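/- Let $M$ be a connected orientable 3-manifold with exactly one end, which is toroidal (the complement of a compact set is $T^2\times(0,\infty)$ with $T^2\times[0,\infty)$ properly embedded in $M$); equivalently, $M$ is homeomorphic to the interior of a compact connected orientable 3-manifold whose boundary is a torus. Let $\hat M$ be its end compactification, obtained by adding one point at infinity. Let $\mathcal T$ be an oriented ideal triangulation of $M$, i.e. $N\ge 2$ oriented ideal tetrahedra with orientation-reversing pairings of all their faces (the two faces of a pair being distinct) whose quotient is homeomorphic to $M$. Let $\mathcal E$ be the set of edges of $\mathcal T$ and $Q$ the set of its $3N$ normal quadrilateral types. The three types in a tetrahedron are cyclically ordered by the orientation, $\square\to\square'\to\square''\to\square$. Let $G(E,\square)$ be the number of tetrahedral edges in the class $E\in\mathcal E$ facing $\square$ and put $l_E(\square)=G(E,\square'')-G(E,\square')$. For an oriented closed normal curve $\gamma$ in the triangulated cusp torus (the link of the ideal vertex), let $G(\gamma,\square)$ be the signed number of corners, on tetrahedral edges facing $\square$, that $\gamma$ goes around. Fix two such curves $\mu,\lambda$ whose classes generate the first integral homology of the cusp torus. Let $\alpha:Q\to\mathbb R$ be a generalised angle structure with peripheral angle-holonomy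 $(x,y)\in\mathbb R^2$: $\alpha(\square)+\alpha(\square')+\alpha(\square'')=\pi$ for all $\square$, $\sum_\square G(E,\square)\alpha(\square)=2\pi$ for all $E$, $\sum_\square G(\mu,\square)\alpha(\square)=x$ and $\sum_\square G(\lambda,\square)\alpha(\square)=y$. Let $\mathcal{SA}_{(e^{ix},e^{iy})}(\mathcal T)$ be the space of $\omega:Q\to S^1$ with $\omega(\square)\omega(\square')\omega(\square'')=-1$ for all $\square$, $\prod_\square\omega(\square)^{G(E,\square)}=1$ for all $E$, $\prod_\square\omega(\square)^{G(\mu,\square)}=e^{ix}$ and $\prod_\square\omega(\square)^{G(\lambda,\square)}=e^{iy}$. Then $|\mathcal E|=N$. Fix an edge $E_0$ and let $$F_{\mathcal T}(w)(\square)=e^{i\alpha(\square)}\prod_{E\ne E_0}w_E^{\,l_E(\square)},\qquad w\in (S^1)^{\mathcal E\setminus\{E_0\}}\cong(S^1)^{N-1}.$$ Then $F_{\mathcal T}$ takes values in $\mathcal{SA}_{(e^{ix},e^{iy})}(\mathcal T)$ and is a covering map onto the connected component of that space containing $e^{i\alpha}$, and its covering degree $d_{\mathcal T}$ equals $|H_1(\hat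 M;\mathbb F_2)|$. In particular, $d_{\mathcal T}$ does not depend on the triangulation: any two ideal triangulations of $M$, with any choices of the remaining data, give the same degree. -/

import Mathlib

open scoped NNReal

/-- An edge of the standard tetrahedron with vertex set `Fin 4`. -/
abbrev TetEdge : Type := {e : Sym2 (Fin 4) // ¬ e.IsDiag}

/-- The three normal quadrilateral types `0, 1, 2` of a tetrahedron face, respectively, the pairs of
opposite edges `01, 23`, then `02, 31`, then `03, 12`.  This is the first edge facing `q`. -/
def TetEdge.fst (q : Fin 3) : TetEdge :=
  ⟨s(0, q.succ), by revert q; decide⟩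

/-- The second edge facing the quadrilateral type `q`, opposite to `TetEdge.fst q`. -/
def TetEdge.snd (q : Fin 3) : TetEdge :=
  ⟨s((q + 1).succ, (q + 2).succ), by revert q; decide⟩

/-- An oriented ideal triangulation: a collection of `N ≥ 2` oriented tetrahedra, with a system
of orientation-reversing pairings of all their faces.  The vertices of each tetrahedron are labelled
by `Fin 4` compatibly with its orientation, and face `i` is the one opposite to vertex `i`.
The face `i` of the tetrahedron `t` is glued to the face `glue t i i` of the tetrahedron `adj t i`
by the affine map sending each vertex `v ≠ i` to the vertex `glue t i v`. -/
structure IdealTriangulation where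
  N : ℕ
  two_le : 2 ≤ N
  adj : Fin N → Fin 4 → Fin N
  glue : Fin N → Fin 4 → Equiv.Perm (Fin 4)
  adj_adj : ∀ t i, adj (adj t i) (glue t i i) = t
  glue_glue : ∀ t i, glue (adj t i) (glue t i i) = (glue t i)⁻¹
  /-- The two faces of a pair are distinct. -/
  ne_self : ∀ t i, (adj t i, glue t i i) ≠ (t, i)
  /-- The pairings reverse the orientation. -/
  sign_glue : ∀ t i, Equiv.Perm.sign (glue t i) = -1

namespace IdealTriangulation

variable (T : IdealTriangulation)

/-! ### The underlying space -/

/-- A point `p` on a face of a tetrahedron is glued to the point `q` of the paired face. -/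
def PointGlued (p q : Fin T.N × stdSimplex ℝ (Fin 4)) : Prop :=
  ∃ i : Fin 4, p.2 i = 0 ∧ q.1 = T.adj p.1 i ∧ ∀ v, q.2 (T.glue p.1 i v) = p.2 v

/-- The space obtained from the (compact) tetrahedra by the face pairings. -/
abbrev Compactified : Type := Quot T.PointGlued

/-- The ideal vertices: the images of the vertices of the tetrahedra. -/
def idealVertices : Set T.Compactified :=
  {P | ∃ (t : Fin T.N) (x : stdSimplex ℝ (Fin 4)) (v : Fin 4), x v = 1 ∧ P = Quot.mk _ (t, x)}

/-- The space obtained from the ideal tetrahedra (with their vertices removed) by the face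
pairings. -/
abbrev Space : Type := {P : T.Compactified // P ∉ T.idealVertices}

/-- `T` is an ideal triangulation of the space `M`. -/
def Triangulates (M : Type) [TopologicalSpace M] : Prop := Nonempty (T.Space ≃ₜ M)

/-! ### Edges, quadrilaterals, leading-trailing deformations -/

/-- The gluing of tetrahedral edges lying on paired faces. -/
def EdgeGlued (e f : Fin T.N × TetEdge) : Prop :=
  ∃ i : Fin 4, i ∉ e.2.1 ∧ f.1 = T.adj e.1 i ∧ f.2.1 = e.2.1.map (T.glue e.1 i)

/-- The edges of the triangulation: the classes of tetrahedral edges under the equivalence relation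
generated by the face pairings. -/
abbrev Edge : Type := Quot T.EdgeGlued

noncomputable instance : Fintype T.Edge := Fintype.ofFinite _

/-- The normal quadrilateral types; `(t, q)` is the type `q` in the tetrahedron `t`. -/
abbrev Quad : Type := Fin T.N × Fin 3

variable {T} in
/-- The cyclic ordering `□ ↦ □'` of the three quadrilateral types in a tetrahedron. -/
def Quad.next (q : T.Quad) : T.Quad := (q.1, q.2 + 1)

open Classical in
/-- `G(E, □)`: the number of tetrahedral edges in the class `E` that face `□`. -/
noncomputable def G (E : T.Edge) (q : T.Quad) : ℤ :=
  (if (Quot.mk _ (q.1, TetEdge.fst q.2) : T.Edge) = E then 1 else 0) +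
    (if (Quot.mk _ (q.1, TetEdge.snd q.2) : T.Edge) = E then 1 else 0)

/-- The leading-trailing deformation about the edge `E`: `l_E(□) = G(E, □'') - G(E, □')`. -/
noncomputable def leadingTrailing (E : T.Edge) (q : T.Quad) : ℤ :=
  T.G E q.next.next - T.G E q.next

/-! ### Peripheral curves

The links of the ideal vertices are triangulated by the triangles `(t, v)`, where `v` is a vertex of
the tetrahedron `t`.  The triangle `(t, v)` has a corner `c` on each edge `vc` (`c ≠ v`), and a side
`f` on each face `f ≠ v`; the side `f` is opposite to the corner `f`. -/

/-- An oriented closed curve in the link of the ideal vertices, in normal position: a cyclic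
sequence of arcs.  The arc `s` lies in the tetrahedron `tet s`; with `π = arc s`, it lies in the
triangle at the vertex `π 0`, enters it through the side `π 1`, leaves it through the side `π 2`, and
so cuts off the corner `π 3`. -/
structure NormalCurve where
  len : ℕ
  tet : Fin (len + 1) → Fin T.N
  arc : Fin (len + 1) → Equiv.Perm (Fin 4)
  tet_succ : ∀ s, tet (s + 1) = T.adj (tet s) (arc s 2)
  vertex_succ : ∀ s, arc (s + 1) 0 = T.glue (tet s) (arc s 2) (arc s 0)
  side_succ : ∀ s, arc (s + 1) 1 = T.glue (tet s) (arc s 2) (arc s 2)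

namespace NormalCurve

variable {T}

/-- `G(γ, □)`: the signed number of arcs of `γ` going around a corner on an edge facing `□`.
The arcs that go around the corner anticlockwise count `1`, the others `-1`. -/
def G (γ : T.NormalCurve) (q : T.Quad) : ℤ :=
  ∑ s, if γ.tet s = q.1 ∧ (s(γ.arc s 0, γ.arc s 3) = (TetEdge.fst q.2).1 ∨
      s(γ.arc s 0, γ.arc s 3) = (TetEdge.snd q.2).1)
    then -((Equiv.Perm.sign (γ.arc s) : ℤˣ) : ℤ) else 0

/-- The 1-chain of `γ` in the dual cell decomposition of the link: the number of times that `γ`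
leaves the triangle `(t, v)` through its side `f`, minus the number of times that it enters there. -/
def chain (γ : T.NormalCurve) (t : Fin T.N) (v f : Fin 4) : ℤ :=
  ∑ s, ((if γ.tet s = t ∧ γ.arc s 0 = v ∧ γ.arc s 2 = f then 1 else 0) -
    (if γ.tet s = t ∧ γ.arc s 0 = v ∧ γ.arc s 1 = f then 1 else 0))

end NormalCurve

/-- Integral 1-cycles of the dual cell decomposition of the link.  The value `z t v f`, `f ≠ v`, is
the coefficient of the dual edge that leaves the triangle `(t, v)` through the side `f`. -/
def IsLinkCycle (z : Fin T.N → Fin 4 → Fin 4 → ℤ) : Prop :=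
  (∀ t v f, f ≠ v → z (T.adj t f) (T.glue t f v) (T.glue t f f) = -z t v f) ∧
    ∀ t v, ∑ f ∈ Finset.univ.erase v, z t v f = 0

/-- Integral 1-boundaries of the dual cell decomposition of the link.  The dual 2-cells are the
vertices of the link, so a 2-chain is a function `h` on the corners `(t, v, c)` that is compatible
with the gluing; the boundary of a dual 2-cell is the loop going around it anticlockwise. -/
def IsLinkBoundary (z : Fin T.N → Fin 4 → Fin 4 → ℤ) : Prop :=
  ∃ h : Fin T.N → Fin 4 → Fin 4 → ℤ,
    (∀ t i v c, v ≠ i → c ≠ i → c ≠ v →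
      h (T.adj t i) (T.glue t i v) (T.glue t i c) = h t v c) ∧
    ∀ t (π : Equiv.Perm (Fin 4)), Equiv.Perm.sign π = -1 →
      z t (π 0) (π 2) = h t (π 0) (π 3) - h t (π 0) (π 1)

/-- The homology classes of `μ` and `ν` generate the first integral homology group of the link. -/
def GeneratesLinkHomology (μ ν : T.NormalCurve) : Prop :=
  ∀ z, T.IsLinkCycle z → ∃ a b : ℤ,
    T.IsLinkBoundary fun t v f ↦ z t v f - (a * μ.chain t v f + b * ν.chain t v f)

/-! ### Angle structures -/

/-- The generalised (real-valued) angle structures `α` with peripheral angle-holonomies `x` along `μ`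
and `y` along `ν`. -/
def angleStructures (μ ν : T.NormalCurve) (x y : ℝ) : Set (T.Quad → ℝ) :=
  {α | (∀ q, α q + α q.next + α q.next.next = Real.pi) ∧
    (∀ E, ∑ q, (T.G E q : ℝ) * α q = 2 * Real.pi) ∧
    ∑ q, (μ.G q : ℝ) * α q = x ∧ ∑ q, (ν.G q : ℝ) * α q = y}

/-- The circle-valued angle structures `ω` with multiplicative peripheral angle-holonomies `ξ` along
`μ` and `η` along `ν`. -/
def circleAngleStructures (μ ν : T.NormalCurve) (ξ η : Circle) : Set (T.Quad → Circle) :=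
  {ω | (∀ q, ((ω q * ω q.next * ω q.next.next : Circle) : ℂ) = -1) ∧
    (∀ E, ∏ q, ω q ^ T.G E q = 1) ∧
    ∏ q, ω q ^ μ.G q = ξ ∧ ∏ q, ω q ^ ν.G q = η}

open Classical in
/-- The leading-trailing parametrisation based at `exp(iα)`, with one circle coordinate for each edge
other than `E₀`: `F(w)(□) = exp(iα(□)) ∏_E w_E ^ l_E(□)`. -/
noncomputable def param (α : T.Quad → ℝ) (E₀ : T.Edge) (w : {E : T.Edge // E ≠ E₀} → Circle)
    (q : T.Quad) : Circle :=
  Circle.exp (α q) * ∏ E : {E : T.Edge // E ≠ E₀}, w E ^ T.leadingTrailing E q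

end IdealTriangulation

/-- `M` has exactly one end, and this end is toroidal: the complement of some compact subset is an
open collar `T² × (0, ∞)`, where `T² × [0, ∞)` is properly embedded in `M`. -/
def HasOneToroidalEnd (M : Type) [TopologicalSpace M] : Prop :=
  ∃ e : (Circle × Circle) × ℝ≥0 → M, Topology.IsClosedEmbedding e ∧
    IsOpen (e '' {p | 0 < p.2}) ∧ IsCompact (e '' {p | 0 < p.2})ᶜ

/-- The map `F`, viewed as a map to the subset `S`, is a covering of degree `d` of the connected
component of `S` containing `b` (and it takes no other values). -/
def IsCoveringOfComponent {X Y : Type} [TopologicalSpace X] [TopologicalSpace Y] (F : X → Y)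
    (S : Set Y) (b : Y) (d : ℕ) : Prop :=
  Set.range F = connectedComponentIn S b ∧ IsCoveringMap (Set.rangeFactorization F) ∧
    ∀ y ∈ Set.range F, (F ⁻¹' {y}).encard = d

/-- The data on which the leading-trailing parametrisation depends: an ideal triangulation `T` of
`M`, peripheral curves `μ`, `ν` generating the first homology of the cusp torus, a generalised angle
structure `α` with peripheral angle-holonomy `(x, y)`, and the edge `E₀` that is left out. -/
structure ParametrisationData (M : Type) [TopologicalSpace M] where
  T : IdealTriangulation
  triangulates : T.Triangulates M
  μ : T.NormalCurve
  ν : T.NormalCurve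
  generates : T.GeneratesLinkHomology μ ν
  x : ℝ
  y : ℝ
  α : T.Quad → ℝ
  mem : α ∈ T.angleStructures μ ν x y
  E₀ : T.Edge

/-- The leading-trailing parametrisation, as a map to
`SA_{(exp(ix), exp(iy))}(T)`, is a covering of degree `d` of the component of `exp(iα)`. -/
def ParametrisationData.HasDegree {M : Type} [TopologicalSpace M] (D : ParametrisationData M)
    (d : ℕ) : Prop :=
  IsCoveringOfComponent (D.T.param D.α D.E₀)
    (D.T.circleAngleStructures D.μ D.ν (Circle.exp D.x) (Circle.exp D.y))
    (fun q ↦ Circle.exp (D.α q)) d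

/-- The first singular homology with `𝔽₂` coefficients of the end compactification of a one-ended
space `M`, which is its one-point compactification. -/
noncomputable def endCompactificationH₁ (M : Type) [TopologicalSpace M] : ModuleCat (ZMod 2) :=
  ((AlgebraicTopology.singularHomologyFunctor (ModuleCat (ZMod 2)) 1).obj
    (ModuleCat.of (ZMod 2) (ZMod 2))).obj (TopCat.of (OnePoint M))

/-! Up to translation by $e^{i\alpha}$ the parametrisation is the homomorphism `paramHom`, which
sends $w$ to the combination $\sum_E w_E\,l_E$ written additively with values in the circle.
Everything is read off from potentials on the cusp link: functions $\rho$ on the sides of the link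
triangles, invariant under gluing, whose difference across each corner is the given function $\beta$
on quadrilaterals.

A combination of leading-trailing deformations has the potential $\rho(v,f)=w(va)+w(vb)-w(ab)$,
where $vab$ is the face opposite $f$ (`isPotential_sideValue`). Its sums telescope around edges and
along closed curves, so the parametrisation lands in the right space. Conversely, a real solution
$\beta$ of the homogeneous equations integrates to a potential, because the edges and the two curves
account for all cycles of the link (`exists_isPotential`), and $w(ab)=(\rho(a,f)+\rho(b,f))/2$
recovers $w$ (`IsPotential.exists_leadingTrailingSum_eq`). Circle-valued solutions near $1$ have
small logarithms that solve the real equations, so the image is open in the group of solutions. It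
is also compact and connected, hence a component, and the degree is the order of the kernel
(`isCoveringOfComponent_of_hom`).

The division by two fails in the circle, and this is where the kernel comes from. If the combination
vanishes, the potential is a constant $s$, since the link is connected. The potentials at the two
ends of an edge add up to $2w(E)$, so $2w(E)=2s$, and $w(E_0)=0$ gives $2s=0$. After adding $s$, the
signs $w$ have sum zero on each face, so they form an $\mathbb F_2$-cocycle
(`cocycleCoords_bijective`).

The space `Compactified` is the one-point compactification of $M$ and has a single vertex, so there
are no nonzero cellular 1-coboundaries and the face cocycles are $H^1(\hat M;\mathbb F_2)$. The
comparison with singular cohomology is made directly. A singular cocycle that vanishes on the edges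
is a coboundary, by contracting open stars of barycentres. Every face cocycle extends, because it
defines a double covering, realised as a map to nonzero real vectors up to sign along which paths
lift. -/

/-! ### Singular homology with coefficients in $\mathbb F_2$ through 1-cocycles -/

section SingularCohomology

open CategoryTheory Limits SSet
open scoped Simplicial

/-- The inclusion of the `i`-th face of the topological simplex. -/
noncomputable def simplexFace {n : ℕ} (i : Fin (n + 2)) :
    C(stdSimplex ℝ (Fin (n + 1)), stdSimplex ℝ (Fin (n + 2))) :=
  ⟨stdSimplex.map i.succAbove, stdSimplex.continuous_map _⟩

/-- Singular 1-cocycles of `X` with coefficients in `𝔽₂`. -/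
def singularOneCocycles (X : Type) [TopologicalSpace X] :
    Submodule (ZMod 2) (C(stdSimplex ℝ (Fin 2), X) → ZMod 2) where
  carrier := {φ | ∀ σ : C(stdSimplex ℝ (Fin 3), X), ∑ i, φ (σ.comp (simplexFace i)) = 0}
  add_mem' {φ ψ} hφ hψ σ := by simp [Finset.sum_add_distrib, hφ σ, hψ σ]
  zero_mem' σ := by simp
  smul_mem' c φ hφ σ := by simp [← Finset.mul_sum, hφ σ]

/-- Singular 1-coboundaries of `X` with coefficients in `𝔽₂`. -/
def IsSingularOneCoboundary {X : Type} [TopologicalSpace X]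
    (φ : C(stdSimplex ℝ (Fin 2), X) → ZMod 2) : Prop :=
  ∃ f : X → ZMod 2, ∀ σ, φ σ = ∑ i, f (σ (stdSimplex.vertex i))

/-- The coefficient module of the singular chains. -/
abbrev coeffModule : ModuleCat (ZMod 2) := ModuleCat.of (ZMod 2) (ZMod 2)

/-- The singular chain complex of `X` with coefficients in `𝔽₂`. -/
noncomputable abbrev singularChains (X : Type) [TopologicalSpace X] :
    ChainComplex (ModuleCat (ZMod 2)) ℕ :=
  (TopCat.toSSet.obj (TopCat.of X)).chainComplex coeffModule

variable {X : Type} [TopologicalSpace X]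

/-- The continuous map underlying a singular simplex. -/
noncomputable def singularSimplexMap {n : ℕ} (x : (TopCat.toSSet.obj (TopCat.of X)) _⦋n⦌) :
    C(stdSimplex ℝ (Fin (n + 1)), X) :=
  TopCat.toSSetObjEquiv (TopCat.of X) _ x

/-- The singular simplex of a continuous map. -/
noncomputable def singularSimplexOf {n : ℕ} (σ : C(stdSimplex ℝ (Fin (n + 1)), X)) :
    (TopCat.toSSet.obj (TopCat.of X)) _⦋n⦌ :=
  (TopCat.toSSetObjEquiv (TopCat.of X) (.op ⦋n⦌)).symm σ

lemma singularSimplexMap_singularSimplexOf {n : ℕ} (σ : C(stdSimplex ℝ (Fin (n + 1)), X)) :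
    singularSimplexMap (singularSimplexOf σ) = σ :=
  (TopCat.toSSetObjEquiv (TopCat.of X) (.op ⦋n⦌)).apply_symm_apply σ

lemma singularSimplexOf_singularSimplexMap {n : ℕ}
    (x : (TopCat.toSSet.obj (TopCat.of X)) _⦋n⦌) :
    singularSimplexOf (singularSimplexMap x) = x :=
  (TopCat.toSSetObjEquiv (TopCat.of X) (.op ⦋n⦌)).symm_apply_apply x

lemma singularSimplexMap_δ {n : ℕ} (x : (TopCat.toSSet.obj (TopCat.of X)) _⦋n + 1⦌)
    (i : Fin (n + 2)) :
    singularSimplexMap ((TopCat.toSSet.obj (TopCat.of X)).δ i x) =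
      (singularSimplexMap x).comp (simplexFace i) := rfl

/-- The morphism out of the singular `n`-chains given by a function on the singular simplices. -/
noncomputable def cochainHom {n : ℕ} (φ : C(stdSimplex ℝ (Fin (n + 1)), X) → ZMod 2) :
    (singularChains X).X n ⟶ coeffModule :=
  Sigma.desc fun x : (TopCat.toSSet.obj (TopCat.of X)) _⦋n⦌ ↦
    φ (singularSimplexMap x) • 𝟙 coeffModule

lemma ι_cochainHom {n : ℕ} (φ : C(stdSimplex ℝ (Fin (n + 1)), X) → ZMod 2)
    (x : (TopCat.toSSet.obj (TopCat.of X)) _⦋n⦌) :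
    (TopCat.toSSet.obj (TopCat.of X)).ιChainComplex x ≫ cochainHom φ =
      φ (singularSimplexMap x) • 𝟙 coeffModule := by
  exact Sigma.ι_desc _ _

/-- Signs disappear modulo two; hence the cocycle condition carries none. -/
lemma neg_one_pow_smul_coeff {M : ModuleCat (ZMod 2)} (f : M ⟶ coeffModule) (i : ℕ) :
    ((-1 : ℤ) ^ i) • f = f := by
  have h : -f = f := by
    ext x
    exact ZMod.neg_eq_self_mod_two _
  rcases neg_one_pow_eq_or ℤ i with hi | hi <;> simp [hi, h]

lemma d_cochainHom {n : ℕ} (φ : C(stdSimplex ℝ (Fin (n + 1)), X) → ZMod 2) :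
    (singularChains X).d (n + 1) n ≫ cochainHom φ =
      cochainHom (fun σ ↦ ∑ i, φ (σ.comp (simplexFace i))) := by
  apply SSet.chainComplex_hom_ext
  intro x
  rw [ι_cochainHom, SSet.ιChainComplex_d_assoc, Preadditive.sum_comp, Finset.sum_smul]
  refine Finset.sum_congr rfl fun i _ ↦ ?_
  rw [Preadditive.zsmul_comp, neg_one_pow_smul_coeff, ι_cochainHom, singularSimplexMap_δ]

lemma exists_cochainHom_eq {n : ℕ} (g : (singularChains X).X n ⟶ coeffModule) :
    ∃ φ : C(stdSimplex ℝ (Fin (n + 1)), X) → ZMod 2, cochainHom φ = g := by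
  refine ⟨fun σ ↦ ((TopCat.toSSet.obj (TopCat.of X)).ιChainComplex (singularSimplexOf σ) ≫ g).hom
    (1 : ZMod 2), ?_⟩
  apply SSet.chainComplex_hom_ext
  intro x
  rw [ι_cochainHom, singularSimplexOf_singularSimplexMap]
  ext
  simp

lemma cochainHom_injective {n : ℕ} {φ ψ : C(stdSimplex ℝ (Fin (n + 1)), X) → ZMod 2}
    (h : cochainHom φ = cochainHom ψ) : φ = ψ := by
  funext σ
  have := congrArg (fun g : (singularChains X).X n ⟶ coeffModule ↦
    ((TopCat.toSSet.obj (TopCat.of X)).ιChainComplex (singularSimplexOf σ) ≫ g).hom (1 : ZMod 2)) h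
  simpa [ι_cochainHom, singularSimplexMap_singularSimplexOf] using this

lemma cochainHom_zero {n : ℕ} :
    cochainHom (0 : C(stdSimplex ℝ (Fin (n + 1)), X) → ZMod 2) = 0 := by
  apply SSet.chainComplex_hom_ext
  intro x
  simp [ι_cochainHom]

lemma d_cochainHom_of_mem {φ : C(stdSimplex ℝ (Fin 2), X) → ZMod 2}
    (hφ : φ ∈ singularOneCocycles X) : (singularChains X).d 2 1 ≫ cochainHom φ = 0 := by
  rw [d_cochainHom, ← cochainHom_zero]
  exact congrArg cochainHom (funext hφ)

/-- The linear form on the first homology group given by a singular 1-cocycle. -/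
noncomputable def homologyForm (φ : singularOneCocycles X) :
    (singularChains X).homology 1 ⟶ coeffModule :=
  (singularChains X).homologyι 1 ≫
    (singularChains X).descOpcycles (cochainHom φ.1) 2 (by simp) (d_cochainHom_of_mem φ.2)

lemma π_homologyForm (φ : singularOneCocycles X) :
    (singularChains X).homologyπ 1 ≫ homologyForm φ =
      (singularChains X).iCycles 1 ≫ cochainHom φ.1 := by
  simp [homologyForm]

lemma homologyForm_add (φ ψ : singularOneCocycles X) :
    homologyForm (φ + ψ) = homologyForm φ + homologyForm ψ := by
  have h : cochainHom (φ + ψ).1 = cochainHom φ.1 + cochainHom ψ.1 := by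
    apply SSet.chainComplex_hom_ext
    intro x
    simp [ι_cochainHom, add_smul]
  rw [← cancel_epi ((singularChains X).homologyπ 1), Preadditive.comp_add, π_homologyForm,
    π_homologyForm, π_homologyForm, h, Preadditive.comp_add]

lemma homologyForm_surjective (χ : (singularChains X).homology 1 ⟶ coeffModule) :
    ∃ φ : singularOneCocycles X, homologyForm φ = χ := by
  -- Over a field the cycles are a direct summand of the chains, so a form on cycles extends to all
  -- chains.
  obtain ⟨p, hp⟩ := LinearMap.exists_leftInverse_of_injective
    ((singularChains X).iCycles 1).hom
    (LinearMap.ker_eq_bot.2 ((ModuleCat.mono_iff_injective _).1 inferInstance))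
  let q : (singularChains X).X 1 ⟶ (singularChains X).cycles 1 := ModuleCat.ofHom p
  have hq : (singularChains X).iCycles 1 ≫ q = 𝟙 _ := by
    ext1
    exact hp
  obtain ⟨φ, hφ⟩ := exists_cochainHom_eq (q ≫ (singularChains X).homologyπ 1 ≫ χ)
  have hd : φ ∈ singularOneCocycles X := by
    have h : (singularChains X).d 2 1 ≫ cochainHom φ = 0 := by
      rw [hφ, ← (singularChains X).toCycles_i 2 1, Category.assoc, reassoc_of% hq,
        HomologicalComplex.toCycles_comp_homologyπ_assoc, zero_comp]
    rw [d_cochainHom, ← cochainHom_zero] at h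
    exact fun σ ↦ congrFun (cochainHom_injective h) σ
  refine ⟨⟨φ, hd⟩, ?_⟩
  rw [← cancel_epi ((singularChains X).homologyπ 1), π_homologyForm]
  dsimp only
  rw [hφ, reassoc_of% hq]

lemma sum_comp_simplexFace (f : X → ZMod 2) (σ : C(stdSimplex ℝ (Fin 2), X)) :
    ∑ i, (fun τ : C(stdSimplex ℝ (Fin 1), X) ↦ f (τ (stdSimplex.vertex 0)))
      (σ.comp (simplexFace i)) = ∑ i, f (σ (stdSimplex.vertex i)) := by
  simp [Fin.sum_univ_two, simplexFace, stdSimplex.map_vertex, add_comm]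

lemma homologyForm_eq_zero_iff (φ : singularOneCocycles X) :
    homologyForm φ = 0 ↔ IsSingularOneCoboundary φ.1 := by
  rw [← cancel_epi ((singularChains X).homologyπ 1), π_homologyForm, comp_zero]
  constructor
  · intro h
    -- Over a field, a form on 1-chains that vanishes on the kernel of the boundary map factors
    -- through that map.
    have hker : (cochainHom φ.1).hom ∈
        LinearMap.range (((singularChains X).d 1 0).hom.dualMap) := by
      rw [LinearMap.range_dualMap_eq_dualAnnihilator_ker, Submodule.mem_dualAnnihilator]
      intro z hz
      let k : coeffModule ⟶ (singularChains X).X 1 := ModuleCat.ofHom (LinearMap.toSpanSingleton _ _ z)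
      have hk : k ≫ (singularChains X).d 1 0 = 0 := by
        ext1
        apply LinearMap.ext_ring
        change ((singularChains X).d 1 0).hom ((1 : ZMod 2) • z) = 0
        rw [one_smul]
        exact hz
      have := congrArg (fun g ↦ ((singularChains X).liftCycles k 0 (by simp) hk ≫ g).hom
        (1 : ZMod 2)) h
      simp only [HomologicalComplex.liftCycles_i_assoc, comp_zero] at this
      have hz' : (cochainHom φ.1).hom ((1 : ZMod 2) • z) = 0 := this
      rwa [one_smul] at hz'
    obtain ⟨ψ, hψ⟩ := hker
    obtain ⟨g, hg⟩ := exists_cochainHom_eq (n := 0) (X := X) (ModuleCat.ofHom ψ)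
    -- Singular 0-simplices are constant maps, so a 0-cochain is a function on the points.
    refine ⟨fun x ↦ g (ContinuousMap.const _ x), fun σ ↦ ?_⟩
    have h1 : (singularChains X).d 1 0 ≫ cochainHom g = cochainHom φ.1 := by
      rw [hg]
      ext1
      exact hψ
    rw [d_cochainHom] at h1
    rw [← cochainHom_injective h1]
    refine Eq.trans ?_ (sum_comp_simplexFace (fun x ↦ g (ContinuousMap.const _ x)) σ)
    refine Finset.sum_congr rfl fun i _ ↦ congrArg g ?_
    ext x
    have : x = stdSimplex.vertex 0 := Subsingleton.elim _ _
    simp [this]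
  · rintro ⟨f, hf⟩
    have h1 : (singularChains X).d 1 0 ≫
        cochainHom (fun τ : C(stdSimplex ℝ (Fin 1), X) ↦ f (τ (stdSimplex.vertex 0))) =
          cochainHom φ.1 := by
      rw [d_cochainHom]
      congr 1
      funext σ
      rw [hf, ← sum_comp_simplexFace]
    rw [← h1, HomologicalComplex.iCycles_d_assoc, zero_comp]

/-- If restriction `r` to a finite group identifies the singular 1-cocycles modulo coboundaries with
it, then this group has as many elements as the first homology group. -/
theorem card_homology_one_eq {Z : Type} [AddCommGroup Z] [Finite Z]
    (r : singularOneCocycles X →+ Z) (hr : Function.Surjective r)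
    (hker : ∀ φ, r φ = 0 ↔ IsSingularOneCoboundary φ.1) :
    Nat.card ((singularChains X).homology 1) = Nat.card Z := by
  let Φ : singularOneCocycles X →+ Module.Dual (ZMod 2) ((singularChains X).homology 1) :=
    AddMonoidHom.mk' (fun φ ↦ (homologyForm φ).hom) fun φ ψ ↦ by
      rw [homologyForm_add]; rfl
  have hΦ : Function.Surjective Φ := fun χ ↦ by
    obtain ⟨φ, hφ⟩ := homologyForm_surjective (ModuleCat.ofHom χ)
    exact ⟨φ, congrArg ModuleCat.Hom.hom hφ⟩
  have hk : Φ.ker = r.ker := by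
    ext φ
    rw [AddMonoidHom.mem_ker, AddMonoidHom.mem_ker, hker, ← homologyForm_eq_zero_iff]
    exact ⟨fun h ↦ by ext1; exact h, fun h ↦ by simp [Φ, h]⟩
  have e : Module.Dual (ZMod 2) ((singularChains X).homology 1) ≃+ Z :=
    (QuotientAddGroup.quotientKerEquivOfSurjective Φ hΦ).symm.trans
      ((QuotientAddGroup.quotientAddEquivOfEq hk).trans
        (QuotientAddGroup.quotientKerEquivOfSurjective r hr))
  -- A finite dual forces finite dimension, and then the space is isomorphic to its dual.
  have : Finite (Module.Dual (ZMod 2) ((singularChains X).homology 1)) := Finite.of_equiv Z e.symm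
  have : Module.Finite (ZMod 2) ((singularChains X).homology 1) := by
    rw [← Module.finite_dual_iff (ZMod 2)]
    exact Module.Finite.of_finite
  rw [← Nat.card_congr e.toEquiv]
  exact Nat.card_congr (Module.Free.chooseBasis (ZMod 2) _).toDualEquiv.toEquiv

end SingularCohomology

/-! ### Orderings of the vertices of a tetrahedron -/

/-- The quadrilateral type facing the edge `ab` of the standard tetrahedron. -/
def quadType (a b : Fin 4) : Fin 3 :=
  (![![0, 0, 1, 2], ![0, 0, 2, 1], ![1, 2, 0, 0], ![2, 1, 0, 0]] : Fin 4 → Fin 4 → Fin 3) a b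

lemma quadType_comm (a b : Fin 4) : quadType a b = quadType b a := by
  revert a b; decide

lemma quadType_eq_iff {a b : Fin 4} (h : a ≠ b) (q : Fin 3) :
    (s(a, b) = (TetEdge.fst q).1 ∨ s(a, b) = (TetEdge.snd q).1) ↔ quadType a b = q := by
  revert a b q; decide

/-- The three edges at a vertex face the three quadrilateral types; the parity of the ordering
decides in which direction the cyclic order runs. -/
lemma quadType_one_of_odd (π : Equiv.Perm (Fin 4)) (h : Equiv.Perm.sign π = -1) :
    quadType (π 0) (π 1) = quadType (π 0) (π 3) + 2 := by
  revert π; decide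

lemma quadType_two_of_odd (π : Equiv.Perm (Fin 4)) (h : Equiv.Perm.sign π = -1) :
    quadType (π 0) (π 2) = quadType (π 0) (π 3) + 1 := by
  revert π; decide

lemma quadType_one_of_even (π : Equiv.Perm (Fin 4)) (h : Equiv.Perm.sign π = 1) :
    quadType (π 0) (π 1) = quadType (π 0) (π 3) + 1 := by
  revert π; decide

lemma quadType_two_of_even (π : Equiv.Perm (Fin 4)) (h : Equiv.Perm.sign π = 1) :
    quadType (π 0) (π 2) = quadType (π 0) (π 3) + 2 := by
  revert π; decide

/-- The edge `ab` of the standard tetrahedron. -/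
def tetEdge (a b : Fin 4) (h : a ≠ b) : TetEdge := ⟨s(a, b), by simpa using h⟩

/-- The odd permutations of the vertices of the standard tetrahedron. -/
abbrev OddPerm : Type := {π : Equiv.Perm (Fin 4) // Equiv.Perm.sign π = -1}

/-- The edge joining the first and the last vertex of an ordering of the vertices. -/
def OddPerm.edge (π : OddPerm) : TetEdge := tetEdge (π.1 0) (π.1 3) (by simp)

/-- An odd ordering is determined by its first and last entries, so each edge occurs once for each
direction. -/
lemma OddPerm.card_edge_eq (e : TetEdge) :
    (Finset.univ.filter fun π : OddPerm ↦ π.edge = e).card = 2 := by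
  revert e; decide +kernel

lemma OddPerm.sum_edge {A : Type*} [AddCommMonoid A] (F : TetEdge → A) :
    ∑ π : OddPerm, F π.edge = 2 • ∑ e, F e := by
  rw [← Finset.sum_fiberwise Finset.univ OddPerm.edge, Finset.smul_sum]
  refine Finset.sum_congr rfl fun e _ ↦ ?_
  rw [Finset.sum_congr rfl (g := fun _ ↦ F e) fun π hπ ↦ by
    rw [(Finset.mem_filter.1 hπ).2], Finset.sum_const, OddPerm.card_edge_eq]

lemma TetEdge.sum_eq {A : Type*} [AddCommMonoid A] (F : TetEdge → A) :
    ∑ e, F e = ∑ q, (F (TetEdge.fst q) + F (TetEdge.snd q)) := by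
  have h : Function.Bijective fun p : Fin 3 × Bool ↦
      if p.2 then TetEdge.fst p.1 else TetEdge.snd p.1 := by decide +kernel
  rw [← h.sum_comp, Fintype.sum_prod_type]
  simp

/-- The first and third entries leave two orderings, of opposite parity; so odd orderings also
enumerate the sides of the link triangles. -/
lemma OddPerm.sum_facet {A : Type*} [AddCommMonoid A] (F : Fin 4 → Fin 4 → A) :
    ∑ π : OddPerm, F (π.1 0) (π.1 2) = ∑ v, ∑ f ∈ Finset.univ.erase v, F v f := by
  have h : Function.Bijective fun π : OddPerm ↦
      (⟨(π.1 0, π.1 2), by simp⟩ : {p : Fin 4 × Fin 4 // p.2 ≠ p.1}) := by decide +kernel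
  rw [h.sum_comp (fun p ↦ F p.1.1 p.1.2)]
  rw [← Finset.sum_subtype (Finset.univ.filter fun p : Fin 4 × Fin 4 ↦ p.2 ≠ p.1) (by simp)
    (fun p ↦ F p.1 p.2), Finset.sum_filter, Fintype.sum_prod_type]
  refine Finset.sum_congr rfl fun v _ ↦ ?_
  rw [← Finset.sum_filter]
  refine Finset.sum_congr ?_ fun _ _ ↦ rfl
  ext; simp

namespace OddPerm

/-- The reversal of the edge of an ordering. -/
def flip (π : OddPerm) : OddPerm :=
  ⟨π.1 * Equiv.swap 0 3 * Equiv.swap 1 2, by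
    rw [map_mul, map_mul, π.2, Equiv.Perm.sign_swap (by decide), Equiv.Perm.sign_swap (by decide)]
    decide⟩

@[simp] lemma flip_zero (π : OddPerm) : π.flip.1 0 = π.1 3 := by
  simp [flip, Equiv.swap_apply_def]
@[simp] lemma flip_one (π : OddPerm) : π.flip.1 1 = π.1 2 := by
  simp [flip, Equiv.swap_apply_def]
@[simp] lemma flip_two (π : OddPerm) : π.flip.1 2 = π.1 1 := by
  simp [flip, Equiv.swap_apply_def]
@[simp] lemma flip_three (π : OddPerm) : π.flip.1 3 = π.1 0 := by
  simp [flip, Equiv.swap_apply_def]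

lemma ext_apply {π τ : OddPerm} (h0 : π.1 0 = τ.1 0) (h1 : π.1 1 = τ.1 1) (h2 : π.1 2 = τ.1 2)
    (h3 : π.1 3 = τ.1 3) : π = τ := by
  ext i
  fin_cases i <;> simp_all

lemma flip_flip (π : OddPerm) : π.flip.flip = π := by
  apply ext_apply <;> simp

/-- The cyclic rotation of the last three entries of an ordering. -/
def rotate (π : OddPerm) : OddPerm :=
  ⟨π.1 * Equiv.swap 1 2 * Equiv.swap 1 3, by
    rw [map_mul, map_mul, π.2, Equiv.Perm.sign_swap (by decide), Equiv.Perm.sign_swap (by decide)]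
    decide⟩

@[simp] lemma rotate_zero (π : OddPerm) : π.rotate.1 0 = π.1 0 := by
  simp [rotate, Equiv.swap_apply_def]
@[simp] lemma rotate_one (π : OddPerm) : π.rotate.1 1 = π.1 3 := by
  simp [rotate, Equiv.swap_apply_def]
@[simp] lemma rotate_two (π : OddPerm) : π.rotate.1 2 = π.1 1 := by
  simp [rotate, Equiv.swap_apply_def]
@[simp] lemma rotate_three (π : OddPerm) : π.rotate.1 3 = π.1 2 := by
  simp [rotate]

lemma rotate_rotate_rotate (π : OddPerm) : π.rotate.rotate.rotate = π := by
  apply ext_apply <;> simp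

/-- Two orderings with the same edge agree or are related by the reversal of the edge. -/
lemma eq_or_eq_flip {π τ : OddPerm} (h : π.edge = τ.edge) : τ = π ∨ τ = π.flip := by
  revert π τ; decide +kernel

lemma exists_edge_eq (e : TetEdge) : ∃ π : OddPerm, π.edge = e := by
  revert e; decide +kernel

lemma exists_facet_eq {v f : Fin 4} (h : f ≠ v) : ∃ π : OddPerm, π.1 0 = v ∧ π.1 2 = f := by
  revert v f; decide +kernel

lemma exists_edge_facet_eq {a b f : Fin 4} (h : a ≠ b) (ha : f ≠ a) (hb : f ≠ b) :
    ∃ π : OddPerm, π.1 2 = f ∧ (π.1 0 = a ∧ π.1 3 = b ∨ π.1 0 = b ∧ π.1 3 = a) := by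
  revert a b f; decide +kernel

end OddPerm

/-! ### Corners of the link triangles and rotation about edges -/

namespace IdealTriangulation

variable (T : IdealTriangulation)

/-- The corners of the triangles in the links of the ideal vertices: `(t, π)` is the corner on the
edge from `π 0` to `π 3` of the tetrahedron `t`, in the triangle at the vertex `π 0`.  Anticlockwise
around the corner, one goes from the side `π 1` to the side `π 2`. -/
abbrev Corner : Type := Fin T.N × OddPerm

variable {T}

namespace Corner

/-- The class of the edge on which the corner lies. -/
def edge (x : T.Corner) : T.Edge := Quot.mk _ (x.1, x.2.edge)

/-- The quadrilateral type facing the edge on which the corner lies. -/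
def quad (x : T.Corner) : T.Quad := (x.1, quadType (x.2.1 0) (x.2.1 3))

/-- The neighbouring corner, anticlockwise around the vertex of the link. -/
def turn (x : T.Corner) : T.Corner :=
  (T.adj x.1 (x.2.1 2), ⟨T.glue x.1 (x.2.1 2) * x.2.1 * Equiv.swap 1 2, by
    rw [map_mul, map_mul, T.sign_glue, x.2.2, Equiv.Perm.sign_swap (by decide)]; decide⟩)

/-- The corner at the other end of the edge. -/
def flip (x : T.Corner) : T.Corner := (x.1, x.2.flip)

@[simp] lemma turn_fst (x : T.Corner) : x.turn.1 = T.adj x.1 (x.2.1 2) := rfl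
@[simp] lemma turn_zero (x : T.Corner) :
    x.turn.2.1 0 = T.glue x.1 (x.2.1 2) (x.2.1 0) := by
  simp [turn, Equiv.swap_apply_def]
@[simp] lemma turn_one (x : T.Corner) :
    x.turn.2.1 1 = T.glue x.1 (x.2.1 2) (x.2.1 2) := by
  simp [turn]
@[simp] lemma turn_two (x : T.Corner) :
    x.turn.2.1 2 = T.glue x.1 (x.2.1 2) (x.2.1 1) := by
  simp [turn]
@[simp] lemma turn_three (x : T.Corner) :
    x.turn.2.1 3 = T.glue x.1 (x.2.1 2) (x.2.1 3) := by
  simp [turn, Equiv.swap_apply_def]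
@[simp] lemma flip_fst (x : T.Corner) : x.flip.1 = x.1 := rfl
@[simp] lemma flip_snd (x : T.Corner) : x.flip.2 = x.2.flip := rfl

lemma ext_apply {x y : T.Corner} (h : x.1 = y.1) (h0 : x.2.1 0 = y.2.1 0)
    (h1 : x.2.1 1 = y.2.1 1) (h2 : x.2.1 2 = y.2.1 2) (h3 : x.2.1 3 = y.2.1 3) : x = y :=
  Prod.ext h (OddPerm.ext_apply h0 h1 h2 h3)

lemma flip_flip (x : T.Corner) : x.flip.flip = x :=
  Prod.ext rfl (OddPerm.flip_flip _)

/-- Seen from the other end of the edge, an anticlockwise turn is clockwise: `flip` conjugates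
`turn` to its inverse. -/
lemma turn_flip_turn (x : T.Corner) : x.turn.flip.turn = x.flip := by
  apply ext_apply <;> simp [T.adj_adj, T.glue_glue]

lemma turn_bijective : Function.Bijective (turn : T.Corner → T.Corner) := by
  have h1 : Function.LeftInverse (fun x : T.Corner ↦ x.flip.turn.flip) turn := fun x ↦ by
    simp [turn_flip_turn, flip_flip]
  exact Finite.injective_iff_bijective.1 h1.injective

lemma flip_involutive : Function.Involutive (flip : T.Corner → T.Corner) := flip_flip

lemma quad_flip (x : T.Corner) : x.flip.quad = x.quad := by
  simp [quad, quadType_comm]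

lemma flip_ne (x : T.Corner) : x.flip ≠ x := fun h ↦ by
  have := congrArg (fun y : T.Corner ↦ y.2.1 0) h
  simp at this

/-- Equality would glue the face crossed by the turn to itself. -/
lemma turn_ne_flip (x : T.Corner) : x.turn ≠ x.flip := fun h ↦ by
  refine T.ne_self x.1 (x.2.1 2) (Prod.ext (show x.turn.1 = x.flip.1 by rw [h]) ?_)
  simpa using congrArg (fun y : T.Corner ↦ y.2.1 1) h

lemma flip_eq_of_iterate (n : ℕ) (x y : T.Corner) (h : turn^[n] x = y) :
    turn^[n] y.flip = x.flip := by
  induction n generalizing x y with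
  | zero => simp_all
  | succ n ih =>
    rw [Function.iterate_succ_apply'] at h
    subst h
    rw [Function.iterate_succ_apply, turn_flip_turn]
    exact ih _ _ rfl

/-- No edge is glued to its reversal. -/
lemma iterate_turn_ne_flip (n : ℕ) (x : T.Corner) : turn^[n] x ≠ x.flip := by
  intro h
  -- If turning reversed the edge, the sequence of corners would be a palindrome up to `flip`. At
  -- its middle a corner would equal its own flip ($n$ even), or its turn would equal its flip ($n$
  -- odd).
  rcases Nat.even_or_odd' n with ⟨m, rfl | rfl⟩
  · have h1 := flip_eq_of_iterate m x _ rfl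
    rw [two_mul, Function.iterate_add_apply] at h
    have h2 : turn^[m] (turn^[m] x).flip = turn^[m] (turn^[m] x) := by rw [h1, h]
    exact flip_ne _ ((turn_bijective.injective.iterate m) h2)
  · have h1 := flip_eq_of_iterate m x _ rfl
    have h2 : turn^[m] (turn^[m] x).flip = turn^[m] (turn^[m] x).turn := by
      rw [h1, ← h, show 2 * m + 1 = m + (m + 1) by ring, Function.iterate_add_apply,
        Function.iterate_succ_apply']
    exact turn_ne_flip _ ((turn_bijective.injective.iterate m) h2).symm

lemma edge_turn (x : T.Corner) : x.turn.edge = x.edge := by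
  refine (Quot.sound ⟨x.2.1 2, ?_, rfl, ?_⟩).symm
  · simp [OddPerm.edge, tetEdge]
  · simp [OddPerm.edge, tetEdge]

/-- A function on the corners that is invariant under both the rotation about the edge and the
exchange of the ends is a function on the edges. -/
lemma exists_edge_function {A : Type*} (H : T.Corner → A) (ht : ∀ x, H x.turn = H x)
    (hf : ∀ x, H x.flip = H x) : ∃ η : T.Edge → A, ∀ x, H x = η x.edge := by
  choose π hπ using OddPerm.exists_edge_eq
  have key (x y : T.Corner) (h1 : x.1 = y.1) (h2 : x.2.edge = y.2.edge) : H x = H y := by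
    rcases OddPerm.eq_or_eq_flip h2 with h | h
    · rw [show y = x from Prod.ext h1.symm h]
    · rw [show y = x.flip from Prod.ext h1.symm h, hf]
  refine ⟨Quot.lift (fun p ↦ H (p.1, π p.2)) ?_, fun x ↦ key _ _ rfl (hπ _).symm⟩
  rintro ⟨t, e⟩ ⟨t', e'⟩ ⟨i, hi, h1, h2⟩
  dsimp only at hi h1 h2 ⊢
  have hmem : ∀ x : T.Corner, x.1 = t → x.2.edge = e → x.2.1 2 = i → H x = H (t', π e') := by
    rintro x rfl rfl rfl
    rw [← ht x]
    refine key _ _ h1.symm (Subtype.ext ?_)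
    rw [hπ, h2]
    simp [OddPerm.edge, tetEdge]
  have he : (π e).edge = e := hπ e
  have hi' : i = (π e).1 1 ∨ i = (π e).1 2 := by
    obtain ⟨j, rfl⟩ := (π e).1.surjective i
    have hj : j ≠ 0 ∧ j ≠ 3 := by
      rw [show e.1 = s((π e).1 0, (π e).1 3) from congrArg Subtype.val he.symm] at hi
      simpa using hi
    have : j = 1 ∨ j = 2 := by omega
    exact this.imp (congrArg _) (congrArg _)
  -- Two faces contain the edge. Crossing the third vertex's face is a turn; the other one becomes a
  -- turn after a flip.
  rcases hi' with rfl | rfl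
  · rw [← hf]
    refine hmem (flip (t, π e)) rfl ?_ (by simp)
    refine Eq.trans (Subtype.ext ?_) he
    simp [OddPerm.edge, tetEdge, Sym2.eq_swap]
  · exact hmem (t, π e) rfl he rfl

end Corner

-- Each tetrahedral edge carries two corners, one at each end; this is the source of the factor two.
open Classical in
lemma two_nsmul_sum_G {A : Type*} [AddCommGroup A] (E : T.Edge) (f : T.Quad → A) :
    2 • ∑ q, T.G E q • f q = ∑ x : T.Corner, if x.edge = E then f x.quad else 0 := by
  rw [Fintype.sum_prod_type, Fintype.sum_prod_type, Finset.smul_sum]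
  refine Finset.sum_congr rfl fun t _ ↦ ?_
  have hq : ∀ π : OddPerm, ∀ q, (π.edge = TetEdge.fst q ∨ π.edge = TetEdge.snd q) →
      quadType (π.1 0) (π.1 3) = q := fun π q h ↦ by
    rw [← quadType_eq_iff (by simp)]
    exact h.imp (congrArg Subtype.val) (congrArg Subtype.val)
  obtain ⟨F, hF⟩ : ∃ F : TetEdge → Fin 3, ∀ π : OddPerm, F π.edge = quadType (π.1 0) (π.1 3) := by
    refine ⟨fun e ↦ quadType ((OddPerm.exists_edge_eq e).choose.1 0)
      ((OddPerm.exists_edge_eq e).choose.1 3), fun π ↦ ?_⟩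
    have h := (OddPerm.exists_edge_eq π.edge).choose_spec
    dsimp only
    rcases OddPerm.eq_or_eq_flip h.symm with h | h <;> rw [h]
    simp [quadType_comm]
  have := OddPerm.sum_edge fun e ↦ if (Quot.mk _ (t, e) : T.Edge) = E then f (t, F e) else 0
  simp only [hF] at this
  refine Eq.trans ?_ this.symm
  rw [TetEdge.sum_eq]
  congr 1
  refine Finset.sum_congr rfl fun q _ ↦ ?_
  obtain ⟨π, h1⟩ := OddPerm.exists_edge_eq (TetEdge.fst q)
  obtain ⟨τ, h2⟩ := OddPerm.exists_edge_eq (TetEdge.snd q)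
  have e1 : F (TetEdge.fst q) = q := by rw [← h1, hF]; exact hq _ _ (Or.inl h1)
  have e2 : F (TetEdge.snd q) = q := by rw [← h2, hF]; exact hq _ _ (Or.inr h2)
  rw [e1, e2, G, add_smul]
  congr 1 <;> split_ifs <;> simp_all

open Classical in
lemma sum_edge_G (q : T.Quad) : ∑ E, T.G E q = 2 := by
  simp only [G, Finset.sum_add_distrib, Finset.sum_ite_eq, Finset.mem_univ, if_true]
  norm_num

/-- This relation allows one edge $E_0$ to be left out of the coordinates. -/
lemma sum_edge_leadingTrailing (q : T.Quad) : ∑ E, T.leadingTrailing E q = 0 := by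
  simp [leadingTrailing, Finset.sum_sub_distrib, sum_edge_G]

end IdealTriangulation

/-! ### The number of edges, and potentials on the link -/

namespace IdealTriangulation

variable {T : IdealTriangulation}

/-- The number of edges of an ideal triangulation with a generalised angle structure is the number
of tetrahedra. -/
theorem card_edge_eq {μ ν : T.NormalCurve} {x y : ℝ} {α : T.Quad → ℝ}
    (hα : α ∈ T.angleStructures μ ν x y) : Nat.card T.Edge = T.N := by
  obtain ⟨h1, h2, -, -⟩ := hα
  have h3 : ∑ q, α q = Real.pi * T.N := by
    rw [Fintype.sum_prod_type, Finset.sum_congr rfl (g := fun _ ↦ Real.pi) fun t _ ↦ ?_]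
    · simp [mul_comm]
    · rw [Fin.sum_univ_three]
      exact h1 (t, 0)
  -- Each quadrilateral faces two tetrahedral edges, so adding up the edge equations gives
  -- $2\pi|\mathcal E|=2\pi N$.
  have h4 : ∑ E, ∑ q, (T.G E q : ℝ) * α q = 2 * ∑ q, α q := by
    rw [Finset.sum_comm, Finset.mul_sum]
    refine Finset.sum_congr rfl fun q _ ↦ ?_
    rw [← Finset.sum_mul]
    exact_mod_cast congrArg (fun n : ℤ ↦ (n : ℝ) * α q) (sum_edge_G q)
  simp only [h2, Finset.sum_const, Finset.card_univ, nsmul_eq_mul, h3] at h4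
  rw [Nat.card_eq_fintype_card]
  have : (Fintype.card T.Edge : ℝ) = T.N := by
    nlinarith [Real.pi_pos]
  exact_mod_cast this

section Potential

variable {A : Type*} [AddCommGroup A]

/-- `ρ` is a function on the sides of the link triangles, compatible with the gluing; its differences
along the corners are given by `β`. -/
structure IsPotential (β : T.Quad → A) (ρ : Fin T.N → Fin 4 → Fin 4 → A) : Prop where
  glue : ∀ t v f, f ≠ v → ρ (T.adj t f) (T.glue t f v) (T.glue t f f) = ρ t v f
  sub : ∀ x : T.Corner, ρ x.1 (x.2.1 0) (x.2.1 2) - ρ x.1 (x.2.1 0) (x.2.1 1) = β x.quad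

lemma IsPotential.sub_perm {β : T.Quad → A} {ρ : Fin T.N → Fin 4 → Fin 4 → A}
    (h : IsPotential β ρ) (t : Fin T.N) (π : Equiv.Perm (Fin 4)) :
    ρ t (π 0) (π 2) - ρ t (π 0) (π 1) =
      (-((Equiv.Perm.sign π : ℤˣ) : ℤ)) • β (t, quadType (π 0) (π 3)) := by
  rcases Int.units_eq_one_or (Equiv.Perm.sign π) with hπ | hπ
  · have h1 : Equiv.Perm.sign (π * Equiv.swap 1 2) = -1 := by
      rw [map_mul, hπ, Equiv.Perm.sign_swap (by decide)]; decide
    have := h.sub (t, ⟨_, h1⟩)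
    simp only [Corner.quad, Equiv.Perm.mul_apply, Equiv.swap_apply_left, Equiv.swap_apply_right,
      Equiv.swap_apply_of_ne_of_ne (show (0 : Fin 4) ≠ 1 by decide) (show (0 : Fin 4) ≠ 2 by decide),
      Equiv.swap_apply_of_ne_of_ne (show (3 : Fin 4) ≠ 1 by decide)
        (show (3 : Fin 4) ≠ 2 by decide)] at this
    rw [hπ, ← this]
    simp
  · rw [hπ, h.sub (t, ⟨π, hπ⟩)]
    simp [Corner.quad]

/-- The sum telescopes around the edge: the side through which a corner is left is the side through
which the next one is entered. The factor two must stay because $A$ may have torsion. -/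
lemma IsPotential.two_nsmul_sum_G {β : T.Quad → A} {ρ : Fin T.N → Fin 4 → Fin 4 → A}
    (h : IsPotential β ρ) (E : T.Edge) : 2 • ∑ q, T.G E q • β q = 0 := by
  classical
  rw [IdealTriangulation.two_nsmul_sum_G]
  have h1 (x : T.Corner) : (if x.edge = E then β x.quad else 0) =
      (if x.edge = E then ρ x.1 (x.2.1 0) (x.2.1 2) else 0) -
        (if x.edge = E then ρ x.1 (x.2.1 0) (x.2.1 1) else 0) := by
    split_ifs <;> simp [h.sub]
  rw [Finset.sum_congr rfl fun x _ ↦ h1 x, Finset.sum_sub_distrib, sub_eq_zero,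
    ← Corner.turn_bijective.sum_comp fun x : T.Corner ↦
      if x.edge = E then ρ x.1 (x.2.1 0) (x.2.1 1) else 0]
  refine Finset.sum_congr rfl fun x _ ↦ ?_
  simp only [Corner.edge_turn, Corner.turn_fst, Corner.turn_zero, Corner.turn_one]
  rw [h.glue _ _ _ (by simp)]

lemma NormalCurve.sum_G (γ : T.NormalCurve) (β : T.Quad → A) :
    ∑ q, γ.G q • β q = ∑ s, (-((Equiv.Perm.sign (γ.arc s) : ℤˣ) : ℤ)) •
      β (γ.tet s, quadType (γ.arc s 0) (γ.arc s 3)) := by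
  classical
  simp only [NormalCurve.G, Finset.sum_smul]
  rw [Finset.sum_comm]
  refine Finset.sum_congr rfl fun s _ ↦ ?_
  rw [Finset.sum_eq_single (γ.tet s, quadType (γ.arc s 0) (γ.arc s 3))]
  · rw [if_pos ⟨rfl, (quadType_eq_iff (by simp) _).2 rfl⟩]
  · intro q _ hq
    rw [if_neg, zero_smul]
    rintro ⟨h1, h2⟩
    rw [quadType_eq_iff (by simp)] at h2
    exact hq (Prod.ext h1.symm h2.symm)
  · simp

/-- Each arc contributes the potential at its exit minus that at its entrance, which telescopes
along the closed curve. -/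
lemma IsPotential.sum_curve {β : T.Quad → A} {ρ : Fin T.N → Fin 4 → Fin 4 → A}
    (h : IsPotential β ρ) (γ : T.NormalCurve) : ∑ q, γ.G q • β q = 0 := by
  rw [γ.sum_G]
  simp only [← h.sub_perm]
  rw [Finset.sum_sub_distrib, sub_eq_zero,
    ← Equiv.sum_comp (Equiv.addRight 1) fun s ↦ ρ (γ.tet s) (γ.arc s 0) (γ.arc s 1)]
  refine Finset.sum_congr rfl fun s _ ↦ ?_
  rw [Equiv.coe_addRight, γ.tet_succ, γ.vertex_succ, γ.side_succ, h.glue _ _ _ (by simp)]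

end Potential

/-! ### The potential of a combination of leading-trailing deformations -/

section EdgeFunction

variable {A : Type*} [AddCommGroup A]

/-- The value of a function on the edges at the edge `ab` of the tetrahedron `t`. -/
def edgeValue (w : T.Edge → A) (t : Fin T.N) (a b : Fin 4) : A :=
  if h : a ≠ b then w (Quot.mk _ (t, tetEdge a b h)) else 0

lemma edgeValue_comm (w : T.Edge → A) (t : Fin T.N) (a b : Fin 4) :
    edgeValue w t a b = edgeValue w t b a := by
  unfold edgeValue
  by_cases h : a = b
  · simp [h]
  · rw [dif_pos h, dif_pos (Ne.symm h)]
    exact congrArg w (congrArg (Quot.mk _) (Prod.ext rfl (Subtype.ext Sym2.eq_swap)))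

lemma edgeValue_glue (w : T.Edge → A) (t : Fin T.N) {a b f : Fin 4} (ha : f ≠ a) (hb : f ≠ b) :
    edgeValue w (T.adj t f) (T.glue t f a) (T.glue t f b) = edgeValue w t a b := by
  unfold edgeValue
  by_cases h : a = b
  · simp [h]
  · rw [dif_pos (by simpa using h), dif_pos h]
    refine congrArg w (Quot.sound ⟨f, ?_, rfl, ?_⟩).symm
    · simp [tetEdge, ha, hb]
    · simp [tetEdge]

lemma edgeValue_corner (w : T.Edge → A) (x : T.Corner) :
    edgeValue w x.1 (x.2.1 0) (x.2.1 3) = w x.edge := by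
  rw [edgeValue, dif_pos (by simp)]
  rfl

/-- The combination of the leading-trailing deformations with the coefficients `w`. -/
noncomputable def leadingTrailingSum (w : T.Edge → A) (q : T.Quad) : A :=
  ∑ E, T.leadingTrailing E q • w E

/-- The sum of the values at the two edges facing a quadrilateral. -/
def facingSum (w : T.Edge → A) (q : T.Quad) : A :=
  w (Quot.mk _ (q.1, TetEdge.fst q.2)) + w (Quot.mk _ (q.1, TetEdge.snd q.2))

open Classical in
lemma sum_G_smul (w : T.Edge → A) (q : T.Quad) : ∑ E, T.G E q • w E = facingSum w q := by
  simp only [G, add_smul, ite_smul, one_smul, zero_smul, Finset.sum_add_distrib,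
    Finset.sum_ite_eq, Finset.mem_univ, if_true]
  rfl

lemma leadingTrailingSum_eq (w : T.Edge → A) (q : T.Quad) :
    leadingTrailingSum w q = facingSum w q.next.next - facingSum w q.next := by
  simp only [leadingTrailingSum, leadingTrailing, sub_smul, Finset.sum_sub_distrib, sum_G_smul]

lemma facingSum_eq (w : T.Edge → A) (t : Fin T.N) (π : Equiv.Perm (Fin 4)) :
    facingSum w (t, quadType (π 0) (π 3)) =
      edgeValue w t (π 0) (π 3) + edgeValue w t (π 1) (π 2) := by
  have h : ∀ π : Equiv.Perm (Fin 4),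
      (s(π 0, π 3) = (TetEdge.fst (quadType (π 0) (π 3))).1 ∧
        s(π 1, π 2) = (TetEdge.snd (quadType (π 0) (π 3))).1) ∨
      (s(π 1, π 2) = (TetEdge.fst (quadType (π 0) (π 3))).1 ∧
        s(π 0, π 3) = (TetEdge.snd (quadType (π 0) (π 3))).1) := by decide
  rw [edgeValue, edgeValue, dif_pos (by simp), dif_pos (by simp), facingSum]
  rcases h π with ⟨h1, h2⟩ | ⟨h1, h2⟩
  · congr 4 <;> exact Subtype.ext (by assumption) |>.symm
  · rw [add_comm]
    congr 4 <;> exact Subtype.ext (by assumption) |>.symm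

/-- One of the two vertices other than `v` and `f`; the other one is `thirdVertex f v`. -/
def thirdVertex (v f : Fin 4) : Fin 4 :=
  (![![0, 2, 3, 1], ![3, 0, 0, 2], ![1, 3, 0, 0], ![2, 0, 1, 0]] : Fin 4 → Fin 4 → Fin 4) v f

lemma thirdVertex_perm (π : Equiv.Perm (Fin 4)) :
    thirdVertex (π 0) (π 2) = π 1 ∧ thirdVertex (π 2) (π 0) = π 3 ∨
      thirdVertex (π 0) (π 2) = π 3 ∧ thirdVertex (π 2) (π 0) = π 1 := by
  revert π; decide

/-- The potential of a combination of leading-trailing deformations. -/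
def sideValue (w : T.Edge → A) (t : Fin T.N) (v f : Fin 4) : A :=
  edgeValue w t v (thirdVertex v f) + edgeValue w t v (thirdVertex f v) -
    edgeValue w t (thirdVertex v f) (thirdVertex f v)

lemma sideValue_perm (w : T.Edge → A) (t : Fin T.N) (π : Equiv.Perm (Fin 4)) :
    sideValue w t (π 0) (π 2) =
      edgeValue w t (π 0) (π 1) + edgeValue w t (π 0) (π 3) - edgeValue w t (π 1) (π 3) := by
  rcases thirdVertex_perm π with ⟨h1, h2⟩ | ⟨h1, h2⟩
  · rw [sideValue, h1, h2]
  · rw [sideValue, h1, h2, edgeValue_comm w t (π 3) (π 1), add_comm (edgeValue w t (π 0) (π 3))]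

/-- The value at a side involves only the edges of one face, so gluing preserves it. The two sides
at a corner share the term of the corner's own edge; it cancels, and what remains is the difference
of the sums over the other two pairs of opposite edges. -/
lemma isPotential_sideValue (w : T.Edge → A) :
    IsPotential (leadingTrailingSum w) (sideValue w) where
  glue t v f h := by
    obtain ⟨π, rfl, rfl⟩ := OddPerm.exists_facet_eq h
    have := sideValue_perm w (T.adj t (π.1 2)) (T.glue t (π.1 2) * π.1)
    simp only [Equiv.Perm.mul_apply] at this
    rw [this, sideValue_perm, edgeValue_glue, edgeValue_glue, edgeValue_glue] <;> simp
  sub x := by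
    have h1 := sideValue_perm w x.1 x.2.1
    have h2 := sideValue_perm w x.1 (x.2.1 * Equiv.swap 1 2)
    have h3 := facingSum_eq w x.1 (x.2.1 * Equiv.swap 1 3)
    have h4 := facingSum_eq w x.1 (x.2.1 * Equiv.swap 2 3)
    simp only [Equiv.Perm.mul_apply, Equiv.swap_apply_left, Equiv.swap_apply_right,
      Equiv.swap_apply_of_ne_of_ne (show (0 : Fin 4) ≠ 1 by decide) (show (0 : Fin 4) ≠ 2 by decide),
      Equiv.swap_apply_of_ne_of_ne (show (0 : Fin 4) ≠ 1 by decide) (show (0 : Fin 4) ≠ 3 by decide),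
      Equiv.swap_apply_of_ne_of_ne (show (0 : Fin 4) ≠ 2 by decide) (show (0 : Fin 4) ≠ 3 by decide),
      Equiv.swap_apply_of_ne_of_ne (show (2 : Fin 4) ≠ 1 by decide) (show (2 : Fin 4) ≠ 3 by decide),
      Equiv.swap_apply_of_ne_of_ne (show (1 : Fin 4) ≠ 2 by decide) (show (1 : Fin 4) ≠ 3 by decide),
      Equiv.swap_apply_of_ne_of_ne (show (3 : Fin 4) ≠ 1 by decide)
        (show (3 : Fin 4) ≠ 2 by decide)] at h2 h3 h4
    have h5 : x.quad.next = (x.1, quadType (x.2.1 0) (x.2.1 2)) := by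
      rw [quadType_two_of_odd _ x.2.2]; rfl
    have h6 : x.quad.next.next = (x.1, quadType (x.2.1 0) (x.2.1 1)) := by
      rw [quadType_one_of_odd _ x.2.2, Quad.next, Quad.next, add_assoc]; rfl
    rw [leadingTrailingSum_eq, h6, h5, h1, h2, h3, h4, edgeValue_comm w x.1 (x.2.1 3) (x.2.1 2)]
    abel

end EdgeFunction

end IdealTriangulation

/-! ### Exactness: real solutions of the homogeneous equations are leading-trailing combinations -/

namespace IdealTriangulation

variable {T : IdealTriangulation}

section Exactness

/-- A function on the corners that is invariant under rotation is orthogonal to every function on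
the quadrilaterals with vanishing sums around the edges. -/
lemma sum_corner_eq_zero {β : T.Quad → ℝ} (hE : ∀ E, ∑ q, (T.G E q : ℝ) * β q = 0)
    (h : T.Corner → ℝ) (ht : ∀ x, h x.turn = h x) : ∑ x : T.Corner, h x * β x.quad = 0 := by
  classical
  have hft (x : T.Corner) : h x.turn.flip = h x.flip := by
    rw [← ht x.turn.flip, Corner.turn_flip_turn]
  -- The two ends of an edge are different vertices of the link, where $h$ may take different
  -- values; only their sum is a function of the edge. This suffices because `β x.quad` does not see
  -- the end.
  obtain ⟨η, hη⟩ := Corner.exists_edge_function (fun x ↦ h x + h x.flip)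
    (fun x ↦ by simp only [ht, hft]) (fun x ↦ by simp only [Corner.flip_flip, add_comm])
  have h1 : ∑ x : T.Corner, h x.flip * β x.quad = ∑ x : T.Corner, h x * β x.quad := by
    rw [← (Corner.flip_involutive (T := T)).bijective.sum_comp]
    simp only [Corner.flip_flip, Corner.quad_flip]
  have h2 : ∑ x : T.Corner, (h x + h x.flip) * β x.quad = 0 := by
    simp only [hη]
    have h3 (x : T.Corner) : η x.edge * β x.quad =
        ∑ E, η E * (if x.edge = E then β x.quad else 0) := by
      simp
    simp only [h3]
    rw [Finset.sum_comm]
    refine Finset.sum_eq_zero fun E _ ↦ ?_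
    have h4 := two_nsmul_sum_G E β
    simp only [zsmul_eq_mul, hE, smul_zero] at h4
    rw [← Finset.mul_sum, ← h4, mul_zero]
  simp only [add_mul, Finset.sum_add_distrib, h1] at h2
  linarith

/-- The function on the sides of each link triangle with sum zero and differences `β`. -/
noncomputable def centredPotential (β : T.Quad → ℝ) (t : Fin T.N) (v f : Fin 4) : ℝ :=
  (β (t, quadType v f + 2) - β (t, quadType v f + 1)) / 3

lemma centredPotential_sub {β : T.Quad → ℝ} (h3 : ∀ q, β q + β q.next + β q.next.next = 0)
    (x : T.Corner) : centredPotential β x.1 (x.2.1 0) (x.2.1 2) -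
      centredPotential β x.1 (x.2.1 0) (x.2.1 1) = β x.quad := by
  have h := h3 x.quad
  simp only [centredPotential, quadType_one_of_odd _ x.2.2, quadType_two_of_odd _ x.2.2]
  simp only [Corner.quad, Quad.next, add_assoc] at h ⊢
  generalize quadType (x.2.1 0) (x.2.1 3) = q at h ⊢
  rw [show q + (1 + 2) = q by rw [show (1 + 2 : Fin 3) = 0 by decide, add_zero],
    show q + (2 + 2) = q + 1 by rw [show (2 + 2 : Fin 3) = 1 by decide],
    show q + (2 + 1) = q by rw [show (2 + 1 : Fin 3) = 0 by decide, add_zero]]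
  rw [show q + (1 + 1) = q + 2 by rw [show (1 + 1 : Fin 3) = 2 by decide]] at h ⊢
  linarith

lemma centredPotential_sub_perm {β : T.Quad → ℝ}
    (h3 : ∀ q, β q + β q.next + β q.next.next = 0) (t : Fin T.N) (π : Equiv.Perm (Fin 4)) :
    centredPotential β t (π 0) (π 2) - centredPotential β t (π 0) (π 1) =
      (-((Equiv.Perm.sign π : ℤˣ) : ℤ)) • β (t, quadType (π 0) (π 3)) := by
  rcases Int.units_eq_one_or (Equiv.Perm.sign π) with hπ | hπ
  · have h := h3 (t, quadType (π 0) (π 3))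
    simp only [centredPotential, quadType_one_of_even _ hπ, quadType_two_of_even _ hπ]
    simp only [Quad.next, add_assoc] at h ⊢
    generalize quadType (π 0) (π 3) = q at h ⊢
    rw [show q + (1 + 2) = q by rw [show (1 + 2 : Fin 3) = 0 by decide, add_zero],
      show q + (2 + 2) = q + 1 by rw [show (2 + 2 : Fin 3) = 1 by decide],
      show q + (2 + 1) = q by rw [show (2 + 1 : Fin 3) = 0 by decide, add_zero]]
    rw [show q + (1 + 1) = q + 2 by rw [show (1 + 1 : Fin 3) = 2 by decide]] at h ⊢
    rw [hπ]
    simp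
    linarith
  · rw [hπ, centredPotential_sub h3 (t, ⟨π, hπ⟩)]
    simp [Corner.quad]

/-- The pairing of 1-chains in the links with a function on the sides. -/
def linkPairing (κ z : Fin T.N → Fin 4 → Fin 4 → ℝ) : ℝ :=
  ∑ t, ∑ v, ∑ f ∈ Finset.univ.erase v, z t v f * κ t v f

lemma linkPairing_eq_sum_corner (κ z : Fin T.N → Fin 4 → Fin 4 → ℝ) :
    linkPairing κ z =
      ∑ x : T.Corner, z x.1 (x.2.1 0) (x.2.1 2) * κ x.1 (x.2.1 0) (x.2.1 2) := by
  rw [Fintype.sum_prod_type]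
  exact Finset.sum_congr rfl fun t _ ↦ (OddPerm.sum_facet fun v f ↦ z t v f * κ t v f).symm

lemma linkPairing_add (κ z z' : Fin T.N → Fin 4 → Fin 4 → ℝ) :
    linkPairing κ (z + z') = linkPairing κ z + linkPairing κ z' := by
  simp [linkPairing, add_mul, Finset.sum_add_distrib]

lemma linkPairing_smul (κ z : Fin T.N → Fin 4 → Fin 4 → ℝ) (a : ℝ) :
    linkPairing κ (a • z) = a * linkPairing κ z := by
  simp only [linkPairing, Pi.smul_apply, smul_eq_mul, Finset.mul_sum, mul_assoc]

/-- Summation by parts turns the pairing with a boundary into a sum of $h\beta$ over the corners,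
which the edge equations annihilate. -/
lemma linkPairing_boundary {β : T.Quad → ℝ} (h3 : ∀ q, β q + β q.next + β q.next.next = 0)
    (hE : ∀ E, ∑ q, (T.G E q : ℝ) * β q = 0) {z : Fin T.N → Fin 4 → Fin 4 → ℤ}
    (hz : T.IsLinkBoundary z) :
    linkPairing (centredPotential β) (fun t v f ↦ (z t v f : ℝ)) = 0 := by
  obtain ⟨h, h1, h2⟩ := hz
  rw [linkPairing_eq_sum_corner]
  let κ := centredPotential β
  -- Rotating the three sides of each link triangle brings both terms of the boundary to the same
  -- corner.
  have h4 : ∑ x : T.Corner, (h x.1 (x.2.1 0) (x.2.1 1) : ℝ) * κ x.1 (x.2.1 0) (x.2.1 2) =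
      ∑ x : T.Corner, (h x.1 (x.2.1 0) (x.2.1 3) : ℝ) * κ x.1 (x.2.1 0) (x.2.1 1) := by
    let c : T.Corner → T.Corner := fun x ↦ (x.1, x.2.rotate)
    have hc : Function.Bijective c := by
      have : Function.LeftInverse (c ∘ c) c := fun x ↦
        Prod.ext rfl (OddPerm.rotate_rotate_rotate x.2)
      exact Finite.injective_iff_bijective.1 this.injective
    rw [← hc.sum_comp]
    simp [c]
  have h5 := sum_corner_eq_zero hE (fun x ↦ (h x.1 (x.2.1 0) (x.2.1 3) : ℝ)) fun x ↦ by
    rw [Corner.turn_fst, Corner.turn_zero, Corner.turn_three, h1] <;> simp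
  simp only [← centredPotential_sub h3, mul_sub, Finset.sum_sub_distrib] at h5
  rw [← h5, ← h4, ← Finset.sum_sub_distrib]
  refine Finset.sum_congr rfl fun x _ ↦ ?_
  rw [h2 x.1 x.2.1 x.2.2]
  push_cast
  ring

/-- Within a triangle the centred potential has differences $\beta$, so exit minus entrance of an
arc is the signed value of $\beta$ at the corner cut off. -/
lemma linkPairing_chain {β : T.Quad → ℝ} (h3 : ∀ q, β q + β q.next + β q.next.next = 0)
    (γ : T.NormalCurve) :
    linkPairing (centredPotential β) (fun t v f ↦ (γ.chain t v f : ℝ)) =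
      ∑ q, (γ.G q : ℝ) * β q := by
  have h1 := γ.sum_G β
  simp only [zsmul_eq_mul] at h1
  rw [h1]
  have h2 : ∀ s i, i ≠ 0 → linkPairing (centredPotential β) (fun t v f ↦
      if γ.tet s = t ∧ γ.arc s 0 = v ∧ γ.arc s i = f then (1 : ℝ) else 0) =
        centredPotential β (γ.tet s) (γ.arc s 0) (γ.arc s i) := by
    intro s i hi
    rw [linkPairing, Finset.sum_eq_single (γ.tet s), Finset.sum_eq_single (γ.arc s 0),
      Finset.sum_eq_single (γ.arc s i)]
    · simp
    · intro f _ hf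
      rw [if_neg fun h ↦ hf h.2.2.symm, zero_mul]
    · intro h
      simp [hi] at h
    · intro v _ hv
      exact Finset.sum_eq_zero fun f _ ↦ by rw [if_neg fun h ↦ hv h.2.1.symm, zero_mul]
    · simp
    · intro t _ ht
      exact Finset.sum_eq_zero fun v _ ↦ Finset.sum_eq_zero fun f _ ↦ by
        rw [if_neg fun h ↦ ht h.1.symm, zero_mul]
    · simp
  have h4 := fun s ↦ centredPotential_sub_perm h3 (γ.tet s) (γ.arc s)
  simp only [zsmul_eq_mul] at h4
  simp only [← h4]
  have h5 := fun s ↦ (h2 s 2 (by decide)).symm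
  have h6 := fun s ↦ (h2 s 1 (by decide)).symm
  simp only [h5, h6]
  simp only [NormalCurve.chain, linkPairing, ← Finset.sum_sub_distrib, ← sub_mul]
  push_cast
  simp only [Finset.sum_mul]
  symm
  rw [Finset.sum_comm]
  refine Finset.sum_congr rfl fun t _ ↦ ?_
  rw [Finset.sum_comm]
  refine Finset.sum_congr rfl fun v _ ↦ ?_
  rw [Finset.sum_comm]

/-- The elementary 1-chain along the dual edge through the side `f` of the triangle `(t, v)`. -/
def dualEdge (t : Fin T.N) (v f : Fin 4) (t' : Fin T.N) (v' f' : Fin 4) : ℤ :=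
  (if t' = t ∧ v' = v ∧ f' = f then 1 else 0) -
    (if t' = T.adj t f ∧ v' = T.glue t f v ∧ f' = T.glue t f f then 1 else 0)

/-- Antisymmetry of 1-chains of the dual cell decomposition. -/
def IsLinkChain (z : Fin T.N → Fin 4 → Fin 4 → ℤ) : Prop :=
  ∀ t v f, f ≠ v → z (T.adj t f) (T.glue t f v) (T.glue t f f) = -z t v f

/-- `z` is a 1-chain with boundary `[b] - [a]`, up to sign. -/
def IsLinkPath (a b : Fin T.N × Fin 4) (z : Fin T.N → Fin 4 → Fin 4 → ℤ) : Prop :=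
  IsLinkChain z ∧ ∀ t v, ∑ f ∈ Finset.univ.erase v, z t v f =
    (if (t, v) = a then 1 else 0) - (if (t, v) = b then 1 else 0)

/-- The triangles `a` and `b` of the links share a side. -/
def VertexGlued (a b : Fin T.N × Fin 4) : Prop :=
  ∃ f, f ≠ a.2 ∧ b = (T.adj a.1 f, T.glue a.1 f a.2)

lemma glue_glue_apply (t : Fin T.N) (i v : Fin 4) :
    T.glue (T.adj t i) (T.glue t i i) (T.glue t i v) = v := by
  simp [T.glue_glue]

lemma isLinkPath_dualEdge (t : Fin T.N) (v f : Fin 4) (h : f ≠ v) :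
    IsLinkPath (t, v) (T.adj t f, T.glue t f v) (dualEdge t v f) := by
  constructor
  · intro t' v' f' _
    have h1 : (T.adj t' f' = T.adj t f ∧ T.glue t' f' v' = T.glue t f v ∧
        T.glue t' f' f' = T.glue t f f) ↔ (t' = t ∧ v' = v ∧ f' = f) := by
      constructor
      · rintro ⟨h1, h2, h3⟩
        have e1 : t' = t := by rw [← T.adj_adj t' f', h1, h3, T.adj_adj]
        have e2 := glue_glue_apply t' f' f'
        have e3 := glue_glue_apply t' f' v'
        rw [h1, h3, glue_glue_apply] at e2
        rw [h1, h2, h3, glue_glue_apply] at e3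
        exact ⟨e1, e3.symm, e2.symm⟩
      · rintro ⟨rfl, rfl, rfl⟩; exact ⟨rfl, rfl, rfl⟩
    have h2 : (T.adj t' f' = t ∧ T.glue t' f' v' = v ∧ T.glue t' f' f' = f) ↔
        (t' = T.adj t f ∧ v' = T.glue t f v ∧ f' = T.glue t f f) := by
      constructor
      · rintro ⟨rfl, rfl, rfl⟩
        simp only [T.adj_adj, glue_glue_apply, and_self]
      · rintro ⟨rfl, rfl, rfl⟩
        simp only [T.adj_adj, glue_glue_apply, and_self]
    simp only [dualEdge, h1, h2, neg_sub]
  · intro t' v'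
    simp only [dualEdge, Finset.sum_sub_distrib]
    congr 1
    · by_cases h' : t' = t ∧ v' = v
      · obtain ⟨rfl, rfl⟩ := h'
        simp [h]
      · rw [if_neg fun h2 ↦ h' (by simpa using h2)]
        exact Finset.sum_eq_zero fun f' _ ↦ if_neg fun h2 ↦ h' ⟨h2.1, h2.2.1⟩
    · by_cases h' : t' = T.adj t f ∧ v' = T.glue t f v
      · obtain ⟨rfl, rfl⟩ := h'
        simp [h]
      · rw [if_neg fun h2 ↦ h' (by simpa using h2)]
        exact Finset.sum_eq_zero fun f' _ ↦ if_neg fun h2 ↦ h' ⟨h2.1, h2.2.1⟩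

lemma IsLinkPath.add {a b c : Fin T.N × Fin 4} {z z' : Fin T.N → Fin 4 → Fin 4 → ℤ}
    (h : IsLinkPath a b z) (h' : IsLinkPath b c z') : IsLinkPath a c (z + z') := by
  refine ⟨fun t v f hf ↦ ?_, fun t v ↦ ?_⟩
  · simp [h.1 t v f hf, h'.1 t v f hf, add_comm]
  · simp [Finset.sum_add_distrib, h.2, h'.2]

lemma IsLinkPath.neg {a b : Fin T.N × Fin 4} {z : Fin T.N → Fin 4 → Fin 4 → ℤ}
    (h : IsLinkPath a b z) : IsLinkPath b a (-z) := by
  refine ⟨fun t v f hf ↦ ?_, fun t v ↦ ?_⟩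
  · simp [h.1 t v f hf]
  · simp [Finset.sum_neg_distrib, h.2]

lemma exists_isLinkPath {a b : Fin T.N × Fin 4} (h : Relation.EqvGen VertexGlued a b) :
    ∃ z, IsLinkPath a b z := by
  induction h with
  | rel a b h =>
    obtain ⟨f, hf, rfl⟩ := h
    exact ⟨_, isLinkPath_dualEdge a.1 a.2 f hf⟩
  | refl a => exact ⟨0, fun t v f _ ↦ by simp, fun t v ↦ by simp⟩
  | symm a b _ ih => obtain ⟨z, hz⟩ := ih; exact ⟨_, hz.neg⟩
  | trans a b c _ _ ih ih' =>
    obtain ⟨z, hz⟩ := ih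
    obtain ⟨z', hz'⟩ := ih'
    exact ⟨_, hz.add hz'⟩

lemma linkPairing_dualEdge (κ : Fin T.N → Fin 4 → Fin 4 → ℝ) {t : Fin T.N} {v f : Fin 4}
    (h : f ≠ v) : linkPairing κ (fun t' v' f' ↦ (dualEdge t v f t' v' f' : ℝ)) =
      κ t v f - κ (T.adj t f) (T.glue t f v) (T.glue t f f) := by
  have key : ∀ (t : Fin T.N) (v f : Fin 4), f ≠ v → ∑ t', ∑ v', ∑ f' ∈ Finset.univ.erase v',
      (if t' = t ∧ v' = v ∧ f' = f then (1 : ℝ) else 0) * κ t' v' f' = κ t v f := by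
    intro t v f h
    rw [Finset.sum_eq_single t, Finset.sum_eq_single v, Finset.sum_eq_single f]
    · simp
    · intro f' _ hf
      rw [if_neg fun h ↦ hf h.2.2, zero_mul]
    · intro h'
      simp [h] at h'
    · intro v' _ hv
      exact Finset.sum_eq_zero fun f _ ↦ by rw [if_neg fun h ↦ hv h.2.1, zero_mul]
    · simp
    · intro t' _ ht
      exact Finset.sum_eq_zero fun v _ ↦ Finset.sum_eq_zero fun f _ ↦ by
        rw [if_neg fun h ↦ ht h.1, zero_mul]
    · simp
  rw [← key t v f h, ← key (T.adj t f) (T.glue t f v) (T.glue t f f) (by simpa using h)]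
  simp only [linkPairing, dualEdge, ← Finset.sum_sub_distrib, ← sub_mul]
  push_cast
  rfl

/-- A function on the quadrilaterals with vanishing sums over the tetrahedra, around the edges, and
along two curves that generate the homology of the link, has a potential. -/
theorem exists_isPotential {μ ν : T.NormalCurve} (hgen : T.GeneratesLinkHomology μ ν)
    {β : T.Quad → ℝ} (h3 : ∀ q, β q + β q.next + β q.next.next = 0)
    (hE : ∀ E, ∑ q, (T.G E q : ℝ) * β q = 0) (hμ : ∑ q, (μ.G q : ℝ) * β q = 0)
    (hν : ∑ q, (ν.G q : ℝ) * β q = 0) : ∃ ρ, IsPotential β ρ := by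
  let κ := centredPotential β
  -- A cycle is a boundary plus a combination of the two curves: the edge equations annihilate the
  -- boundary, and the vanishing holonomies annihilate the curves.
  have hcycle : ∀ z, T.IsLinkCycle z → linkPairing κ (fun t v f ↦ (z t v f : ℝ)) = 0 := by
    intro z hz
    obtain ⟨a, b, hab⟩ := hgen z hz
    have h1 := linkPairing_boundary h3 hE hab
    have h2 : (fun t v f ↦ (z t v f : ℝ)) =
        (fun t v f ↦ ((z t v f - (a * μ.chain t v f + b * ν.chain t v f) : ℤ) : ℝ)) +
          ((a : ℝ) • (fun t v f ↦ (μ.chain t v f : ℝ)) +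
            (b : ℝ) • (fun t v f ↦ (ν.chain t v f : ℝ))) := by
      funext t v f
      simp
    rw [h2, linkPairing_add, linkPairing_add, linkPairing_smul, linkPairing_smul, h1,
      linkPairing_chain h3, linkPairing_chain h3, hμ, hν]
    simp
  have hpath : ∀ a b z z', IsLinkPath a b z → IsLinkPath a b z' →
      linkPairing κ (fun t v f ↦ (z t v f : ℝ)) = linkPairing κ (fun t v f ↦ (z' t v f : ℝ)) := by
    intro a b z z' hz hz'
    have h1 := hz.add hz'.neg
    have h2 := hcycle (z + -z') ⟨h1.1, fun t v ↦ by rw [h1.2]; simp⟩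
    have h5 : (fun t v f ↦ (((z + -z') t v f : ℤ) : ℝ)) =
        (fun t v f ↦ (z t v f : ℝ)) + (-1 : ℝ) • (fun t v f ↦ (z' t v f : ℝ)) := by
      funext t v f
      simp
    rw [h5, linkPairing_add, linkPairing_smul] at h2
    linarith
  let S := Relation.EqvGen.setoid (VertexGlued (T := T))
  -- Each component of the link receives a base triangle; the path from it to a given triangle may
  -- be chosen freely, by `hpath`.
  have hex : ∀ a : Fin T.N × Fin 4, ∃ z, IsLinkPath (Quotient.mk S a).out a z := fun a ↦
    exists_isLinkPath (Quotient.exact (Quotient.out_eq (Quotient.mk S a)))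
  choose Z hZ using hex
  -- The centred potential jumps across a side by its pairing with the dual edge. Adding to each
  -- triangle the total jump along a path from the base triangle removes all jumps and leaves the
  -- differences inside triangles unchanged.
  refine ⟨fun t v f ↦ linkPairing κ (fun t' v' f' ↦ (Z (t, v) t' v' f' : ℝ)) + κ t v f, ?_, ?_⟩
  · intro t v f hf
    have h1 : (Quotient.mk S (t, v)) = Quotient.mk S (T.adj t f, T.glue t f v) :=
      Quotient.sound (Relation.EqvGen.rel _ _ ⟨f, hf, rfl⟩)
    have h2 := (hZ (t, v)).add (isLinkPath_dualEdge t v f hf)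
    have h4 := hZ (T.adj t f, T.glue t f v)
    rw [← h1] at h4
    have h5 := hpath _ _ _ _ h4 h2
    have h6 : (fun t' v' f' ↦ (((Z (t, v) + dualEdge t v f) t' v' f' : ℤ) : ℝ)) =
        (fun t' v' f' ↦ (Z (t, v) t' v' f' : ℝ)) +
          (fun t' v' f' ↦ (dualEdge t v f t' v' f' : ℝ)) := by
      funext t v f
      simp
    rw [h6, linkPairing_add, linkPairing_dualEdge κ hf] at h5
    rw [h5]
    ring
  · intro x
    rw [add_sub_add_left_eq_sub]
    exact centredPotential_sub h3 x

/-- A real function on the quadrilaterals with a potential is a combination of leading-trailing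
deformations. -/
theorem IsPotential.exists_leadingTrailingSum_eq {β : T.Quad → ℝ}
    {ρ : Fin T.N → Fin 4 → Fin 4 → ℝ} (h : IsPotential β ρ) :
    ∃ w : T.Edge → ℝ, β = leadingTrailingSum w := by
  -- The corners at the two ends have the same difference $\beta$ with the sides exchanged, so the
  -- sum over both ends is the same for the two faces at the edge.
  have hflip (x : T.Corner) :
      ρ x.1 (x.2.1 0) (x.2.1 1) + ρ x.1 (x.2.1 3) (x.2.1 1) =
        ρ x.1 (x.2.1 0) (x.2.1 2) + ρ x.1 (x.2.1 3) (x.2.1 2) := by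
    have h1 := h.sub x
    have h2 := h.sub x.flip
    rw [Corner.quad_flip] at h2
    simp at h2
    linarith
  -- This inverts $\rho(v,f)=\eta(va)+\eta(vb)-\eta(ab)$ on each face. The division by two is
  -- possible over $\mathbb R$ but ambiguous in the circle, which is what produces the covering
  -- degree.
  obtain ⟨η, hη⟩ := Corner.exists_edge_function (T := T)
    (fun x ↦ (ρ x.1 (x.2.1 0) (x.2.1 2) + ρ x.1 (x.2.1 3) (x.2.1 2)) / 2)
    (fun x ↦ by
      rw [← hflip]
      simp only [Corner.turn_fst, Corner.turn_zero, Corner.turn_one, Corner.turn_three]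
      rw [h.glue _ _ _ (by simp), h.glue _ _ _ (by simp)])
    (fun x ↦ by
      simp only [Corner.flip_fst, Corner.flip_snd, OddPerm.flip_zero, OddPerm.flip_two,
        OddPerm.flip_three]
      rw [← hflip, add_comm])
  have hval (t : Fin T.N) (a b f : Fin 4) (hab : a ≠ b) (ha : f ≠ a) (hb : f ≠ b) :
      edgeValue η t a b = (ρ t a f + ρ t b f) / 2 := by
    obtain ⟨π, rfl, ⟨rfl, rfl⟩ | ⟨rfl, rfl⟩⟩ := OddPerm.exists_edge_facet_eq hab ha hb
    · rw [edgeValue_corner η (t, π), ← hη]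
    · rw [edgeValue_comm, edgeValue_corner η (t, π), ← hη, add_comm]
  have hside (t : Fin T.N) (π : Equiv.Perm (Fin 4)) :
      sideValue η t (π 0) (π 2) = ρ t (π 0) (π 2) := by
    rw [sideValue_perm, hval t (π 0) (π 1) (π 2), hval t (π 0) (π 3) (π 2),
      hval t (π 1) (π 3) (π 2)]
    · ring
    all_goals simp
  refine ⟨η, funext fun q ↦ ?_⟩
  obtain ⟨x, rfl⟩ : ∃ x : T.Corner, x.quad = q := by
    obtain ⟨π, hπ⟩ : ∃ π : OddPerm, quadType (π.1 0) (π.1 3) = q.2 := by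
      generalize q.2 = i
      revert i; decide +kernel
    exact ⟨(q.1, π), Prod.ext rfl hπ⟩
  rw [← h.sub x, ← (isPotential_sideValue η).sub x, hside]
  have := hside x.1 (x.2.1 * Equiv.swap 1 2)
  simp only [Equiv.Perm.mul_apply, Equiv.swap_apply_right,
    Equiv.swap_apply_of_ne_of_ne (show (0 : Fin 4) ≠ 1 by decide)
      (show (0 : Fin 4) ≠ 2 by decide)] at this
  rw [this]

end Exactness

end IdealTriangulation

/-! ### Homomorphisms of compact groups as coverings -/

section TranslatedHom

open Topology

/-- A translate of a continuous homomorphism with finite kernel from a compact connected group is a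
covering of a connected component of every coset of a subgroup in which its image is open. -/
theorem isCoveringOfComponent_of_hom {K Y : Type} [CommGroup K] [TopologicalSpace K]
    [IsTopologicalGroup K] [CompactSpace K] [ConnectedSpace K] [T2Space K] [CommGroup Y]
    [TopologicalSpace Y] [IsTopologicalGroup Y] [T2Space Y] (h : K →* Y) (hc : Continuous h)
    [Finite h.ker] (b : Y) (S₀ : Subgroup Y) (S : Set Y) (hS : ∀ y, b * y ∈ S ↔ y ∈ S₀)
    (hle : h.range ≤ S₀) {U : Set Y} (hU : U ∈ 𝓝 1) (hUS : ∀ y ∈ U, y ∈ S₀ → y ∈ h.range)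
    {F : K → Y} (hF : ∀ w, F w = b * h w) :
    IsCoveringOfComponent F S b (Nat.card h.ker) := by
  have hFc : Continuous F := by
    rw [show F = fun w ↦ b * h w from funext hF]
    fun_prop
  have hb : b ∈ Set.range F := ⟨1, by simp [hF]⟩
  have hrS : Set.range F ⊆ S := by
    rintro _ ⟨w, rfl⟩
    rw [hF, hS]
    exact hle ⟨w, rfl⟩
  refine ⟨?_, ?_, ?_⟩
  · refine Set.Subset.antisymm
      ((isPreconnected_range hFc).subset_connectedComponentIn hb hrS) ?_
    obtain ⟨V, hVU, hV, h1V⟩ := mem_nhds_iff.1 hU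
    -- Translates of the neighbourhood of $1$ form an open set in which $S$ coincides with the
    -- image. As the image is also compact, it is open and closed in $S$.
    let W : Set Y := ⋃ w, (F w * ·) '' V
    have hW : IsOpen W := isOpen_iUnion fun w ↦ (Homeomorph.mulLeft (F w)).isOpenMap V hV
    have hFW : Set.range F ⊆ W := by
      rintro _ ⟨w, rfl⟩
      exact Set.mem_iUnion.2 ⟨w, 1, h1V, mul_one _⟩
    have hWS : ∀ y ∈ W, y ∈ S → y ∈ Set.range F := by
      intro y hy hyS
      obtain ⟨w, u, hu, rfl⟩ := Set.mem_iUnion.1 hy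
      dsimp only at hyS ⊢
      rw [hF, mul_assoc, hS] at hyS
      have h1 : u ∈ S₀ := (S₀.mul_mem_cancel_left (hle ⟨w, rfl⟩)).1 hyS
      obtain ⟨w', rfl⟩ := hUS u (hVU hu) h1
      exact ⟨w * w', by rw [hF, hF, map_mul, mul_assoc]⟩
    intro y hy
    by_contra hyF
    have hcl : IsClosed (Set.range F) := (isCompact_range hFc).isClosed
    obtain ⟨z, hz, hzW, hzF⟩ := (isPreconnected_connectedComponentIn (F := S) (x := b)) W
      (Set.range F)ᶜ hW hcl.isOpen_compl
      (fun z _ ↦ (em (z ∈ Set.range F)).imp (fun h ↦ hFW h) id)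
      ⟨b, mem_connectedComponentIn (hrS hb), hFW hb⟩ ⟨y, hy, hyF⟩
    exact hzF (hWS z hzW (connectedComponentIn_subset _ _ hz))
  · have hq : IsQuotientMap h.rangeRestrict := by
      have hc' : Continuous h.rangeRestrict := hc.subtype_mk _
      exact hc'.isClosedMap.isQuotientMap hc' h.rangeRestrict_surjective
    have hdisc : IsDiscrete (h.rangeRestrict.ker : Set K) := by
      rw [MonoidHom.ker_rangeRestrict]
      have : DiscreteTopology (h.ker : Set K) := Finite.instDiscreteTopology
      exact ⟨this⟩
    have hcov := (hq.isQuotientCoveringMap_of_isDiscrete_ker_monoidHom hdisc).isCoveringMap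
    let e : h.range ≃ₜ Set.range F := (Homeomorph.mulLeft b).subtype fun y ↦ by
      constructor
      · rintro ⟨w, rfl⟩
        exact ⟨w, hF w⟩
      · rintro ⟨w, hw⟩
        rw [hF] at hw
        exact ⟨w, mul_left_cancel hw⟩
    have h1 : Set.rangeFactorization F = e ∘ h.rangeRestrict := by
      funext w
      exact Subtype.ext (hF w)
    rw [h1]
    exact hcov.homeomorph_comp e
  · rintro _ ⟨w, rfl⟩
    -- Each fibre is a translate of the kernel.
    have h1 : F ⁻¹' {F w} = (w * ·) '' (h.ker : Set K) := by
      ext w'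
      simp only [Set.mem_preimage, Set.mem_singleton_iff, Set.mem_image, hF, mul_right_inj]
      constructor
      · intro hw
        exact ⟨w⁻¹ * w', by simp [MonoidHom.mem_ker, hw], by simp⟩
      · rintro ⟨u, hu, rfl⟩
        rw [map_mul, (MonoidHom.mem_ker).1 hu, mul_one]
    rw [h1, (mul_right_injective w).encard_image, Set.encard, ENat.card_eq_coe_natCard]
    rfl

end TranslatedHom

/-! ### Cocycles on faces and vanishing leading-trailing sums -/

namespace IdealTriangulation

variable (T : IdealTriangulation)

/-- The functions on the edges with values in `𝔽₂` whose sums over the three edges of each face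
vanish. -/
def faceCocycles : AddSubgroup (T.Edge → ZMod 2) where
  carrier := {c | ∀ t a b d, edgeValue c t a b + edgeValue c t b d + edgeValue c t a d = 0}
  zero_mem' t a b d := by simp [edgeValue]
  add_mem' {c c'} hc hc' t a b d := by
    have h (t a b) : edgeValue (c + c') t a b = edgeValue c t a b + edgeValue c' t a b := by
      unfold edgeValue
      split_ifs <;> simp
    have h1 := congrArg₂ (· + ·) (hc t a b d) (hc' t a b d)
    simp only [h, add_zero] at h1 ⊢
    rw [← h1]
    abel
  neg_mem' {c} hc := by
    have h : -c = c := funext fun E ↦ ZMod.neg_eq_self_mod_two _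
    rwa [h]

variable {T}

/-- Degenerate triples impose no condition in characteristic two. -/
lemma mem_faceCocycles_of_perm {c : T.Edge → ZMod 2}
    (h : ∀ t (π : Equiv.Perm (Fin 4)), edgeValue c t (π 0) (π 1) + edgeValue c t (π 0) (π 3) +
      edgeValue c t (π 1) (π 3) = 0) : c ∈ T.faceCocycles := by
  intro t a b d
  have h0 (a) : edgeValue c t a a = 0 := by simp [edgeValue]
  by_cases h1 : a = b
  · subst h1
    rw [h0, zero_add, CharTwo.add_self_eq_zero]
  by_cases h2 : b = d
  · subst h2
    rw [h0, add_zero, CharTwo.add_self_eq_zero]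
  by_cases h3 : a = d
  · subst h3
    rw [h0, add_zero, edgeValue_comm c t b a, CharTwo.add_self_eq_zero]
  obtain ⟨π, rfl, rfl, rfl⟩ : ∃ π : Equiv.Perm (Fin 4), π 0 = a ∧ π 1 = b ∧ π 3 = d := by
    revert a b d; decide +kernel
  have := h t π
  rw [add_right_comm] at this
  exact this

lemma edgeValue_map {A B : Type*} [AddCommGroup A] [AddCommGroup B] (f : A →+ B) (w : T.Edge → A)
    (t : Fin T.N) (a b : Fin 4) : edgeValue (f ∘ w) t a b = f (edgeValue w t a b) := by
  unfold edgeValue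
  split_ifs <;> simp

lemma leadingTrailingSum_map {A B : Type*} [AddCommGroup A] [AddCommGroup B] (f : A →+ B)
    (w : T.Edge → A) (q : T.Quad) :
    leadingTrailingSum (f ∘ w) q = f (leadingTrailingSum w q) := by
  simp [leadingTrailingSum]

lemma leadingTrailingSum_add_const {A : Type*} [AddCommGroup A] (w : T.Edge → A) (a : A)
    (q : T.Quad) : leadingTrailingSum (fun E ↦ w E + a) q = leadingTrailingSum w q := by
  simp [leadingTrailingSum, Finset.sum_add_distrib, ← Finset.sum_smul, sum_edge_leadingTrailing]

lemma exists_corner_quad_eq (q : T.Quad) : ∃ x : T.Corner, x.quad = q := by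
  obtain ⟨π, hπ⟩ : ∃ π : OddPerm, quadType (π.1 0) (π.1 3) = q.2 := by
    generalize q.2 = i
    revert i; decide +kernel
  exact ⟨(q.1, π), Prod.ext rfl hπ⟩

/-- In characteristic two the potential at a side is the sum over the edges of a face, so a cocycle
has potential zero. -/
lemma leadingTrailingSum_eq_zero_of_mem {c : T.Edge → ZMod 2} (hc : c ∈ T.faceCocycles)
    (q : T.Quad) : leadingTrailingSum c q = 0 := by
  obtain ⟨x, rfl⟩ := exists_corner_quad_eq q
  have h (t v f) : sideValue c t v f = 0 := by
    rw [sideValue, CharTwo.sub_eq_add, add_right_comm]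
    exact hc t _ _ _
  rw [← (isPotential_sideValue c).sub x, h, h, sub_zero]

/-- The telescoping sum is applied to the indicator of `E'`; over the integers the factor two can be
cancelled. -/
lemma leadingTrailing_orthogonal_edge (E E' : T.Edge) :
    ∑ q, T.G E q * T.leadingTrailing E' q = 0 := by
  classical
  have h := (isPotential_sideValue (Pi.single E' (1 : ℤ))).two_nsmul_sum_G E
  simpa [leadingTrailingSum, Pi.single_apply] using h

lemma leadingTrailing_orthogonal_curve (γ : T.NormalCurve) (E' : T.Edge) :
    ∑ q, γ.G q * T.leadingTrailing E' q = 0 := by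
  classical
  have h := (isPotential_sideValue (Pi.single E' (1 : ℤ))).sum_curve γ
  simpa [leadingTrailingSum, Pi.single_apply] using h

lemma leadingTrailing_sum_tetrahedron (E : T.Edge) (q : T.Quad) :
    T.leadingTrailing E q + T.leadingTrailing E q.next + T.leadingTrailing E q.next.next = 0 := by
  have h : q.next.next.next = q := Prod.ext rfl (by
    simp only [Quad.next, add_assoc]
    rw [show (1 + (1 + 1) : Fin 3) = 0 by decide, add_zero])
  simp only [leadingTrailing, h]
  ring

/-- If the leading-trailing sums of `w` vanish and the link is connected, then the potential of `w` is
constant. -/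
lemma exists_const_of_leadingTrailingSum_eq_zero {A : Type*} [AddCommGroup A]
    (hconn : ∀ a b : Fin T.N × Fin 4, Relation.EqvGen VertexGlued a b) {w : T.Edge → A}
    (hw : ∀ q, leadingTrailingSum w q = 0) :
    ∃ s : A, ∀ t v f, f ≠ v → sideValue w t v f = s := by
  have hρ := isPotential_sideValue w
  have h1 (t : Fin T.N) (v f f' : Fin 4) (hf : f ≠ v) (hf' : f' ≠ v) :
      sideValue w t v f = sideValue w t v f' := by
    by_cases h : f = f'
    · rw [h]
    · obtain ⟨π, rfl, rfl, rfl⟩ : ∃ π : Equiv.Perm (Fin 4), π 0 = v ∧ π 2 = f ∧ π 1 = f' := by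
        revert v f f'; decide +kernel
      rw [← sub_eq_zero, hρ.sub_perm, hw, smul_zero]
  have h2 : ∀ v : Fin 4, v + 1 ≠ v := by decide
  have h3 : ∀ a b : Fin T.N × Fin 4, Relation.EqvGen VertexGlued a b →
      sideValue w a.1 a.2 (a.2 + 1) = sideValue w b.1 b.2 (b.2 + 1) := by
    intro a b h
    induction h with
    | rel a b h =>
      obtain ⟨f, hf, rfl⟩ := h
      rw [h1 _ _ (a.2 + 1) f (h2 _) hf, ← hρ.glue _ _ _ hf]
      exact h1 _ _ _ _ (by simpa using hf) (h2 _)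
    | refl => rfl
    | symm _ _ _ ih => exact ih.symm
    | trans _ _ _ _ _ ih ih' => exact ih.trans ih'
  have t₀ : Fin T.N := ⟨0, lt_of_lt_of_le (by norm_num) T.two_le⟩
  exact ⟨sideValue w t₀ 0 1, fun t v f hf ↦ (h1 t v f (v + 1) hf (h2 v)).trans
    (h3 (t, v) (t₀, 0) (hconn _ _))⟩

end IdealTriangulation

/-! ### Kernel, image and covering property of the parametrisation -/

namespace IdealTriangulation

open Topology

variable {T : IdealTriangulation}

open Classical in
/-- The linear part of the leading-trailing parametrisation. -/
noncomputable def paramHom (E₀ : T.Edge) : ({E : T.Edge // E ≠ E₀} → Circle) →* (T.Quad → Circle) where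
  toFun w q := ∏ E : {E : T.Edge // E ≠ E₀}, w E ^ T.leadingTrailing E q
  map_one' := by
    funext q
    simp
  map_mul' w w' := by
    funext q
    simp [mul_zpow, Finset.prod_mul_distrib]

lemma continuous_paramHom (E₀ : T.Edge) : Continuous (paramHom E₀) := by
  classical
  refine continuous_pi fun q ↦ ?_
  refine continuous_finsetProd _ fun E _ ↦ ?_
  exact (continuous_apply E).zpow _

lemma param_eq (α : T.Quad → ℝ) (E₀ : T.Edge) (w : {E : T.Edge // E ≠ E₀} → Circle) :
    T.param α E₀ w = (fun q ↦ Circle.exp (α q)) * paramHom E₀ w := rfl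

open Classical in
/-- Circle coordinates for the edges other than `E₀`, completed by the neutral element. -/
noncomputable def extendCoords {E₀ : T.Edge} (w : {E : T.Edge // E ≠ E₀} → Circle) (E : T.Edge) :
    Additive Circle :=
  if h : E ≠ E₀ then Additive.ofMul (w ⟨E, h⟩) else 0

lemma extendCoords_coe {E₀ : T.Edge} (w : {E : T.Edge // E ≠ E₀} → Circle)
    (E : {E : T.Edge // E ≠ E₀}) : extendCoords w E = Additive.ofMul (w E) := by
  rw [extendCoords, dif_pos E.2]

lemma extendCoords_self {E₀ : T.Edge} (w : {E : T.Edge // E ≠ E₀} → Circle) :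
    extendCoords w E₀ = 0 := by
  rw [extendCoords, dif_neg (by simp)]

lemma extendCoords_restrict {E₀ : T.Edge} (u : T.Edge → Additive Circle) (h : u E₀ = 0) :
    extendCoords (fun E : {E : T.Edge // E ≠ E₀} ↦ (u E).toMul) = u := by
  funext E
  by_cases hE : E = E₀
  · rw [hE, extendCoords_self, h]
  · exact extendCoords_coe _ ⟨E, hE⟩

lemma ofMul_paramHom (E₀ : T.Edge) (w : {E : T.Edge // E ≠ E₀} → Circle) (q : T.Quad) :
    Additive.ofMul (paramHom E₀ w q) = leadingTrailingSum (extendCoords w) q := by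
  classical
  have h : leadingTrailingSum (extendCoords w) q =
      T.leadingTrailing E₀ q • extendCoords w E₀ +
        ∑ E : {E : T.Edge // E ≠ E₀}, T.leadingTrailing E q • extendCoords w E := by
    have := Fintype.prod_eq_mul_prod_subtype_ne
      (fun E ↦ Multiplicative.ofAdd (T.leadingTrailing E q • extendCoords w E)) E₀
    exact this
  rw [h, extendCoords_self, smul_zero, zero_add]
  simp only [extendCoords_coe]
  rfl

/-- The embedding of `𝔽₂` into the circle. -/
noncomputable def signCircle : ZMod 2 →+ Additive Circle :=
  ZMod.lift 2 ⟨zmultiplesHom _ (Additive.ofMul (Circle.exp Real.pi)), by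
    change Additive.ofMul (Circle.exp Real.pi ^ (2 : ℤ)) = 0
    rw [← Circle.exp_zsmul]
    simp⟩

lemma signCircle_one : signCircle 1 = Additive.ofMul (Circle.exp Real.pi) := by
  have := ZMod.lift_coe 2 ⟨zmultiplesHom (Additive Circle) (Additive.ofMul (Circle.exp Real.pi)), by
    change Additive.ofMul (Circle.exp Real.pi ^ (2 : ℤ)) = 0
    rw [← Circle.exp_zsmul]
    simp⟩ 1
  rw [Int.cast_one] at this
  refine this.trans ?_
  simp

lemma signCircle_injective : Function.Injective signCircle := by
  rw [injective_iff_map_eq_zero]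
  intro a ha
  have h : ∀ a : ZMod 2, a = 0 ∨ a = 1 := by decide
  rcases h a with rfl | rfl
  · rfl
  · rw [signCircle_one] at ha
    exact absurd ha Circle.exp_pi_ne_one

lemma exists_signCircle_eq {u : Additive Circle} (h : u + u = 0) : ∃ a, signCircle a = u := by
  have h1 : (u.toMul : ℂ) * u.toMul = 1 := congrArg (fun z : Additive Circle ↦ (z.toMul : ℂ)) h
  rcases mul_self_eq_one_iff.1 h1 with h2 | h2
  · exact ⟨0, by rw [map_zero]; exact (Circle.ext h2).symm⟩
  · refine ⟨1, ?_⟩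
    rw [signCircle_one]
    refine congrArg Additive.ofMul (Circle.ext (y := u.toMul) ?_)
    rw [h2, Circle.coe_exp, Complex.exp_pi_mul_I]

lemma edgeValue_sub_const {A : Type*} [AddCommGroup A] (w : T.Edge → A) (s : A) (t : Fin T.N)
    {a b : Fin 4} (h : a ≠ b) :
    edgeValue (fun E ↦ w E + s) t a b = edgeValue w t a b + s := by
  rw [edgeValue, edgeValue, dif_pos h, dif_pos h]

/-- The coordinates in the kernel of the parametrisation given by a face cocycle. -/
noncomputable def cocycleCoords (E₀ : T.Edge) (c : T.Edge → ZMod 2) (E : {E : T.Edge // E ≠ E₀}) :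
    Circle :=
  (signCircle (c E + c E₀)).toMul

/-- The coordinate at `E₀` has to be trivial; adding the constant `c E₀` achieves this and leaves
all leading-trailing sums unchanged. -/
lemma extendCoords_cocycleCoords (E₀ : T.Edge) (c : T.Edge → ZMod 2) :
    extendCoords (cocycleCoords E₀ c) = signCircle ∘ fun E ↦ c E + c E₀ :=
  extendCoords_restrict (signCircle ∘ fun E ↦ c E + c E₀) (by
    simp [CharTwo.add_self_eq_zero])

lemma cocycleCoords_mem_ker (E₀ : T.Edge) {c : T.Edge → ZMod 2} (hc : c ∈ T.faceCocycles) :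
    cocycleCoords E₀ c ∈ (paramHom E₀).ker := by
  rw [MonoidHom.mem_ker]
  funext q
  apply Additive.ofMul.injective
  rw [ofMul_paramHom, extendCoords_cocycleCoords, leadingTrailingSum_map,
    leadingTrailingSum_add_const, leadingTrailingSum_eq_zero_of_mem hc, map_zero]
  rfl

/-- The kernel of the parametrisation is in bijection with the face cocycles. -/
lemma cocycleCoords_bijective (E₀ : T.Edge)
    (hconn : ∀ a b : Fin T.N × Fin 4, Relation.EqvGen VertexGlued a b) :
    Function.Bijective fun c : T.faceCocycles ↦
      (⟨cocycleCoords E₀ c.1, cocycleCoords_mem_ker E₀ c.2⟩ : (paramHom E₀).ker) := by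
  have t₀ : Fin T.N := ⟨0, lt_of_lt_of_le (by norm_num) T.two_le⟩
  constructor
  · rintro ⟨c, hc⟩ ⟨c', hc'⟩ h
    have h1 : extendCoords (cocycleCoords E₀ c) = extendCoords (cocycleCoords E₀ c') :=
      congrArg extendCoords (congrArg Subtype.val h)
    rw [extendCoords_cocycleCoords, extendCoords_cocycleCoords] at h1
    have h2 (E) : c E + c E₀ = c' E + c' E₀ := signCircle_injective (congrFun h1 E)
    have h3 (E) : c E = c' E + (c' E₀ - c E₀) := by
      rw [← add_sub_assoc, ← h2, add_sub_cancel_right]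
    -- Two cocycles that differ by a constant $k$ have face sums differing by $3k=k$, so $k=0$.
    have h4 : c' E₀ - c E₀ = 0 := by
      have e1 := hc t₀ 0 1 2
      rw [show c = fun E ↦ c' E + (c' E₀ - c E₀) from funext h3, edgeValue_sub_const _ _ _ (by decide),
        edgeValue_sub_const _ _ _ (by decide), edgeValue_sub_const _ _ _ (by decide)] at e1
      have e2 := hc' t₀ 0 1 2
      generalize c' E₀ - c E₀ = k at e1
      have e3 := CharTwo.add_self_eq_zero k
      linear_combination e1 - e2 - e3
    exact Subtype.ext (funext fun E ↦ (h3 E).trans (by rw [h4, add_zero]))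
  · rintro ⟨w, hw⟩
    have hlt (q) : leadingTrailingSum (extendCoords w) q = 0 := by
      rw [← ofMul_paramHom, (MonoidHom.mem_ker).1 hw]
      rfl
    obtain ⟨s, hs⟩ := exists_const_of_leadingTrailingSum_eq_zero hconn hlt
    have hs' (t : Fin T.N) (π : Equiv.Perm (Fin 4)) :
        edgeValue (extendCoords w) t (π 0) (π 1) + edgeValue (extendCoords w) t (π 0) (π 3) -
          edgeValue (extendCoords w) t (π 1) (π 3) = s := by
      rw [← sideValue_perm, hs _ _ _ (by simp)]
    -- The potentials at the two ends of an edge of a face both equal `s`; in their sum the other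
    -- two edges cancel and the edge itself counts twice.
    have h2 (E : T.Edge) : extendCoords w E + extendCoords w E = s + s := by
      induction E using Quot.inductionOn with | _ p
      obtain ⟨t, e⟩ := p
      obtain ⟨π, rfl⟩ := OddPerm.exists_edge_eq e
      rw [show (Quot.mk _ (t, π.edge) : T.Edge) = Corner.edge (t, π) from rfl,
        ← edgeValue_corner (extendCoords w)]
      dsimp only
      have e1 := hs' t (π.1 * Equiv.swap 1 3)
      have e2 := hs' t (π.1 * Equiv.swap 0 3 * Equiv.swap 1 3)
      simp only [Equiv.Perm.mul_apply, Equiv.swap_apply_left, Equiv.swap_apply_right,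
        Equiv.swap_apply_of_ne_of_ne (show (0 : Fin 4) ≠ 1 by decide) (show (0 : Fin 4) ≠ 3 by decide),
        Equiv.swap_apply_of_ne_of_ne (show (1 : Fin 4) ≠ 0 by decide)
          (show (1 : Fin 4) ≠ 3 by decide)] at e1 e2
      rw [edgeValue_comm _ t (π.1 3) (π.1 0)] at e2
      rw [edgeValue_comm _ t (π.1 3) (π.1 1)] at e1 e2
      nth_rw 1 [← e1]
      nth_rw 1 [← e2]
      rw [edgeValue_comm _ t (π.1 1) (π.1 3)]
      abel
    -- The normalisation at `E₀` makes `s`, and then every coordinate, a sign.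
    have h3 : s + s = 0 := by rw [← h2 E₀, extendCoords_self, add_zero]
    obtain ⟨k, rfl⟩ := exists_signCircle_eq h3
    choose c hc using fun E ↦ exists_signCircle_eq ((h2 E).trans h3)
    have hc0 : c E₀ = 0 := signCircle_injective (by rw [hc, extendCoords_self, map_zero])
    have hcw : extendCoords w = signCircle ∘ c := (funext hc).symm
    -- The face sums of `c` are all equal to `k`; adding `k` to each of three edges changes them by
    -- $3k=k$ and makes them vanish.
    refine ⟨⟨fun E ↦ c E + k, mem_faceCocycles_of_perm fun t π ↦ ?_⟩, ?_⟩
    · have := hs' t π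
      rw [hcw, edgeValue_map, edgeValue_map, edgeValue_map, ← map_add, ← map_sub] at this
      have e1 := signCircle_injective this
      rw [edgeValue_sub_const _ _ _ (by simp), edgeValue_sub_const _ _ _ (by simp),
        edgeValue_sub_const _ _ _ (by simp), ← e1, CharTwo.sub_eq_add]
      generalize edgeValue c t (π 0) (π 1) = A
      generalize edgeValue c t (π 0) (π 3) = B
      generalize edgeValue c t (π 1) (π 3) = C
      revert A B C; decide
    · refine Subtype.ext (funext fun E ↦ ?_)
      apply Additive.ofMul.injective
      rw [← extendCoords_coe, ← extendCoords_coe, extendCoords_cocycleCoords]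
      change signCircle (c E + k + (c E₀ + k)) = extendCoords w E
      rw [hc0, zero_add, add_assoc, CharTwo.add_self_eq_zero, add_zero, hc]

/-- The group of circle-valued functions satisfying the homogeneous equations. -/
def homogeneousCircle (μ ν : T.NormalCurve) : Subgroup (T.Quad → Circle) where
  carrier := {ω | (∀ q, ω q * ω q.next * ω q.next.next = 1) ∧ (∀ E, ∏ q, ω q ^ T.G E q = 1) ∧
    ∏ q, ω q ^ μ.G q = 1 ∧ ∏ q, ω q ^ ν.G q = 1}
  one_mem' := by simp
  mul_mem' {ω ω'} h h' := by
    refine ⟨fun q ↦ ?_, fun E ↦ ?_, ?_, ?_⟩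
    · have := congrArg₂ (· * ·) (h.1 q) (h'.1 q)
      simp only [mul_one] at this
      rw [← this]
      simp only [Pi.mul_apply]
      ac_rfl
    · simp [mul_zpow, Finset.prod_mul_distrib, h.2.1, h'.2.1]
    · simp [mul_zpow, Finset.prod_mul_distrib, h.2.2.1, h'.2.2.1]
    · simp [mul_zpow, Finset.prod_mul_distrib, h.2.2.2, h'.2.2.2]
  inv_mem' {ω} h := by
    refine ⟨fun q ↦ ?_, fun E ↦ ?_, ?_, ?_⟩
    · have := congrArg (·⁻¹) (h.1 q)
      simp only [mul_inv, inv_one] at this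
      exact this
    · simp [h.2.1]
    · simp [h.2.2.1]
    · simp [h.2.2.2]

lemma prod_exp_zpow (n : T.Quad → ℤ) (α : T.Quad → ℝ) :
    ∏ q, Circle.exp (α q) ^ n q = Circle.exp (∑ q, (n q : ℝ) * α q) := by
  have h := map_sum Circle.expHom (fun q ↦ (n q : ℝ) * α q) Finset.univ
  have h' : Circle.exp (∑ q, (n q : ℝ) * α q) = ∏ q, Circle.exp ((n q : ℝ) * α q) := h
  rw [h']
  exact Finset.prod_congr rfl fun q _ ↦ (Circle.exp_intCast_mul _ _).symm

/-- Dividing by $e^{i\alpha}$ removes the right-hand sides: the space of circle-valued structures is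
a coset of the homogeneous solutions. -/
lemma mul_mem_circleAngleStructures {μ ν : T.NormalCurve} {x y : ℝ} {α : T.Quad → ℝ}
    (hα : α ∈ T.angleStructures μ ν x y) (ω : T.Quad → Circle) :
    (fun q ↦ Circle.exp (α q)) * ω ∈
        T.circleAngleStructures μ ν (Circle.exp x) (Circle.exp y) ↔
      ω ∈ homogeneousCircle μ ν := by
  obtain ⟨h1, h2, h3, h4⟩ := hα
  have key (n : T.Quad → ℤ) (z : ℝ) (hz : ∑ q, (n q : ℝ) * α q = z) :
      ∏ q, ((fun q ↦ Circle.exp (α q)) * ω) q ^ n q = Circle.exp z ↔ ∏ q, ω q ^ n q = 1 := by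
    simp only [Pi.mul_apply, mul_zpow, Finset.prod_mul_distrib]
    rw [prod_exp_zpow, hz, mul_eq_left]
  refine and_congr (forall_congr' fun q ↦ ?_) (and_congr (forall_congr' fun E ↦ ?_)
    (and_congr ?_ ?_))
  · have e1 : ((Circle.exp Real.pi : Circle) : ℂ) = -1 := by
      rw [Circle.coe_exp, Complex.exp_pi_mul_I]
    rw [← e1, Circle.coe_inj, ← h1 q, Circle.exp_add, Circle.exp_add]
    simp only [Pi.mul_apply]
    rw [← mul_eq_left (a := Circle.exp (α q) * Circle.exp (α q.next) * Circle.exp (α q.next.next))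
      (b := ω q * ω q.next * ω q.next.next)]
    exact Eq.congr_left (by ac_rfl)
  · have := key (T.G E) _ (h2 E)
    rwa [Circle.exp_two_pi] at this
  · exact key μ.G _ h3
  · exact key ν.G _ h4

lemma range_paramHom_le (μ ν : T.NormalCurve) (E₀ : T.Edge) :
    (paramHom E₀).range ≤ homogeneousCircle μ ν := by
  classical
  rintro _ ⟨w, rfl⟩
  have key (n : T.Quad → ℤ) (hn : ∀ E, ∑ q, n q * T.leadingTrailing E q = 0) :
      ∏ q, paramHom E₀ w q ^ n q = 1 := by
    change ∏ q, (∏ E : {E : T.Edge // E ≠ E₀}, w E ^ T.leadingTrailing E q) ^ n q = 1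
    simp only [← Finset.prod_zpow]
    rw [Finset.prod_comm]
    refine Finset.prod_eq_one fun E _ ↦ ?_
    simp only [← zpow_mul]
    have h1 : ∏ q, w E ^ (T.leadingTrailing E q * n q) =
        w E ^ ∑ q, T.leadingTrailing E q * n q :=
      (Finset.sum_smul (M := Additive Circle) (s := Finset.univ)
        (f := fun q ↦ T.leadingTrailing E q * n q) (x := Additive.ofMul (w E))).symm
    rw [h1, Finset.sum_congr rfl fun q _ ↦ mul_comm _ _, hn, zpow_zero]
  refine ⟨fun q ↦ ?_, fun E ↦ key _ (leadingTrailing_orthogonal_edge E),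
    key _ (leadingTrailing_orthogonal_curve μ), key _ (leadingTrailing_orthogonal_curve ν)⟩
  change (∏ E : {E : T.Edge // E ≠ E₀}, w E ^ T.leadingTrailing E q) *
    (∏ E : {E : T.Edge // E ≠ E₀}, w E ^ T.leadingTrailing E q.next) *
    (∏ E : {E : T.Edge // E ≠ E₀}, w E ^ T.leadingTrailing E q.next.next) = 1
  rw [← Finset.prod_mul_distrib, ← Finset.prod_mul_distrib]
  refine Finset.prod_eq_one fun E _ ↦ ?_
  rw [← zpow_add, ← zpow_add, leadingTrailing_sum_tetrahedron, zpow_zero]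

lemma eq_zero_of_exp_eq_one {s : ℝ} (h : Circle.exp s = 1) (hs : |s| < 2 * Real.pi) : s = 0 := by
  obtain ⟨n, rfl⟩ := Circle.exp_eq_one.1 h
  have hpi := Real.two_pi_pos
  rw [abs_mul, abs_of_pos hpi] at hs
  have h1 : |(n : ℝ)| < 1 := by
    by_contra hn
    nlinarith
  have h2 : |n| < 1 := by exact_mod_cast h1
  rw [Int.abs_lt_one_iff.1 h2]
  simp

/-- Near the neutral element, the solutions of the homogeneous equations are parametrised. -/
lemma exists_nhds_subset_range {μ ν : T.NormalCurve} (hgen : T.GeneratesLinkHomology μ ν)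
    (E₀ : T.Edge) : ∃ U ∈ 𝓝 (1 : T.Quad → Circle), ∀ ω ∈ U, ω ∈ homogeneousCircle μ ν →
      ω ∈ (paramHom E₀).range := by
  -- The constant bounds the absolute coefficient sum of every equation, with $3$ for the
  -- tetrahedra. If all arguments are below $\pi/B$, each left-hand side is less than $2\pi$ in
  -- absolute value, so an equation modulo $2\pi$ holds exactly.
  obtain ⟨B, hBdef⟩ : ∃ B : ℝ, B = 3 + ∑ q, |(μ.G q : ℝ)| + ∑ q, |(ν.G q : ℝ)| +
    ∑ E, ∑ q, |(T.G E q : ℝ)| := ⟨_, rfl⟩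
  have hμ0 : 0 ≤ ∑ q, |(μ.G q : ℝ)| := Finset.sum_nonneg fun _ _ ↦ abs_nonneg _
  have hν0 : 0 ≤ ∑ q, |(ν.G q : ℝ)| := Finset.sum_nonneg fun _ _ ↦ abs_nonneg _
  have hE0' (E : T.Edge) : 0 ≤ ∑ q, |(T.G E q : ℝ)| := Finset.sum_nonneg fun _ _ ↦ abs_nonneg _
  have hE0 : 0 ≤ ∑ E, ∑ q, |(T.G E q : ℝ)| := Finset.sum_nonneg fun E _ ↦ hE0' E
  have hB : 0 < B := by linarith
  obtain ⟨ε, hεdef⟩ : ∃ ε : ℝ, ε = Real.pi / B := ⟨_, rfl⟩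
  have hε : 0 < ε := hεdef ▸ div_pos Real.pi_pos hB
  have hεB (b : ℝ) (hb : b ≤ B) : b * ε < 2 * Real.pi := by
    have : b * ε ≤ B * ε := by gcongr
    rw [show B * ε = Real.pi by rw [hεdef]; exact mul_div_cancel₀ _ hB.ne'] at this
    linarith [Real.pi_pos]
  refine ⟨{ω | ∀ q, |(ω q : ℂ).arg| < ε}, ?_, ?_⟩
  · have h1 : ∀ q : T.Quad, ∀ᶠ ω : T.Quad → Circle in 𝓝 1, |(ω q : ℂ).arg| < ε := by
      intro q
      have hc : ContinuousAt (fun ω : T.Quad → Circle ↦ |(ω q : ℂ).arg|) 1 := by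
        refine (ContinuousAt.comp (f := fun ω : T.Quad → Circle ↦ (ω q : ℂ))
          (Complex.continuousAt_arg (by simp)) ?_).abs
        have h : Continuous ((↑) : Circle → ℂ) := continuous_subtype_val
        exact (h.comp (continuous_apply q)).continuousAt
      exact hc.eventually_lt_const (by simpa using hε)
    exact Filter.eventually_all.2 h1
  · rintro ω hω ⟨h1, h2, h3, h4⟩
    let β : T.Quad → ℝ := fun q ↦ (ω q : ℂ).arg
    have hβ (q) : Circle.exp (β q) = ω q := Circle.exp_arg _
    have hβε (q) : |β q| ≤ ε := (hω q).le
    have key (n : T.Quad → ℤ) (hn : ∑ q, |(n q : ℝ)| ≤ B) (hp : ∏ q, ω q ^ n q = 1) :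
        ∑ q, (n q : ℝ) * β q = 0 := by
      apply eq_zero_of_exp_eq_one
      · rw [← prod_exp_zpow]
        simpa only [hβ] using hp
      · refine lt_of_le_of_lt (Finset.abs_sum_le_sum_abs _ _) (lt_of_le_of_lt ?_ (hεB _ hn))
        rw [Finset.sum_mul]
        refine Finset.sum_le_sum fun q _ ↦ ?_
        rw [abs_mul]
        gcongr
        exact hβε q
    have e1 (q) : β q + β q.next + β q.next.next = 0 := by
      apply eq_zero_of_exp_eq_one
      · rw [Circle.exp_add, Circle.exp_add, hβ, hβ, hβ, h1]
      · have h5 := hβε q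
        have h6 := hβε q.next
        have h7 := hβε q.next.next
        have h8 := hεB 3 (by linarith)
        have h9 := abs_add_three (β q) (β q.next) (β q.next.next)
        linarith
    have e2 (E) : ∑ q, (T.G E q : ℝ) * β q = 0 := by
      refine key _ ?_ (h2 E)
      have := Finset.single_le_sum (fun E _ ↦ hE0' E) (Finset.mem_univ E)
      linarith
    have e3 := key μ.G (by linarith) h3
    have e4 := key ν.G (by linarith) h4
    obtain ⟨ρ, hρ⟩ := exists_isPotential hgen e1 e2 e3 e4
    obtain ⟨w, hw⟩ := hρ.exists_leadingTrailingSum_eq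
    -- Subtracting the value at `E₀` gives the required normalisation without changing the
    -- leading-trailing sums.
    let u : T.Edge → Additive Circle := Circle.expHom ∘ fun E ↦ w E + -w E₀
    have hu : u E₀ = 0 := by simp [u]
    refine ⟨fun E : {E : T.Edge // E ≠ E₀} ↦ (u E).toMul, funext fun q ↦ ?_⟩
    apply Additive.ofMul.injective
    rw [ofMul_paramHom, extendCoords_restrict u hu, leadingTrailingSum_map,
      leadingTrailingSum_add_const, ← hw, ← hβ]
    rfl

/-- The leading-trailing parametrisation is a covering of a connected component, and its degree is
the number of face cocycles. -/
theorem isCoveringOfComponent_param {μ ν : T.NormalCurve} (hgen : T.GeneratesLinkHomology μ ν)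
    (hconn : ∀ a b : Fin T.N × Fin 4, Relation.EqvGen VertexGlued a b) {x y : ℝ} {α : T.Quad → ℝ}
    (hα : α ∈ T.angleStructures μ ν x y) (E₀ : T.Edge) :
    IsCoveringOfComponent (T.param α E₀)
      (T.circleAngleStructures μ ν (Circle.exp x) (Circle.exp y)) (fun q ↦ Circle.exp (α q))
      (Nat.card T.faceCocycles) := by
  have hbij := cocycleCoords_bijective E₀ hconn
  rw [Nat.card_congr (Equiv.ofBijective _ hbij)]
  have : Finite (paramHom E₀).ker := Finite.of_surjective _ hbij.surjective
  obtain ⟨U, hU, hUS⟩ := exists_nhds_subset_range hgen E₀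
  exact isCoveringOfComponent_of_hom (paramHom E₀) (continuous_paramHom E₀) _
    (homogeneousCircle μ ν) _ (mul_mem_circleAngleStructures hα) (range_paramHom_le μ ν E₀) hU hUS
    (param_eq α E₀)

end IdealTriangulation

/-! ### The single ideal vertex and the one-point compactification -/

namespace IdealTriangulation

open Topology

variable (T : IdealTriangulation)

/-- The largest barycentric coordinate. -/
noncomputable def maxCoord (p : stdSimplex ℝ (Fin 4)) : ℝ := Finset.univ.sup' ⟨0, by simp⟩ p

lemma le_maxCoord (p : stdSimplex ℝ (Fin 4)) (v : Fin 4) : p v ≤ maxCoord p :=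
  Finset.le_sup' (p : Fin 4 → ℝ) (Finset.mem_univ v)

lemma exists_eq_maxCoord (p : stdSimplex ℝ (Fin 4)) : ∃ v, p v = maxCoord p := by
  obtain ⟨v, -, hv⟩ := Finset.exists_mem_eq_sup' (s := Finset.univ) ⟨0, by simp⟩ (p : Fin 4 → ℝ)
  exact ⟨v, hv.symm⟩

lemma continuous_stdSimplex_apply {ι : Type*} [Fintype ι] (v : ι) :
    Continuous fun p : stdSimplex ℝ ι ↦ p v :=
  (continuous_apply v).comp continuous_subtype_val

lemma continuous_maxCoord : Continuous maxCoord := by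
  have h := Continuous.finset_sup'_apply (s := Finset.univ)
    (f := fun (v : Fin 4) (p : stdSimplex ℝ (Fin 4)) ↦ p v) ⟨0, by simp⟩
    fun v _ ↦ continuous_stdSimplex_apply v
  exact h

variable {T} in
lemma PointGlued.maxCoord_eq {p q : Fin T.N × stdSimplex ℝ (Fin 4)} (h : T.PointGlued p q) :
    maxCoord p.2 = maxCoord q.2 := by
  obtain ⟨i, -, -, h⟩ := h
  apply le_antisymm
  · obtain ⟨v, hv⟩ := exists_eq_maxCoord p.2
    rw [← hv, ← h]
    exact le_maxCoord _ _
  · obtain ⟨v, hv⟩ := exists_eq_maxCoord q.2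
    obtain ⟨v, rfl⟩ := (T.glue p.1 i).surjective v
    rw [← hv, h]
    exact le_maxCoord _ _

/-- The largest barycentric coordinate, as a function on the compactified space. -/
noncomputable def height : T.Compactified → ℝ :=
  Quot.lift (fun p ↦ maxCoord p.2) fun _ _ h ↦ h.maxCoord_eq

lemma continuous_height : Continuous T.height :=
  continuous_quot_lift _ (continuous_maxCoord.comp continuous_snd)

lemma height_mk (p : Fin T.N × stdSimplex ℝ (Fin 4)) :
    T.height (Quot.mk _ p) = maxCoord p.2 := rfl

lemma height_mem_idealVertices {P : T.Compactified} : P ∈ T.idealVertices ↔ T.height P = 1 := by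
  constructor
  · rintro ⟨t, x, v, hv, rfl⟩
    refine le_antisymm ?_ (hv ▸ le_maxCoord x v)
    obtain ⟨u, hu⟩ := exists_eq_maxCoord x
    rw [height_mk, ← hu]
    exact stdSimplex.le_one x u
  · induction P using Quot.inductionOn with | _ p
    intro h
    obtain ⟨u, hu⟩ := exists_eq_maxCoord p.2
    exact ⟨p.1, p.2, u, hu.trans h, rfl⟩

lemma height_le_one (P : T.Compactified) : T.height P ≤ 1 := by
  induction P using Quot.inductionOn with | _ p
  obtain ⟨u, hu⟩ := exists_eq_maxCoord p.2
  rw [height_mk, ← hu]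
  exact stdSimplex.le_one p.2 u

lemma height_lt_one (P : T.Space) : T.height P.1 < 1 :=
  lt_of_le_of_ne (T.height_le_one _) fun h ↦ P.2 (T.height_mem_idealVertices.2 h)

lemma isOpen_compl_idealVertices : IsOpen (T.idealVerticesᶜ) := by
  have : T.idealVertices = T.height ⁻¹' {1} := by
    ext P
    exact T.height_mem_idealVertices
  rw [this]
  exact (isClosed_singleton.preimage T.continuous_height).isOpen_compl

/-- The image in the compactified space of a vertex of a tetrahedron. -/
noncomputable def idealVertex (t : Fin T.N) (v : Fin 4) : T.Compactified :=
  Quot.mk _ (t, stdSimplex.vertex v)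

lemma eq_vertex_of_apply_eq_one {x : stdSimplex ℝ (Fin 4)} {v : Fin 4} (h : x v = 1) :
    x = stdSimplex.vertex v := by
  have h1 := stdSimplex.sum_eq_one x
  rw [← Finset.add_sum_erase _ _ (Finset.mem_univ v), h, add_eq_left,
    Finset.sum_eq_zero_iff_of_nonneg fun i _ ↦ stdSimplex.zero_le x i] at h1
  apply stdSimplex.ext
  funext u
  by_cases hu : u = v
  · subst hu
    rw [h, stdSimplex.vertex_coe, Pi.single_eq_same]
  · rw [h1 u (by simp [hu]), stdSimplex.vertex_coe, Pi.single_eq_of_ne hu]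

lemma mem_idealVertices_iff {P : T.Compactified} :
    P ∈ T.idealVertices ↔ ∃ t v, P = T.idealVertex t v := by
  constructor
  · rintro ⟨t, x, v, hv, rfl⟩
    exact ⟨t, v, by rw [eq_vertex_of_apply_eq_one hv]; rfl⟩
  · rintro ⟨t, v, rfl⟩
    exact ⟨t, _, v, by simp, rfl⟩

lemma idealVertex_glue (t : Fin T.N) {v i : Fin 4} (h : i ≠ v) :
    T.idealVertex (T.adj t i) (T.glue t i v) = T.idealVertex t v := by
  refine (Quot.sound ⟨i, ?_, rfl, fun u ↦ ?_⟩).symm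
  · simp [h]
  · simp [Pi.single_apply]

/-- The neighbourhood of the ideal vertex `P` formed by the corners of the tetrahedra at `P`. -/
def star (P : T.Compactified) : Set T.Compactified :=
  {x | Quot.lift (fun p : Fin T.N × stdSimplex ℝ (Fin 4) ↦
    ∃ v, 1 / 2 < p.2 v ∧ T.idealVertex p.1 v = P) (by
      rintro p q ⟨i, h1, h2, h3⟩
      refine propext ⟨?_, ?_⟩
      · rintro ⟨v, hv, rfl⟩
        refine ⟨T.glue p.1 i v, by rwa [h3], ?_⟩
        rw [h2, idealVertex_glue]
        rintro rfl
        norm_num [h1] at hv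
      · rintro ⟨v, hv, rfl⟩
        obtain ⟨v, rfl⟩ := (T.glue p.1 i).surjective v
        rw [h3] at hv
        refine ⟨v, hv, ?_⟩
        rw [h2, idealVertex_glue]
        rintro rfl
        norm_num [h1] at hv) x}

lemma mk_mem_star {t : Fin T.N} {p : stdSimplex ℝ (Fin 4)} {P : T.Compactified} :
    (Quot.mk _ (t, p) : T.Compactified) ∈ T.star P ↔ ∃ v, 1 / 2 < p v ∧ T.idealVertex t v = P :=
  Iff.rfl

lemma isOpen_star (P : T.Compactified) : IsOpen (T.star P) := by
  rw [← isQuotientMap_quot_mk.isOpen_preimage]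
  have : Quot.mk _ ⁻¹' T.star P = ⋃ t : Fin T.N, ⋃ v : Fin 4, ⋃ _ : T.idealVertex t v = P,
      ({t} : Set (Fin T.N)) ×ˢ {p : stdSimplex ℝ (Fin 4) | 1 / 2 < p v} := by
    ext ⟨t, p⟩
    simp only [Set.mem_preimage, mk_mem_star, Set.mem_iUnion, Set.mem_prod, Set.mem_singleton_iff,
      Set.mem_ofPred_eq]
    constructor
    · rintro ⟨v, h, h'⟩
      exact ⟨t, v, h', rfl, h⟩
    · rintro ⟨_, v, h', rfl, h⟩
      exact ⟨v, h, h'⟩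
  rw [this]
  refine isOpen_iUnion fun t ↦ isOpen_iUnion fun v ↦ isOpen_iUnion fun _ ↦ ?_
  exact (isOpen_discrete _).prod (isOpen_lt continuous_const (continuous_stdSimplex_apply v))

/-- Two barycentric coordinates cannot both exceed $1/2$, so the stars of distinct ideal vertices
are disjoint. -/
lemma eq_of_mem_star {x P Q : T.Compactified} (hP : x ∈ T.star P) (hQ : x ∈ T.star Q) : P = Q := by
  induction x using Quot.inductionOn with | _ p
  obtain ⟨v, hv, rfl⟩ := hP
  obtain ⟨u, hu, rfl⟩ := hQ
  by_cases h : v = u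
  · rw [h]
  · have h1 := stdSimplex.sum_eq_one p.2
    have h2 : p.2 v + p.2 u ≤ ∑ i, p.2 i := by
      rw [← Finset.sum_pair h]
      exact Finset.sum_le_sum_of_subset_of_nonneg (Finset.subset_univ _)
        fun i _ _ ↦ stdSimplex.zero_le p.2 i
    linarith

lemma exists_mem_star {x : T.Compactified} (h : 1 / 2 < T.height x) :
    ∃ t v, x ∈ T.star (T.idealVertex t v) := by
  induction x using Quot.inductionOn with | _ p
  obtain ⟨u, hu⟩ := exists_eq_maxCoord p.2
  refine ⟨p.1, u, u, ?_, rfl⟩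
  rw [hu]
  exact h

/-- Hence no star is swallowed by a compact subset of the space, on which the height stays away from
$1$. -/
lemma exists_mem_star_height (t : Fin T.N) (v : Fin 4) {a : ℝ} (ha : a < 1) :
    ∃ x : T.Space, x.1 ∈ T.star (T.idealVertex t v) ∧ a < T.height x.1 := by
  -- The witness lies on an edge at the vertex; its coordinate there is midway between `max a (1 /
  -- 2)` and $1$.
  let s : ℝ := (1 + max a (1 / 2)) / 2
  have hm : max a (1 / 2) < 1 := max_lt ha (by norm_num)
  have hs1 : s < 1 := by simp only [s]; linarith
  have hsa : a < s := by
    have := le_max_left a (1 / 2)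
    simp only [s]; linarith
  have hs2 : 1 / 2 < s := by
    have := le_max_right a (1 / 2)
    simp only [s]; linarith
  let p : stdSimplex ℝ (Fin 4) := ⟨Pi.single v s + Pi.single (v + 1) (1 - s), by
    constructor
    · intro i
      simp only [Pi.add_apply, Pi.single_apply]
      split_ifs <;> linarith
    · simp [Finset.sum_add_distrib]⟩
  have hv : v + 1 ≠ v := by revert v; decide
  have hp (i) : p i = (Pi.single v s + Pi.single (v + 1) (1 - s) : Fin 4 → ℝ) i := rfl
  have hpv : p v = s := by
    rw [hp, Pi.add_apply, Pi.single_eq_same, Pi.single_eq_of_ne hv.symm, add_zero]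
  have hle (i) : p i ≤ s := by
    rw [hp, Pi.add_apply, Pi.single_apply, Pi.single_apply]
    split_ifs with h1 h2 h2
    · exact absurd (h2.symm.trans h1) hv
    all_goals linarith
  have hh : T.height (Quot.mk _ (t, p)) = s := by
    refine le_antisymm ?_ (hpv ▸ le_maxCoord p v)
    obtain ⟨u, hu⟩ := exists_eq_maxCoord p
    rw [height_mk, ← hu]
    exact hle u
  refine ⟨⟨Quot.mk _ (t, p), ?_⟩, ⟨v, hpv ▸ hs2, rfl⟩, hh ▸ hsa⟩
  rw [height_mem_idealVertices, hh]
  exact hs1.ne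

/-- Compact subsets of the space stay away from the ideal vertices. -/
lemma exists_height_le_of_isCompact {K : Set T.Space} (hK : IsCompact K) :
    ∃ a < 1, ∀ x ∈ K, T.height x.1 ≤ a := by
  rcases K.eq_empty_or_nonempty with rfl | hne
  · exact ⟨0, by norm_num, by simp⟩
  · obtain ⟨x, hx, h⟩ := hK.exists_isMaxOn hne
      (T.continuous_height.comp continuous_subtype_val).continuousOn
    exact ⟨T.height x.1, T.height_lt_one x, fun y hy ↦ h hy⟩

lemma isCompact_height_le {a : ℝ} (ha : a < 1) : IsCompact {x : T.Space | T.height x.1 ≤ a} := by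
  rw [IsEmbedding.subtypeVal.isCompact_iff]
  have h : Subtype.val '' {x : T.Space | T.height x.1 ≤ a} = {x | T.height x ≤ a} := by
    ext x
    constructor
    · rintro ⟨y, hy, rfl⟩
      exact hy
    · intro hx
      refine ⟨⟨x, fun h' ↦ ?_⟩, hx, rfl⟩
      rw [height_mem_idealVertices] at h'
      have : T.height x ≤ a := hx
      linarith
  rw [h]
  exact (isClosed_le T.continuous_height continuous_const).isCompact

end IdealTriangulation

open Topology in
/-- In a space with one toroidal end, every compact set is contained in a compact set with connected
complement. -/
lemma HasOneToroidalEnd.exists_isCompact {M : Type} [TopologicalSpace M] (h : HasOneToroidalEnd M)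
    {K : Set M} (hK : IsCompact K) :
    ∃ A : Set M, IsPreconnected A ∧ Disjoint A K ∧ IsCompact Aᶜ := by
  obtain ⟨e, he, -, hc⟩ := h
  have h1 : IsCompact (e ⁻¹' K) := he.isCompact_preimage hK
  obtain ⟨r, hr⟩ := (h1.image continuous_snd).bddAbove
  -- The part of the collar beyond the last level reached by `K` is connected, and it misses `K`.
  refine ⟨e '' {p | r < p.2}, ?_, ?_, ?_⟩
  · refine IsPreconnected.image ?_ e he.continuous.continuousOn
    have : {p : (Circle × Circle) × ℝ≥0 | r < p.2} = Set.univ ×ˢ Set.Ioi r := by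
      ext; simp
    rw [this]
    exact isPreconnected_univ.prod isPreconnected_Ioi
  · rw [Set.disjoint_left]
    rintro _ ⟨p, hp, rfl⟩ hpK
    exact absurd (hr ⟨p, hpK, rfl⟩) (not_le.2 hp)
  · have h2 : (e '' {p | r < p.2})ᶜ ⊆ (e '' {p | 0 < p.2})ᶜ ∪ e '' {p | p.2 ≤ r} := by
      intro x hx
      by_cases hx' : x ∈ e '' {p | 0 < p.2}
      · obtain ⟨p, -, rfl⟩ := hx'
        exact Or.inr ⟨p, not_lt.1 (fun h : r < p.2 ↦ hx ⟨p, h, rfl⟩), rfl⟩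
      · exact Or.inl hx'
    have h3 : (e '' {p | r < p.2})ᶜ = (e '' {p | 0 < p.2})ᶜ ∪ e '' {p | p.2 ≤ r} := by
      refine Set.Subset.antisymm h2 ?_
      rintro x (hx | ⟨p, hp, rfl⟩)
      · rintro ⟨p, hp, rfl⟩
        exact hx ⟨p, lt_of_le_of_lt bot_le (show r < p.2 from hp), rfl⟩
      · rintro ⟨q, hq, hqp⟩
        rw [he.injective hqp] at hq
        exact absurd (show p.2 ≤ r from hp) (not_le.2 hq)
    rw [h3]
    refine hc.union (IsCompact.image ?_ he.continuous)
    have : {p : (Circle × Circle) × ℝ≥0 | p.2 ≤ r} = Set.univ ×ˢ Set.Iic r := by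
      ext; simp
    rw [this]
    have h4 : Set.Iic r = Set.Icc 0 r := by
      ext; simp
    rw [h4]
    exact isCompact_univ.prod isCompact_Icc

namespace IdealTriangulation

open Topology

variable {T : IdealTriangulation}

/-- An ideal triangulation of a space with one toroidal end has exactly one ideal vertex. -/
theorem idealVertex_eq {M : Type} [TopologicalSpace M] (hM : HasOneToroidalEnd M)
    (φ : T.Space ≃ₜ M) (t t' : Fin T.N) (v v' : Fin 4) :
    T.idealVertex t v = T.idealVertex t' v' := by
  by_contra hne
  obtain ⟨A, hA, hAK, hAc⟩ := hM.exists_isCompact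
    ((T.isCompact_height_le (show (1 / 2 : ℝ) < 1 by norm_num)).image φ.continuous)
  have hB : IsPreconnected (φ.symm '' A) := hA.image _ φ.symm.continuous.continuousOn
  have hmeet (t v) : (φ.symm '' A ∩ Subtype.val ⁻¹' T.star (T.idealVertex t v)).Nonempty := by
    obtain ⟨a, ha, h⟩ := T.exists_height_le_of_isCompact (hAc.image φ.symm.continuous)
    obtain ⟨x, hx, hxa⟩ := T.exists_mem_star_height t v ha
    refine ⟨x, ?_, hx⟩
    by_contra hxA
    refine absurd (h x ⟨φ x, fun h' ↦ hxA ⟨φ x, h', by simp⟩, by simp⟩) (not_le.2 hxa)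
  -- The connected set obtained from `A` lies above height $1/2$, hence in the disjoint open stars,
  -- and it meets all of them. Two different ideal vertices would disconnect it.
  let P := T.idealVertex t v
  obtain ⟨x, hx, h1, h2⟩ := hB (Subtype.val ⁻¹' T.star P)
    (Subtype.val ⁻¹' ⋃ Q : {Q : T.Compactified // Q ≠ P}, T.star Q.1)
    ((T.isOpen_star P).preimage continuous_subtype_val)
    ((isOpen_iUnion fun Q ↦ T.isOpen_star _).preimage continuous_subtype_val)
    (by
      rintro _ ⟨y, hy, rfl⟩
      have h1 : 1 / 2 < T.height (φ.symm y).1 := by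
        by_contra h
        exact Set.disjoint_left.1 hAK hy ⟨φ.symm y, not_lt.1 h, by simp⟩
      obtain ⟨t, v, h⟩ := T.exists_mem_star h1
      by_cases h' : T.idealVertex t v = P
      · exact Or.inl (h' ▸ h)
      · exact Or.inr (Set.mem_iUnion.2 ⟨⟨_, h'⟩, h⟩))
    (hmeet t v)
    (by
      obtain ⟨x, hx, h⟩ := hmeet t' v'
      exact ⟨x, hx, Set.mem_iUnion.2 ⟨⟨T.idealVertex t' v', Ne.symm hne⟩, h⟩⟩)
  obtain ⟨Q, hQ⟩ := Set.mem_iUnion.1 h2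
  exact Q.2 (T.eq_of_mem_star hQ h1)

/-- A chain of gluings that starts at a vertex of a tetrahedron stays at vertices, and each of its
steps crosses a side of the link. Thus the link of one ideal vertex is connected. -/
lemma eqvGen_vertexGlued_of_pointGlued {p q : Fin T.N × stdSimplex ℝ (Fin 4)}
    (h : Relation.EqvGen T.PointGlued p q) :
    (∀ v, p.2 v = 1 → ∃ u, q.2 u = 1 ∧ Relation.EqvGen VertexGlued (p.1, v) (q.1, u)) ∧
      ∀ u, q.2 u = 1 → ∃ v, p.2 v = 1 ∧ Relation.EqvGen VertexGlued (p.1, v) (q.1, u) := by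
  induction h with
  | rel p q h =>
    obtain ⟨i, h1, h2, h3⟩ := h
    have key : ∀ v, p.2 v = 1 →
        Relation.EqvGen VertexGlued (p.1, v) (q.1, T.glue p.1 i v) := by
      intro v hv
      refine Relation.EqvGen.rel _ _ ⟨i, ?_, Prod.ext h2 rfl⟩
      rintro rfl
      rw [h1] at hv
      norm_num at hv
    refine ⟨fun v hv ↦ ⟨T.glue p.1 i v, by rwa [h3], key v hv⟩, fun u hu ↦ ?_⟩
    obtain ⟨v, rfl⟩ := (T.glue p.1 i).surjective u
    rw [h3] at hu
    exact ⟨v, hu, key v hu⟩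
  | refl p => exact ⟨fun v hv ↦ ⟨v, hv, .refl _⟩, fun v hv ↦ ⟨v, hv, .refl _⟩⟩
  | symm p q _ ih =>
    refine ⟨fun v hv ↦ ?_, fun v hv ↦ ?_⟩
    · obtain ⟨u, hu, h⟩ := ih.2 v hv
      exact ⟨u, hu, h.symm⟩
    · obtain ⟨u, hu, h⟩ := ih.1 v hv
      exact ⟨u, hu, h.symm⟩
  | trans p q r _ _ ih ih' =>
    refine ⟨fun v hv ↦ ?_, fun v hv ↦ ?_⟩
    · obtain ⟨u, hu, h⟩ := ih.1 v hv
      obtain ⟨w, hw, h'⟩ := ih'.1 u hu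
      exact ⟨w, hw, h.trans _ _ _ h'⟩
    · obtain ⟨u, hu, h⟩ := ih'.2 v hv
      obtain ⟨w, hw, h'⟩ := ih.2 u hu
      exact ⟨w, hw, h'.trans _ _ _ h⟩

lemma eqvGen_vertexGlued {t t' : Fin T.N} {v v' : Fin 4}
    (h : T.idealVertex t v = T.idealVertex t' v') :
    Relation.EqvGen (VertexGlued (T := T)) (t, v) (t', v') := by
  obtain ⟨u, hu, h'⟩ := (eqvGen_vertexGlued_of_pointGlued (Quot.eqvGen_exact h)).1 v (by simp)
  have : u = v' := by
    by_contra hne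
    simp [hne] at hu
  exact this ▸ h'

/-- If there is only one ideal vertex, then the compactified space is the one-point
compactification. -/
theorem nonempty_homeomorph_onePoint {M : Type} [TopologicalSpace M] [T2Space M]
    [LocallyCompactSpace M] (φ : T.Space ≃ₜ M)
    (hv : ∀ t t' v v', T.idealVertex t v = T.idealVertex t' v') :
    Nonempty (T.Compactified ≃ₜ OnePoint M) := by
  classical
  have t₀ : Fin T.N := ⟨0, lt_of_lt_of_le (by norm_num) T.two_le⟩
  let f : T.Compactified → OnePoint M := fun x ↦
    if h : x ∉ T.idealVertices then (φ ⟨x, h⟩ : OnePoint M) else OnePoint.infty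
  have hf (x : T.Space) : f x.1 = (φ x : OnePoint M) := dif_pos x.2
  have hf' (x) (hx : x ∈ T.idealVertices) : f x = OnePoint.infty := dif_neg (not_not.2 hx)
  have hbij : Function.Bijective f := by
    constructor
    · intro x y hxy
      by_cases hx : x ∈ T.idealVertices <;> by_cases hy : y ∈ T.idealVertices
      · obtain ⟨t, v, rfl⟩ := T.mem_idealVertices_iff.1 hx
        obtain ⟨t', v', rfl⟩ := T.mem_idealVertices_iff.1 hy
        exact hv _ _ _ _
      · rw [hf' x hx, hf ⟨y, hy⟩] at hxy
        exact absurd hxy.symm (OnePoint.coe_ne_infty _)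
      · rw [hf' y hy, hf ⟨x, hx⟩] at hxy
        exact absurd hxy (OnePoint.coe_ne_infty _)
      · rw [hf ⟨x, hx⟩, hf ⟨y, hy⟩, OnePoint.coe_eq_coe] at hxy
        exact congrArg Subtype.val (φ.injective hxy)
    · intro y
      induction y using OnePoint.rec with
      | infty => exact ⟨T.idealVertex t₀ 0, hf' _ (T.mem_idealVertices_iff.2 ⟨_, _, rfl⟩)⟩
      | coe y => exact ⟨(φ.symm y).1, by rw [hf, φ.apply_symm_apply]⟩
  have hemb : IsOpenEmbedding (Subtype.val : T.Space → T.Compactified) :=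
    T.isOpen_compl_idealVertices.isOpenEmbedding_subtypeVal
  have hcont : Continuous f := by
    refine ⟨fun s hs ↦ ?_⟩
    have hpre : Subtype.val '' (φ ⁻¹' ((↑) ⁻¹' s : Set M)) = f ⁻¹' s ∩ T.idealVerticesᶜ := by
      ext x
      constructor
      · rintro ⟨y, hy, rfl⟩
        exact ⟨by rw [Set.mem_preimage, hf]; exact hy, y.2⟩
      · rintro ⟨hx, hx'⟩
        refine ⟨⟨x, hx'⟩, ?_, rfl⟩
        rw [Set.mem_preimage, hf ⟨x, hx'⟩] at hx
        exact hx
    have hopen : IsOpen (f ⁻¹' s ∩ T.idealVerticesᶜ) := by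
      rw [← hpre]
      exact hemb.isOpenMap _ ((hs.preimage OnePoint.continuous_coe).preimage φ.continuous)
    by_cases hinf : OnePoint.infty ∈ s
    · obtain ⟨-, hK⟩ := (OnePoint.isOpen_iff_of_mem hinf).1 hs
      -- A neighbourhood of infinity has compact complement, on which the height is at most some `a
      -- < 1`; so everything above height `a` maps into it.
      obtain ⟨a, ha, h⟩ := T.exists_height_le_of_isCompact (hK.image φ.symm.continuous)
      have : f ⁻¹' s = (f ⁻¹' s ∩ T.idealVerticesᶜ) ∪ {x | a < T.height x} := by
        ext x
        constructor
        · intro hx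
          by_cases hx' : x ∈ T.idealVertices
          · refine Or.inr ?_
            rw [Set.mem_ofPred_eq, T.height_mem_idealVertices.1 hx']
            exact ha
          · exact Or.inl ⟨hx, hx'⟩
        · rintro (hx | hx)
          · exact hx.1
          · by_cases hx' : x ∈ T.idealVertices
            · rw [Set.mem_preimage, hf' x hx']
              exact hinf
            · by_contra hxs
              rw [Set.mem_preimage, hf ⟨x, hx'⟩] at hxs
              exact absurd (h ⟨x, hx'⟩ ⟨_, hxs, by simp⟩) (not_le.2 hx)
      rw [this]
      exact hopen.union (isOpen_lt continuous_const T.continuous_height)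
    · have : f ⁻¹' s = f ⁻¹' s ∩ T.idealVerticesᶜ := by
        refine (Set.inter_eq_left.2 fun x hx ↦ Set.mem_compl fun hx' ↦ hinf ?_).symm
        rw [← hf' x hx']
        exact hx
      rw [this]
      exact hopen
  exact ⟨hcont.homeoOfEquivCompactToT2 (f := Equiv.ofBijective f hbij)⟩

end IdealTriangulation

/-! ### Singular 1-cocycles on segments, squares and small paths -/

section AffineSimplices

variable {ι X : Type} [Fintype ι] [TopologicalSpace X]

/-- The affine singular simplex with given vertices. -/
noncomputable def affineMap {n : ℕ} (P : Fin (n + 1) → stdSimplex ℝ ι) :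
    C(stdSimplex ℝ (Fin (n + 1)), stdSimplex ℝ ι) where
  toFun s := ⟨fun v ↦ ∑ i, s i * P i v,
    fun v ↦ Finset.sum_nonneg fun i _ ↦ mul_nonneg (stdSimplex.zero_le s i) (stdSimplex.zero_le _ v),
    by
      rw [Finset.sum_comm]
      simp_rw [← Finset.mul_sum, stdSimplex.sum_eq_one, mul_one, stdSimplex.sum_eq_one]⟩
  continuous_toFun := Continuous.subtype_mk (continuous_pi fun v ↦ continuous_finsetSum _ fun i _ ↦
    (IdealTriangulation.continuous_stdSimplex_apply i).mul continuous_const) _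

lemma affineMap_apply {n : ℕ} (P : Fin (n + 1) → stdSimplex ℝ ι) (s : stdSimplex ℝ (Fin (n + 1)))
    (v : ι) : affineMap P s v = ∑ i, s i * P i v := rfl

lemma affineMap_vertex {n : ℕ} (P : Fin (n + 1) → stdSimplex ℝ ι) (i : Fin (n + 1)) :
    affineMap P (stdSimplex.vertex i) = P i := by
  classical
  apply stdSimplex.ext
  funext v
  rw [affineMap_apply]
  simp [Pi.single_apply]

lemma stdSimplex_map_apply_of_injective {κ : Type} [Fintype κ] {f : ι → κ}
    (hf : Function.Injective f) (s : stdSimplex ℝ ι) (i : ι) : stdSimplex.map f s (f i) = s i := by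
  classical
  rw [stdSimplex.map_coe, FunOnFinite.linearMap_apply_apply]
  rw [Finset.sum_eq_single i]
  · intro j hj hji
    exact absurd (hf (Finset.mem_filter.1 hj).2) hji
  · simp

lemma stdSimplex_map_apply_of_notMem {κ : Type} [Fintype κ] {f : ι → κ}
    (s : stdSimplex ℝ ι) {j : κ} (hj : j ∉ Set.range f) : stdSimplex.map f s j = 0 := by
  classical
  rw [stdSimplex.map_coe, FunOnFinite.linearMap_apply_apply]
  refine Finset.sum_eq_zero fun i hi ↦ absurd ⟨i, (Finset.mem_filter.1 hi).2⟩ hj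

lemma affineMap_comp_simplexFace {n : ℕ} (P : Fin (n + 2) → stdSimplex ℝ ι) (i : Fin (n + 2)) :
    (affineMap P).comp (simplexFace i) = affineMap (P ∘ i.succAbove) := by
  ext s v
  change affineMap P (stdSimplex.map i.succAbove s) v = _
  rw [affineMap_apply, affineMap_apply, Fin.sum_univ_succAbove _ i,
    stdSimplex_map_apply_of_notMem s (by simp), zero_mul, zero_add]
  exact Finset.sum_congr rfl fun j _ ↦ by
    rw [stdSimplex_map_apply_of_injective Fin.succAbove_right_injective]; rfl

lemma affineMap_const {n : ℕ} (p : stdSimplex ℝ ι) (s : stdSimplex ℝ (Fin (n + 1))) :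
    affineMap (fun _ ↦ p) s = p := by
  apply stdSimplex.ext
  funext v
  rw [affineMap_apply, ← Finset.sum_mul, stdSimplex.sum_eq_one, one_mul]

lemma affineMap_vertices {n : ℕ} (s : stdSimplex ℝ (Fin (n + 1))) :
    affineMap (fun i ↦ stdSimplex.vertex i) s = s := by
  apply stdSimplex.ext
  funext v
  rw [affineMap_apply]
  simp [Pi.single_apply]

lemma affineMap_vertex_vertex :
    affineMap ![stdSimplex.vertex (S := ℝ) (0 : Fin 2), stdSimplex.vertex 1] =
      ContinuousMap.id _ := by
  refine ContinuousMap.ext fun s ↦ Eq.trans ?_ (affineMap_vertices s)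
  congr 2
  funext i; fin_cases i <;> rfl

/-- The value of a 1-cochain on the image of a straight segment. -/
noncomputable def segmentValue (φ : C(stdSimplex ℝ (Fin 2), X) → ZMod 2) (g : C(stdSimplex ℝ ι, X))
    (p q : stdSimplex ℝ ι) : ZMod 2 := φ (g.comp (affineMap ![p, q]))

variable {φ : C(stdSimplex ℝ (Fin 2), X) → ZMod 2}

lemma segmentValue_triangle (hφ : φ ∈ singularOneCocycles X) (g : C(stdSimplex ℝ ι, X))
    (p q r : stdSimplex ℝ ι) :
    segmentValue φ g q r + segmentValue φ g p r + segmentValue φ g p q = 0 := by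
  have h := hφ (g.comp (affineMap ![p, q, r]))
  simp_rw [ContinuousMap.comp_assoc, affineMap_comp_simplexFace] at h
  rw [Fin.sum_univ_three] at h
  have h0 : ![p, q, r] ∘ (0 : Fin 3).succAbove = ![q, r] := by
    funext i; fin_cases i <;> rfl
  have h1 : ![p, q, r] ∘ (1 : Fin 3).succAbove = ![p, r] := by
    funext i; fin_cases i <;> rfl
  have h2 : ![p, q, r] ∘ (2 : Fin 3).succAbove = ![p, q] := by
    funext i; fin_cases i <;> rfl
  rwa [h0, h1, h2] at h

lemma segmentValue_self (hφ : φ ∈ singularOneCocycles X) (g : C(stdSimplex ℝ ι, X))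
    (p : stdSimplex ℝ ι) : segmentValue φ g p p = 0 := by
  have h := segmentValue_triangle hφ g p p p
  rwa [CharTwo.add_self_eq_zero, zero_add] at h

lemma segmentValue_comm (hφ : φ ∈ singularOneCocycles X) (g : C(stdSimplex ℝ ι, X))
    (p q : stdSimplex ℝ ι) : segmentValue φ g p q = segmentValue φ g q p := by
  have h := segmentValue_triangle hφ g p q p
  rw [segmentValue_self hφ, add_zero] at h
  exact (CharTwo.add_eq_zero.1 h).symm

lemma segmentValue_add (hφ : φ ∈ singularOneCocycles X) (g : C(stdSimplex ℝ ι, X))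
    (p q r : stdSimplex ℝ ι) :
    segmentValue φ g p q + segmentValue φ g q r = segmentValue φ g p r := by
  have h := segmentValue_triangle hφ g p q r
  rw [← CharTwo.add_eq_zero, ← h]
  ring

/-- A 1-cocycle vanishes on the bottom of a square if it vanishes on the other three sides. -/
lemma cocycle_eq_zero_of_square (hφ : φ ∈ singularOneCocycles X)
    (K : C(stdSimplex ℝ (Fin 2) × stdSimplex ℝ (Fin 2), X))
    (h0 : φ (K.comp ((ContinuousMap.const _ (stdSimplex.vertex 0)).prodMk (ContinuousMap.id _))) = 0)
    (h1 : φ (K.comp ((ContinuousMap.const _ (stdSimplex.vertex 1)).prodMk (ContinuousMap.id _))) = 0)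
    (ht : φ (K.comp ((ContinuousMap.id _).prodMk (ContinuousMap.const _ (stdSimplex.vertex 1)))) = 0) :
    φ (K.comp ((ContinuousMap.id _).prodMk (ContinuousMap.const _ (stdSimplex.vertex 0)))) = 0 := by
  have hc (i : Fin 2) : affineMap ![stdSimplex.vertex (S := ℝ) i, stdSimplex.vertex i] =
      ContinuousMap.const _ (stdSimplex.vertex i) := by
    refine ContinuousMap.ext fun s ↦ ?_
    refine Eq.trans ?_ (affineMap_const (stdSimplex.vertex i) s)
    congr 2
    funext i; fin_cases i <;> rfl
  have key (P Q : Fin 3 → stdSimplex ℝ (Fin 2)) :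
      φ (K.comp ((affineMap ![P 1, P 2]).prodMk (affineMap ![Q 1, Q 2]))) +
        φ (K.comp ((affineMap ![P 0, P 2]).prodMk (affineMap ![Q 0, Q 2]))) +
        φ (K.comp ((affineMap ![P 0, P 1]).prodMk (affineMap ![Q 0, Q 1]))) = 0 := by
    have h := hφ (K.comp ((affineMap P).prodMk (affineMap Q)))
    have hcomp (i : Fin 3) : (K.comp ((affineMap P).prodMk (affineMap Q))).comp (simplexFace i) =
        K.comp ((affineMap (P ∘ i.succAbove)).prodMk (affineMap (Q ∘ i.succAbove))) := by
      rw [← affineMap_comp_simplexFace, ← affineMap_comp_simplexFace]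
      rfl
    simp_rw [hcomp] at h
    rw [Fin.sum_univ_three] at h
    have e0 (P : Fin 3 → stdSimplex ℝ (Fin 2)) : P ∘ (0 : Fin 3).succAbove = ![P 1, P 2] := by
      funext i; fin_cases i <;> rfl
    have e1 (P : Fin 3 → stdSimplex ℝ (Fin 2)) : P ∘ (1 : Fin 3).succAbove = ![P 0, P 2] := by
      funext i; fin_cases i <;> rfl
    have e2 (P : Fin 3 → stdSimplex ℝ (Fin 2)) : P ∘ (2 : Fin 3).succAbove = ![P 0, P 1] := by
      funext i; fin_cases i <;> rfl
    rwa [e0, e0, e1, e1, e2, e2] at h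
  -- The square is cut along its diagonal into two triangles.
  have k1 := key ![stdSimplex.vertex 0, stdSimplex.vertex 1, stdSimplex.vertex 1]
    ![stdSimplex.vertex 0, stdSimplex.vertex 0, stdSimplex.vertex 1]
  have k2 := key ![stdSimplex.vertex 0, stdSimplex.vertex 0, stdSimplex.vertex 1]
    ![stdSimplex.vertex 0, stdSimplex.vertex 1, stdSimplex.vertex 1]
  simp only [Matrix.cons_val_zero, Matrix.cons_val_one, Matrix.cons_val, affineMap_vertex_vertex, hc] at k1 k2
  rw [h1, zero_add] at k1
  rw [ht, h0, zero_add, add_zero] at k2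
  rwa [k2, zero_add] at k1

lemma cocycle_const (hφ : φ ∈ singularOneCocycles X) (x : X) : φ (ContinuousMap.const _ x) = 0 := by
  have h := hφ (ContinuousMap.const _ x)
  have hc (i) : (ContinuousMap.const (stdSimplex ℝ (Fin 3)) x).comp (simplexFace i) =
      ContinuousMap.const _ x := rfl
  simp_rw [hc] at h
  rw [Fin.sum_univ_three, CharTwo.add_self_eq_zero, zero_add] at h
  exact h

/-- The point of the standard 1-simplex with given parameter. -/
noncomputable def simplexPoint (a : unitInterval) : stdSimplex ℝ (Fin 2) :=
  stdSimplexHomeomorphUnitInterval.symm a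

lemma simplexPoint_apply_one (s : stdSimplex ℝ (Fin 2)) :
    simplexPoint (stdSimplexHomeomorphUnitInterval s) = s :=
  stdSimplexHomeomorphUnitInterval.symm_apply_apply s

/-- A 1-cocycle that vanishes on small paths vanishes. -/
lemma cocycle_eq_zero_of_cover (hφ : φ ∈ singularOneCocycles X) {κ : Type*} (U : κ → Set X)
    (hU : ∀ k, IsOpen (U k)) (hcover : ∀ x, ∃ k, x ∈ U k)
    (h : ∀ k γ, (∀ s, γ s ∈ U k) → φ γ = 0) (γ : C(stdSimplex ℝ (Fin 2), X)) : φ γ = 0 := by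
  -- The path is subdivided into pieces that each lie in one set of the cover, and the cocycle is
  -- additive over the pieces.
  obtain ⟨t, ht0, hmono, ⟨n, hn⟩, hsub⟩ := exists_monotone_Icc_subset_open_cover_unitInterval
    (c := fun k ↦ {a : unitInterval | γ (simplexPoint a) ∈ U k})
    (fun k ↦ (hU k).preimage (γ.continuous.comp stdSimplexHomeomorphUnitInterval.symm.continuous))
    (fun a _ ↦ Set.mem_iUnion.2 (hcover (γ (simplexPoint a))))
  have hstep (m : ℕ) : segmentValue φ γ (simplexPoint (t m)) (simplexPoint (t (m + 1))) = 0 := by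
    obtain ⟨k, hk⟩ := hsub m
    refine h k _ fun s ↦ ?_
    have hmem : stdSimplexHomeomorphUnitInterval
        (affineMap ![simplexPoint (t m), simplexPoint (t (m + 1))] s) ∈
          Set.Icc (t m) (t (m + 1)) := by
      have h1 : (stdSimplexHomeomorphUnitInterval
          (affineMap ![simplexPoint (t m), simplexPoint (t (m + 1))] s) : ℝ) =
            s 0 * t m + s 1 * t (m + 1) := by
        change affineMap ![simplexPoint (t m), simplexPoint (t (m + 1))] s 1 = _
        rw [affineMap_apply, Fin.sum_univ_two]
        rfl
      have h2 : s 0 + s 1 = 1 := stdSimplex.add_eq_one s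
      have h3 : (t m : ℝ) ≤ t (m + 1) := hmono (Nat.le_succ m)
      have h4 := stdSimplex.zero_le s 0
      have h5 := stdSimplex.zero_le s 1
      have h6 := mul_nonneg h4 (sub_nonneg.2 h3)
      have h7 := mul_nonneg h5 (sub_nonneg.2 h3)
      constructor <;> rw [← Subtype.coe_le_coe, h1] <;> rw [← sub_eq_iff_eq_add.2 h2.symm] at h6 ⊢ <;>
        linarith
    have h8 := hk hmem
    rw [Set.mem_ofPred_eq, simplexPoint_apply_one] at h8
    exact h8
  have hall (m : ℕ) : segmentValue φ γ (simplexPoint (t 0)) (simplexPoint (t m)) = 0 := by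
    induction m with
    | zero => exact segmentValue_self hφ _ _
    | succ m ih => rw [← segmentValue_add hφ γ _ (simplexPoint (t m)), ih, hstep, add_zero]
  have h9 := hall n
  have e0 : simplexPoint 0 = stdSimplex.vertex 0 :=
    (Homeomorph.symm_apply_eq _).2 stdSimplexHomeomorphUnitInterval_zero.symm
  have e1 : simplexPoint 1 = stdSimplex.vertex 1 :=
    (Homeomorph.symm_apply_eq _).2 stdSimplexHomeomorphUnitInterval_one.symm
  rw [ht0, hn n le_rfl, e0, e1, segmentValue, affineMap_vertex_vertex] at h9
  exact h9

end AffineSimplices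

/-! ### Restriction of singular cocycles to the edges, and its kernel -/

namespace IdealTriangulation

variable {T : IdealTriangulation}

/-- The canonical map of a tetrahedron to the compactified space. -/
def tetMap (T : IdealTriangulation) (t : Fin T.N) : C(stdSimplex ℝ (Fin 4), T.Compactified) where
  toFun p := Quot.mk _ (t, p)
  continuous_toFun := continuous_quot_mk.comp (by fun_prop)

lemma pointGlued_iff {y z : Fin T.N × stdSimplex ℝ (Fin 4)} : T.PointGlued y z ↔
    ∃ i, y.2 i = 0 ∧ z.1 = T.adj y.1 i ∧ z.2 = stdSimplex.map (T.glue y.1 i) y.2 := by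
  refine exists_congr fun i ↦ and_congr_right fun _ ↦ and_congr_right fun _ ↦ ⟨fun h ↦ ?_, ?_⟩
  · apply stdSimplex.ext
    funext v
    obtain ⟨v, rfl⟩ := (T.glue y.1 i).surjective v
    rw [stdSimplex_map_apply_of_injective (T.glue y.1 i).injective]
    exact h v
  · intro h v
    rw [h, stdSimplex_map_apply_of_injective (T.glue y.1 i).injective]

lemma tetMap_glue (t : Fin T.N) {i : Fin 4} {p : stdSimplex ℝ (Fin 4)} (h : p i = 0) :
    T.tetMap (T.adj t i) (stdSimplex.map (T.glue t i) p) = T.tetMap t p :=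
  (Quot.sound (pointGlued_iff.2 ⟨i, h, rfl, rfl⟩)).symm

lemma map_affineMap {n : ℕ} (g : Equiv.Perm (Fin 4)) (P : Fin (n + 1) → stdSimplex ℝ (Fin 4))
    (s : stdSimplex ℝ (Fin (n + 1))) :
    stdSimplex.map g (affineMap P s) = affineMap (fun i ↦ stdSimplex.map g (P i)) s := by
  apply stdSimplex.ext
  funext v
  obtain ⟨v, rfl⟩ := g.surjective v
  rw [stdSimplex_map_apply_of_injective g.injective, affineMap_apply, affineMap_apply]
  simp_rw [stdSimplex_map_apply_of_injective g.injective]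

lemma tetMap_affineMap_glue (t : Fin T.N) {i : Fin 4} {p q : stdSimplex ℝ (Fin 4)} (hp : p i = 0)
    (hq : q i = 0) :
    (T.tetMap (T.adj t i)).comp
        (affineMap ![stdSimplex.map (T.glue t i) p, stdSimplex.map (T.glue t i) q]) =
      (T.tetMap t).comp (affineMap ![p, q]) := by
  refine ContinuousMap.ext fun s ↦ ?_
  have h : affineMap ![p, q] s i = 0 := by
    rw [affineMap_apply, Fin.sum_univ_two]
    change s 0 * p i + s 1 * q i = 0
    rw [hp, hq]
    ring
  refine Eq.trans ?_ (tetMap_glue t h)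
  rw [map_affineMap]
  change T.tetMap _ (affineMap _ s) = _
  congr 3

variable {φ : C(stdSimplex ℝ (Fin 2), T.Compactified) → ZMod 2}

lemma segmentValue_glue (t : Fin T.N) {i : Fin 4} {p q : stdSimplex ℝ (Fin 4)} (hp : p i = 0)
    (hq : q i = 0) :
    segmentValue φ (T.tetMap (T.adj t i)) (stdSimplex.map (T.glue t i) p)
        (stdSimplex.map (T.glue t i) q) = segmentValue φ (T.tetMap t) p q :=
  congrArg φ (tetMap_affineMap_glue t hp hq)

lemma vertex_apply_of_ne {v i : Fin 4} (h : i ≠ v) : stdSimplex.vertex (S := ℝ) v i = 0 := by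
  simp [h]

/-- The value of a 1-cochain on the edge `ab` of the tetrahedron `t`. -/
noncomputable def edgePathValue (φ : C(stdSimplex ℝ (Fin 2), T.Compactified) → ZMod 2) (t : Fin T.N)
    (a b : Fin 4) : ZMod 2 :=
  segmentValue φ (T.tetMap t) (stdSimplex.vertex a) (stdSimplex.vertex b)

lemma edgePathValue_glue (t : Fin T.N) {i a b : Fin 4} (ha : i ≠ a) (hb : i ≠ b) :
    edgePathValue φ (T.adj t i) (T.glue t i a) (T.glue t i b) = edgePathValue φ t a b := by
  rw [edgePathValue, ← stdSimplex.map_vertex, ← stdSimplex.map_vertex,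
    segmentValue_glue t (vertex_apply_of_ne ha) (vertex_apply_of_ne hb), edgePathValue]

/-- An edge path of the triangulation, as a corner. -/
noncomputable def edgeCorner (E : T.Edge) : T.Corner :=
  (E.out.1, (OddPerm.exists_edge_eq E.out.2).choose)

lemma edge_edgeCorner (E : T.Edge) : (edgeCorner E).edge = E := by
  have h := (OddPerm.exists_edge_eq E.out.2).choose_spec
  rw [Corner.edge, edgeCorner]
  dsimp only
  rw [h]
  exact Quot.out_eq E

/-- The restriction of a singular 1-cochain to the edges of the triangulation. -/
noncomputable def edgeRestriction (φ : C(stdSimplex ℝ (Fin 2), T.Compactified) → ZMod 2)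
    (E : T.Edge) : ZMod 2 :=
  edgePathValue φ (edgeCorner E).1 ((edgeCorner E).2.1 0) ((edgeCorner E).2.1 3)

/-- The chosen representative of an edge class is immaterial: values agree across gluings, and a
cocycle modulo two ignores the direction of a segment. -/
lemma edgeValue_edgeRestriction (hφ : φ ∈ singularOneCocycles T.Compactified) (t : Fin T.N)
    (a b : Fin 4) : edgeValue (edgeRestriction φ) t a b = edgePathValue φ t a b := by
  have key (x : T.Corner) : edgePathValue φ x.1 (x.2.1 0) (x.2.1 3) = edgeRestriction φ x.edge := by
    obtain ⟨η, hη⟩ := Corner.exists_edge_function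
      (fun x : T.Corner ↦ edgePathValue φ x.1 (x.2.1 0) (x.2.1 3))
      (fun x ↦ by
        rw [Corner.turn_fst, Corner.turn_zero, Corner.turn_three]
        exact edgePathValue_glue _ (by simp) (by simp))
      (fun x ↦ by
        simp only [Corner.flip_fst, Corner.flip_snd, OddPerm.flip_zero, OddPerm.flip_three]
        exact segmentValue_comm hφ _ _ _)
    have h1 := hη x
    have h2 := hη (edgeCorner x.edge)
    rw [edge_edgeCorner] at h2
    exact h1.trans h2.symm
  by_cases hab : a = b
  · subst hab
    rw [edgePathValue, segmentValue_self hφ]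
    simp [edgeValue]
  · obtain ⟨f, hfa, hfb⟩ : ∃ f, f ≠ a ∧ f ≠ b := by revert a b; decide
    obtain ⟨π, -, ⟨rfl, rfl⟩ | ⟨rfl, rfl⟩⟩ := OddPerm.exists_edge_facet_eq hab hfa hfb
    · exact (edgeValue_corner _ (t, π)).trans (key (t, π)).symm
    · rw [edgeValue_comm]
      refine (edgeValue_corner _ (t, π)).trans ((key (t, π)).symm.trans ?_)
      exact segmentValue_comm hφ _ _ _

variable (T) in
/-- The restriction of singular 1-cocycles to the edges of the triangulation. -/
noncomputable def edgeRestrictionHom : singularOneCocycles T.Compactified →+ T.faceCocycles where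
  toFun φ := ⟨edgeRestriction φ.1, fun t a b d ↦ by
    simp only [edgeValue_edgeRestriction φ.2]
    have h := segmentValue_triangle φ.2 (T.tetMap t) (stdSimplex.vertex a) (stdSimplex.vertex b)
      (stdSimplex.vertex d)
    rw [← h]
    simp only [edgePathValue]
    ring⟩
  map_zero' := rfl
  map_add' _ _ := rfl

/-- With a single vertex every edge is a loop, on which a coboundary takes the same value twice. -/
lemma edgeRestrictionHom_eq_zero_of_coboundary
    (hv : ∀ t t' v v', T.idealVertex t v = T.idealVertex t' v')
    (φ : singularOneCocycles T.Compactified) (h : IsSingularOneCoboundary φ.1) :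
    edgeRestrictionHom T φ = 0 := by
  obtain ⟨f, hf⟩ := h
  refine Subtype.ext (funext fun E ↦ ?_)
  change φ.1 _ = 0
  rw [hf, Fin.sum_univ_two, ContinuousMap.comp_apply, ContinuousMap.comp_apply, affineMap_vertex,
    affineMap_vertex]
  change f (T.idealVertex _ _) + f (T.idealVertex _ _) = 0
  rw [hv _ (edgeCorner E).1 _ ((edgeCorner E).2.1 3), CharTwo.add_self_eq_zero]

/-! ### Contractions of open subsets -/

/-- The points whose coordinates in `S` are positive and larger than all the other ones. -/
def dominated (S : Finset (Fin 4)) : Set (stdSimplex ℝ (Fin 4)) :=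
  {p | ∀ i ∈ S, 0 < p i ∧ ∀ j ∉ S, p j < p i}

lemma isOpen_dominated (S : Finset (Fin 4)) : IsOpen (dominated S) := by
  have : dominated S = ⋂ i ∈ S, ({p | 0 < p i} ∩ ⋂ j ∈ Sᶜ, {p | p j < p i}) := by
    ext p
    simp [dominated]
  rw [this]
  refine isOpen_biInter_finset fun i _ ↦ (isOpen_lt continuous_const
    (continuous_stdSimplex_apply i)).inter (isOpen_biInter_finset fun j _ ↦
      isOpen_lt (continuous_stdSimplex_apply j) (continuous_stdSimplex_apply i))

/-- For nonempty `S` the set `dominated S` is the open star of the barycentre of `S` in the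
barycentric subdivision, and the stars for faces of equal dimension are disjoint. The centre chosen
in `contractionCentre` is therefore unambiguous. -/
lemma eq_of_mem_dominated {S S' : Finset (Fin 4)} (h : S.card = S'.card)
    {p : stdSimplex ℝ (Fin 4)} (hS : p ∈ dominated S) (hS' : p ∈ dominated S') : S = S' := by
  by_contra hne
  have h1 : ¬ S ⊆ S' := fun h' ↦ hne (Finset.eq_of_subset_of_card_le h' h.ge)
  have h2 : ¬ S' ⊆ S := fun h' ↦ hne (Finset.eq_of_subset_of_card_le h' h.le).symm
  obtain ⟨i, hi, hi'⟩ := Finset.not_subset.1 h1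
  obtain ⟨j, hj, hj'⟩ := Finset.not_subset.1 h2
  exact lt_asymm ((hS i hi).2 j hj') ((hS' j hj).2 i hi')

lemma exists_mem_dominated (p : stdSimplex ℝ (Fin 4)) :
    ∃ S : Finset (Fin 4), S.Nonempty ∧ p ∈ dominated S := by
  obtain ⟨v, hv⟩ := exists_eq_maxCoord p
  refine ⟨Finset.univ.filter fun i ↦ p i = maxCoord p, ⟨v, by simp [hv]⟩, fun i hi ↦ ?_⟩
  have hi' : p i = maxCoord p := by simpa using hi
  rw [hi']
  refine ⟨?_, fun j hj ↦ lt_of_le_of_ne (le_maxCoord p j) (by simpa using hj)⟩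
  by_contra hle
  have h1 := stdSimplex.sum_eq_one p
  have h2 : ∑ i, p i ≤ 0 := Finset.sum_nonpos fun i _ ↦ (le_maxCoord p i).trans (not_lt.1 hle)
  linarith

lemma mem_dominated_map (g : Equiv.Perm (Fin 4)) {S : Finset (Fin 4)} {p : stdSimplex ℝ (Fin 4)} :
    stdSimplex.map g p ∈ dominated (S.map g.toEmbedding) ↔ p ∈ dominated S := by
  simp only [dominated, Set.mem_ofPred_eq, Finset.mem_map_equiv]
  rw [← g.forall_congr_right]
  simp_rw [← g.forall_congr_right (q := fun j ↦ g.symm j ∉ S → _)]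
  simp [stdSimplex_map_apply_of_injective g.injective]

open Classical in
/-- The barycentre of a face of the tetrahedron. -/
noncomputable def faceCentre (S : Finset (Fin 4)) : stdSimplex ℝ (Fin 4) :=
  if h : S.Nonempty then ⟨fun i ↦ if i ∈ S then (S.card : ℝ)⁻¹ else 0, by
    constructor
    · intro i
      dsimp only
      split_ifs
      · positivity
      · rfl
    · have : (S.card : ℝ) ≠ 0 := by exact_mod_cast h.card_pos.ne'
      simp [this]⟩ else stdSimplex.vertex 0

lemma faceCentre_apply {S : Finset (Fin 4)} (h : S.Nonempty) (i : Fin 4) :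
    faceCentre S i = if i ∈ S then (S.card : ℝ)⁻¹ else 0 := by
  rw [faceCentre, dif_pos h]
  rfl

lemma map_faceCentre (g : Equiv.Perm (Fin 4)) {S : Finset (Fin 4)} (h : S.Nonempty) :
    stdSimplex.map g (faceCentre S) = faceCentre (S.map g.toEmbedding) := by
  apply stdSimplex.ext
  funext i
  obtain ⟨i, rfl⟩ := g.surjective i
  rw [stdSimplex_map_apply_of_injective g.injective, faceCentre_apply h,
    faceCentre_apply (h.map)]
  simp

open Classical in
/-- The point to which `p` is contracted. -/
noncomputable def contractionCentre (k : ℕ) (p : stdSimplex ℝ (Fin 4)) : stdSimplex ℝ (Fin 4) :=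
  if h : ∃ S : Finset (Fin 4), S.Nonempty ∧ S.card = k ∧ p ∈ dominated S then faceCentre h.choose
  else p

lemma contractionCentre_of_mem {S : Finset (Fin 4)} (hS : S.Nonempty) {p : stdSimplex ℝ (Fin 4)}
    (hp : p ∈ dominated S) : contractionCentre S.card p = faceCentre S := by
  have h : ∃ S' : Finset (Fin 4), S'.Nonempty ∧ S'.card = S.card ∧ p ∈ dominated S' :=
    ⟨S, hS, rfl, hp⟩
  rw [contractionCentre, dif_pos h,
    eq_of_mem_dominated h.choose_spec.2.1 h.choose_spec.2.2 hp]

lemma map_contractionCentre (k : ℕ) (g : Equiv.Perm (Fin 4)) (p : stdSimplex ℝ (Fin 4)) :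
    stdSimplex.map g (contractionCentre k p) = contractionCentre k (stdSimplex.map g p) := by
  by_cases h : ∃ S : Finset (Fin 4), S.Nonempty ∧ S.card = k ∧ p ∈ dominated S
  · obtain ⟨S, hS, rfl, hp⟩ := h
    rw [contractionCentre_of_mem hS hp, map_faceCentre g hS, ← Finset.card_map g.toEmbedding,
      contractionCentre_of_mem hS.map ((mem_dominated_map g).2 hp)]
  · have h' : ¬ ∃ S : Finset (Fin 4), S.Nonempty ∧ S.card = k ∧ stdSimplex.map g p ∈ dominated S := by
      rintro ⟨S, hS, hk, hp⟩
      refine h ⟨S.map g.symm.toEmbedding, hS.map, by simpa using hk, ?_⟩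
      rw [← mem_dominated_map g, Finset.map_map]
      simpa using hp
    rw [contractionCentre, contractionCentre, dif_neg h, dif_neg h']

/-- A point of a face is contracted inside that face, so the contraction is compatible with the
gluing. -/
lemma contractionCentre_apply_eq_zero (k : ℕ) {p : stdSimplex ℝ (Fin 4)} {i : Fin 4}
    (h : p i = 0) : contractionCentre k p i = 0 := by
  by_cases h' : ∃ S : Finset (Fin 4), S.Nonempty ∧ S.card = k ∧ p ∈ dominated S
  · obtain ⟨S, hS, rfl, hp⟩ := h'
    rw [contractionCentre_of_mem hS hp, faceCentre_apply hS, if_neg]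
    exact fun hi ↦ (hp i hi).1.ne' h
  · rw [contractionCentre, dif_neg h', h]

/-- The straight-line contraction of the tetrahedra, on the quotient space. -/
noncomputable def contraction (k : ℕ) (z : T.Compactified) (s : stdSimplex ℝ (Fin 2)) :
    T.Compactified :=
  Quot.lift (fun y : Fin T.N × stdSimplex ℝ (Fin 4) ↦
    T.tetMap y.1 (affineMap ![y.2, contractionCentre k y.2] s)) (by
      rintro ⟨t, p⟩ ⟨_, _⟩ h
      obtain ⟨i, h1, rfl, rfl⟩ := pointGlued_iff.1 h
      dsimp only
      rw [← map_contractionCentre]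
      exact (DFunLike.congr_fun (tetMap_affineMap_glue t h1 (contractionCentre_apply_eq_zero k h1))
        s).symm) z

/-- The open set that is contracted to the barycentres of the faces with `k` vertices. -/
def contractible (T : IdealTriangulation) (k : ℕ) : Set T.Compactified :=
  {z | Quot.lift (fun y : Fin T.N × stdSimplex ℝ (Fin 4) ↦
    ∃ S : Finset (Fin 4), S.Nonempty ∧ S.card = k ∧ y.2 ∈ dominated S) (by
      rintro ⟨t, p⟩ ⟨_, _⟩ h
      obtain ⟨i, h1, rfl, rfl⟩ := pointGlued_iff.1 h
      dsimp only
      refine propext ⟨?_, ?_⟩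
      · rintro ⟨S, hS, hk, hp⟩
        exact ⟨S.map (T.glue t i).toEmbedding, hS.map, by simpa using hk,
          (mem_dominated_map _).2 hp⟩
      · rintro ⟨S, hS, hk, hp⟩
        refine ⟨S.map (T.glue t i).symm.toEmbedding, hS.map, by simpa using hk, ?_⟩
        rw [← mem_dominated_map (T.glue t i), Finset.map_map]
        simpa using hp) z}

lemma isOpen_contractible (k : ℕ) : IsOpen (T.contractible k) := by
  rw [← isQuotientMap_quot_mk.isOpen_preimage]
  have : Quot.mk _ ⁻¹' T.contractible k = ⋃ S : Finset (Fin 4), ⋃ _ : S.Nonempty,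
      ⋃ _ : S.card = k, (Prod.snd ⁻¹' dominated S : Set (Fin T.N × stdSimplex ℝ (Fin 4))) := by
    ext y
    simp only [Set.mem_iUnion, exists_prop]
    rfl
  rw [this]
  exact isOpen_iUnion fun S ↦ isOpen_iUnion fun _ ↦ isOpen_iUnion fun _ ↦
    (isOpen_dominated S).preimage continuous_snd

lemma continuous_affineMap_pair {Y : Type*} [TopologicalSpace Y]
    {p q : Y → stdSimplex ℝ (Fin 4)} {s : Y → stdSimplex ℝ (Fin 2)} (hp : Continuous p)
    (hq : Continuous q) (hs : Continuous s) : Continuous fun y ↦ affineMap ![p y, q y] (s y) := by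
  have h : Continuous fun y ↦ (fun v ↦ s y 0 * p y v + s y 1 * q y v : Fin 4 → ℝ) :=
    continuous_pi fun v ↦ (((continuous_stdSimplex_apply 0).comp hs).mul
      ((continuous_stdSimplex_apply v).comp hp)).add
        (((continuous_stdSimplex_apply 1).comp hs).mul ((continuous_stdSimplex_apply v).comp hq))
  refine continuous_induced_rng.2 (h.congr fun y ↦ ?_)
  funext v
  exact (Fin.sum_univ_two fun i ↦ s y i * (![p y, q y] : Fin 2 → _) i v).symm

lemma continuous_contraction (k : ℕ) : Continuous
    fun z : T.contractible k × stdSimplex ℝ (Fin 2) ↦ contraction k z.1.1 z.2 := by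
  -- Over an open set the projection remains a quotient map, also after taking the product with a
  -- compact interval; so continuity can be checked upstairs, where the centre is locally constant.
  have hq : Topology.IsQuotientMap ((T.contractible k).restrictPreimage
      (Quot.mk T.PointGlued)) :=
    isQuotientMap_quot_mk.restrictPreimage_isOpen (isOpen_contractible k)
  refine hq.continuous_lift_prod_left ?_
  rw [continuous_iff_continuousAt]
  rintro ⟨⟨⟨t, p⟩, S, hS, rfl, hp⟩, s⟩
  have h1 : Continuous fun z : (Quot.mk T.PointGlued ⁻¹' T.contractible S.card) ×
      stdSimplex ℝ (Fin 2) ↦ (Quot.mk _ (z.1.1.1, affineMap ![z.1.1.2, faceCentre S] z.2) :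
        T.Compactified) := by
    refine continuous_quot_mk.comp (Continuous.prodMk (by fun_prop) ?_)
    exact continuous_affineMap_pair (by fun_prop) continuous_const continuous_snd
  refine h1.continuousAt.congr ?_
  have h2 : ∀ᶠ z : (Quot.mk T.PointGlued ⁻¹' T.contractible S.card) × stdSimplex ℝ (Fin 2) in
      nhds (⟨(t, p), S, hS, rfl, hp⟩, s), z.1.1.2 ∈ dominated S :=
    ((isOpen_dominated S).preimage (f := fun z : (Quot.mk T.PointGlued ⁻¹'
      T.contractible S.card) × stdSimplex ℝ (Fin 2) ↦ z.1.1.2) (by fun_prop)).mem_nhds hp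
  filter_upwards [h2] with z hz
  change T.tetMap _ _ = T.tetMap _ _
  rw [contractionCentre_of_mem hS hz]

lemma contraction_zero (k : ℕ) (z : T.Compactified) :
    contraction k z (stdSimplex.vertex 0) = z := by
  induction z using Quot.inductionOn with | _ y
  change T.tetMap _ (affineMap _ _) = _
  rw [affineMap_vertex]
  rfl

lemma contraction_one_mem (k : ℕ) {z : T.Compactified} (hz : z ∈ T.contractible k) :
    contraction k z (stdSimplex.vertex 1) ∈
      Set.range fun x : Fin T.N × Finset (Fin 4) ↦ T.tetMap x.1 (faceCentre x.2) := by
  induction z using Quot.inductionOn with | _ y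
  obtain ⟨S, hS, rfl, hp⟩ := hz
  refine ⟨(y.1, S), ?_⟩
  change _ = T.tetMap _ (affineMap _ _)
  rw [affineMap_vertex, contractionCentre_of_mem hS hp]
  rfl

/-- A 1-cocycle that vanishes on the segments in the tetrahedra vanishes. -/
lemma cocycle_eq_zero_of_segments [T2Space T.Compactified]
    (hφ : φ ∈ singularOneCocycles T.Compactified)
    (hs : ∀ t p q, segmentValue φ (T.tetMap t) p q = 0) (γ) : φ γ = 0 := by
  refine cocycle_eq_zero_of_cover hφ T.contractible isOpen_contractible (fun z ↦ ?_)
    (fun k γ hγ ↦ ?_) γ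
  · induction z using Quot.inductionOn with | _ y
    obtain ⟨S, hS, hp⟩ := exists_mem_dominated y.2
    exact ⟨S.card, S, hS, rfl, hp⟩
  -- The homotopy moves the small path to the barycentres. Its vertical sides are segments in
  -- tetrahedra, on which the cocycle vanishes by assumption.
  · let K : C(stdSimplex ℝ (Fin 2) × stdSimplex ℝ (Fin 2), T.Compactified) :=
      ⟨fun z ↦ contraction k (γ z.1) z.2, (continuous_contraction k).comp
        (f := fun z : stdSimplex ℝ (Fin 2) × stdSimplex ℝ (Fin 2) ↦
          ((⟨γ z.1, hγ z.1⟩ : T.contractible k), z.2)) (by fun_prop)⟩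
    have hvert (a : stdSimplex ℝ (Fin 2)) :
        φ (K.comp ((ContinuousMap.const _ a).prodMk (ContinuousMap.id _))) = 0 := by
      obtain ⟨y, hy⟩ := Quot.exists_rep (γ a)
      rw [← hs y.1 y.2 (contractionCentre k y.2)]
      refine congrArg φ (ContinuousMap.ext fun s ↦ ?_)
      change contraction k (γ a) s = _
      rw [← hy]
      rfl
    -- The top is a path in a finite Hausdorff, hence discrete, set of points; so it is constant.
    have htop : φ (K.comp ((ContinuousMap.id _).prodMk
        (ContinuousMap.const _ (stdSimplex.vertex 1)))) = 0 := by
      set τ := K.comp ((ContinuousMap.id _).prodMk (ContinuousMap.const _ (stdSimplex.vertex 1)))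
        with hτ
      have hc (s) : τ s = τ (stdSimplex.vertex 0) := by
        have hfin := Set.finite_range
          fun x : Fin T.N × Finset (Fin 4) ↦ T.tetMap x.1 (faceCentre x.2)
        exact isPreconnected_univ.constant_of_mapsTo hfin.isDiscrete τ.continuous.continuousOn
          (fun s _ ↦ contraction_one_mem k (hγ s)) (Set.mem_univ _) (Set.mem_univ _)
      rw [show τ = ContinuousMap.const _ (τ (stdSimplex.vertex 0)) from ContinuousMap.ext hc]
      exact cocycle_const hφ _
    rw [← cocycle_eq_zero_of_square hφ K (hvert _) (hvert _) htop]
    refine congrArg φ (ContinuousMap.ext fun s ↦ ?_)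
    exact (contraction_zero k (γ s)).symm

/-- A 1-cocycle that vanishes on the edges of a triangulation with one vertex is a coboundary. -/
theorem coboundary_of_edgeRestrictionHom_eq_zero [T2Space T.Compactified]
    (φ : singularOneCocycles T.Compactified) (h : edgeRestrictionHom T φ = 0) :
    IsSingularOneCoboundary φ.1 := by
  have hE (t : Fin T.N) (a b : Fin 4) : segmentValue φ.1 (T.tetMap t) (stdSimplex.vertex a)
      (stdSimplex.vertex b) = 0 := by
    have h1 := edgeValue_edgeRestriction φ.2 t a b
    rw [show edgeRestriction φ.1 = 0 from congrArg Subtype.val h] at h1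
    exact h1.symm.trans (by simp [edgeValue])
  have hV (t : Fin T.N) (a b : Fin 4) (p : stdSimplex ℝ (Fin 4)) :
      segmentValue φ.1 (T.tetMap t) (stdSimplex.vertex a) p =
        segmentValue φ.1 (T.tetMap t) (stdSimplex.vertex b) p := by
    rw [← segmentValue_add φ.2 _ _ (stdSimplex.vertex b), hE, zero_add]
  -- The primitive is the integral of the cocycle from a vertex of the tetrahedron. By `hV` any
  -- vertex may be used, and across a face one takes a vertex of that face.
  let f : T.Compactified → ZMod 2 := Quot.lift (fun y : Fin T.N × stdSimplex ℝ (Fin 4) ↦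
    segmentValue φ.1 (T.tetMap y.1) (stdSimplex.vertex 0) y.2) (by
      rintro ⟨t, p⟩ ⟨_, _⟩ h
      obtain ⟨i, h1, rfl, rfl⟩ := pointGlued_iff.1 h
      obtain ⟨j, hj⟩ : ∃ j, i ≠ j := (exists_ne i).imp fun _ h ↦ h.symm
      dsimp only
      rw [hV _ 0 j, hV (T.adj t i) 0 (T.glue t i j), ← stdSimplex.map_vertex,
        segmentValue_glue t (vertex_apply_of_ne hj) h1])
  -- Subtracting the coboundary of `f` leaves a cocycle that vanishes on all segments in tetrahedra.
  let ψ : C(stdSimplex ℝ (Fin 2), T.Compactified) → ZMod 2 :=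
    fun γ ↦ φ.1 γ + ∑ i, f (γ (stdSimplex.vertex i))
  have hψ : ψ ∈ singularOneCocycles T.Compactified := by
    refine Submodule.add_mem _ φ.2 fun σ ↦ ?_
    have hface (i : Fin 3) (j : Fin 2) :
        (σ.comp (simplexFace i)) (stdSimplex.vertex j) = σ (stdSimplex.vertex (i.succAbove j)) :=
      congrArg σ (stdSimplex.map_vertex _ _)
    simp only [hface, Fin.sum_univ_two]
    refine (Fin.sum_univ_three _).trans ?_
    change f (σ (stdSimplex.vertex 1)) + f (σ (stdSimplex.vertex 2)) +
      (f (σ (stdSimplex.vertex 0)) + f (σ (stdSimplex.vertex 2))) +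
      (f (σ (stdSimplex.vertex 0)) + f (σ (stdSimplex.vertex 1))) = 0
    generalize f (σ (stdSimplex.vertex 0)) = a
    generalize f (σ (stdSimplex.vertex 1)) = b
    generalize f (σ (stdSimplex.vertex 2)) = c
    revert a b c
    decide
  have hseg (t : Fin T.N) (p q : stdSimplex ℝ (Fin 4)) : segmentValue ψ (T.tetMap t) p q = 0 := by
    change segmentValue φ.1 (T.tetMap t) p q + _ = 0
    rw [Fin.sum_univ_two, ContinuousMap.comp_apply, ContinuousMap.comp_apply, affineMap_vertex,
      affineMap_vertex, ← segmentValue_triangle φ.2 (T.tetMap t) (stdSimplex.vertex 0) p q,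
      add_assoc]
    congr 1
    exact add_comm _ _
  refine ⟨f, fun γ ↦ ?_⟩
  exact CharTwo.add_eq_zero.1 (cocycle_eq_zero_of_segments hψ hseg γ)

end IdealTriangulation

/-! ### Coordinates for the double covering of a face cocycle -/

namespace IdealTriangulation

variable {T : IdealTriangulation}

/-! ### Faces with a marked vertex -/

/-- A face of a tetrahedron, given by the set of its vertices, with a marked vertex. -/
abbrev MarkedFace (T : IdealTriangulation) : Type := Fin T.N × Fin 4 × Finset (Fin 4)

/-- The gluing of the marked faces of the tetrahedra. -/
def MarkedGlued (x y : T.MarkedFace) : Prop :=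
  ∃ i, i ∉ x.2.2 ∧
    y = (T.adj x.1 i, T.glue x.1 i x.2.1, x.2.2.map (T.glue x.1 i).toEmbedding)

lemma MarkedGlued.symm {x y : T.MarkedFace} (h : MarkedGlued x y) : MarkedGlued y x := by
  obtain ⟨i, hi, rfl⟩ := h
  refine ⟨T.glue x.1 i i, by simpa using hi, ?_⟩
  dsimp only
  rw [T.adj_adj, T.glue_glue, Finset.map_map]
  refine Prod.ext rfl (Prod.ext (by simp) ?_)
  ext v
  simp

lemma MarkedGlued.card_eq {x y : T.MarkedFace} (h : MarkedGlued x y) :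
    x.2.2.card = y.2.2.card := by
  obtain ⟨i, -, rfl⟩ := h
  simp

lemma eq_of_notMem_of_card {S : Finset (Fin 4)} (h : 3 ≤ S.card) {i j : Fin 4} (hi : i ∉ S)
    (hj : j ∉ S) : i = j := by
  by_contra hij
  have h1 : ({i, j} : Finset (Fin 4)).card ≤ Sᶜ.card :=
    Finset.card_le_card (by intro k; simp; rintro (rfl | rfl) <;> assumption)
  rw [Finset.card_pair hij, Finset.card_compl, Fintype.card_fin] at h1
  omega

/-- The marked faces glued to a given one, if its dimension is at least two. -/
def facePair (x : T.MarkedFace) : Set T.MarkedFace :=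
  {y | 3 ≤ x.2.2.card ∧ (y = x ∨ MarkedGlued x y)}

/-- A triangle misses exactly one vertex, so it is glued across one face only, and the inverse
gluing leads back; a whole tetrahedron is not glued at all. -/
lemma facePair_eq {x y : T.MarkedFace} (h : MarkedGlued x y) : facePair x = facePair y := by
  have key : ∀ x y : T.MarkedFace, MarkedGlued x y → facePair x ⊆ facePair y := by
    rintro x y h z ⟨hx, rfl | hz⟩
    · exact ⟨h.card_eq ▸ hx, Or.inr h.symm⟩
    · refine ⟨h.card_eq ▸ hx, Or.inl ?_⟩
      obtain ⟨i, hi, rfl⟩ := h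
      obtain ⟨j, hj, rfl⟩ := hz
      rw [eq_of_notMem_of_card hx hi hj]
  exact (key _ _ h).antisymm (key _ _ h.symm)

/-- The rotation about an edge, as a permutation of the corners. -/
noncomputable def turnPerm : Equiv.Perm T.Corner := Equiv.ofBijective _ Corner.turn_bijective

lemma turnPerm_pow_apply (n : ℕ) (x : T.Corner) : (turnPerm ^ n) x = Corner.turn^[n] x := by
  rw [Equiv.Perm.coe_pow]
  rfl

/-- The corners on the edges glued to a given marked edge. -/
def edgeCorners (x : T.MarkedFace) : Set T.Corner :=
  {c | ∃ c' : T.Corner, (c'.1 = x.1 ∧ c'.2.1 0 = x.2.1 ∧ {c'.2.1 0, c'.2.1 3} = x.2.2) ∧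
    turnPerm.SameCycle c' c}

/-- Gluing an edge along a face turns its corner by one step, forwards or backwards. -/
lemma edgeCorners_eq {x y : T.MarkedFace} (h : MarkedGlued x y) : edgeCorners x = edgeCorners y := by
  have key : ∀ x y : T.MarkedFace, MarkedGlued x y → edgeCorners x ⊆ edgeCorners y := by
    rintro ⟨t, a, S⟩ _ ⟨i, hi, rfl⟩ c ⟨⟨t, π⟩, ⟨rfl, rfl, rfl⟩, hc⟩
    dsimp only at hi
    have hi' : i = π.1 1 ∨ i = π.1 2 := by
      obtain ⟨j, rfl⟩ := π.1.surjective i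
      have : j = 1 ∨ j = 2 := by
        simp at hi
        omega
      exact this.imp (congrArg _) (congrArg _)
    rcases hi' with rfl | rfl
    · refine ⟨(Corner.flip (t, π)).turn.flip, ⟨by simp, by simp, ?_⟩, Equiv.Perm.SameCycle.trans ?_ hc⟩
      · simp [Finset.map_insert]
      · refine ⟨1, ?_⟩
        change Corner.turn _ = _
        rw [Corner.turn_flip_turn, Corner.flip_flip]
    · refine ⟨Corner.turn (t, π), ⟨by simp, by simp, ?_⟩, Equiv.Perm.SameCycle.trans ?_ hc⟩
      · simp [Finset.map_insert]
      · exact Equiv.Perm.SameCycle.symm ⟨1, rfl⟩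
  exact (key _ _ h).antisymm (key _ _ h.symm)

/-- The gluing does not move the marking of a face. -/
lemma eq_of_markedFace_eq {t : Fin T.N} {a b : Fin 4} {S : Finset (Fin 4)} (ha : a ∈ S) (hb : b ∈ S)
    (h : Quot.mk MarkedGlued (t, a, S) = Quot.mk MarkedGlued (t, b, S)) : a = b := by
  by_contra hab
  have h1 : facePair (t, a, S) = facePair (t, b, S) :=
    congrArg (Quot.lift facePair fun _ _ ↦ facePair_eq) h
  have h2 : edgeCorners (t, a, S) = edgeCorners (t, b, S) :=
    congrArg (Quot.lift edgeCorners fun _ _ ↦ edgeCorners_eq) h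
  have hsub : ({a, b} : Finset (Fin 4)) ⊆ S := by
    intro c; simp; rintro (rfl | rfl) <;> assumption
  have hcard := Finset.card_le_card hsub
  rw [Finset.card_pair hab] at hcard
  -- For an edge the two markings are its two directions, which no sequence of turns exchanges. For
  -- a larger face an exchange would require gluing a face to itself.
  rcases hcard.eq_or_lt with h3 | h3
  · have hS : ({a, b} : Finset (Fin 4)) = S :=
      Finset.eq_of_subset_of_card_le hsub (by rw [Finset.card_pair hab, h3])
    obtain ⟨π, rfl, rfl⟩ : ∃ π : OddPerm, π.1 0 = a ∧ π.1 3 = b := by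
      clear * - hab
      revert a b; decide +kernel
    have hmem : ((t, π) : T.Corner) ∈ edgeCorners (t, π.1 0, S) :=
      ⟨(t, π), ⟨rfl, rfl, hS⟩, .refl _ _⟩
    rw [h2] at hmem
    obtain ⟨⟨t', τ⟩, ⟨h4, h5, h6⟩, h7⟩ := hmem
    dsimp only at h4 h5 h6
    subst h4
    have h8 : π.edge = τ.edge := by
      have h9 : τ.1 3 = π.1 0 := by
        have h10 : τ.1 3 ∈ ({π.1 0, π.1 3} : Finset (Fin 4)) := by rw [hS, ← h6]; simp
        simp only [Finset.mem_insert, Finset.mem_singleton] at h10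
        refine h10.resolve_right fun h ↦ ?_
        rw [← h5] at h
        simp at h
      refine Subtype.ext ?_
      simp [OddPerm.edge, tetEdge, h5, h9]
    rcases OddPerm.eq_or_eq_flip h8 with rfl | rfl
    · exact hab h5
    · obtain ⟨n, -, hn⟩ := h7.symm.exists_pow_eq'
      rw [turnPerm_pow_apply] at hn
      exact Corner.iterate_turn_ne_flip n _ hn
  · have hmem : (t, b, S) ∈ facePair (t, a, S) := by
      rw [h1]
      exact ⟨h3, Or.inl rfl⟩
    rcases hmem.2 with h4 | ⟨i, hi, h4⟩
    · simp only [Prod.mk.injEq, true_and, and_true] at h4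
      exact hab h4.symm
    · simp only [Prod.mk.injEq] at h4
      refine T.ne_self t i (Prod.ext h4.1.symm ?_)
      refine eq_of_notMem_of_card h3 ?_ hi
      rw [h4.2.2]
      simpa using hi

/-! ### Bump functions -/

/-- A bump function supported on the points dominated by a face. -/
noncomputable def bump (S : Finset (Fin 4)) (p : stdSimplex ℝ (Fin 4)) : ℝ :=
  ∏ i ∈ S, (p i * ∏ j ∈ Sᶜ, max 0 (p i - p j))

lemma continuous_bump (S : Finset (Fin 4)) : Continuous (bump S) := by
  refine continuous_finsetProd _ fun i _ ↦ (continuous_stdSimplex_apply i).mul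
    (continuous_finsetProd _ fun j _ ↦ continuous_const.max
      ((continuous_stdSimplex_apply i).sub (continuous_stdSimplex_apply j)))

lemma bump_ne_zero_iff {S : Finset (Fin 4)} {p : stdSimplex ℝ (Fin 4)} :
    bump S p ≠ 0 ↔ p ∈ dominated S := by
  rw [bump, Finset.prod_ne_zero_iff]
  refine forall₂_congr fun i _ ↦ ?_
  rw [mul_ne_zero_iff, Finset.prod_ne_zero_iff, (stdSimplex.zero_le p i).lt_iff_ne']
  refine and_congr_right fun _ ↦ forall_congr' fun j ↦ ?_
  rw [Finset.mem_compl]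
  refine imp_congr_right fun _ ↦ ?_
  rw [Ne, max_eq_left_iff, sub_nonpos, not_le]

lemma bump_map (g : Equiv.Perm (Fin 4)) (S : Finset (Fin 4)) (p : stdSimplex ℝ (Fin 4)) :
    bump (S.map g.toEmbedding) (stdSimplex.map g p) = bump S p := by
  rw [bump, bump, Finset.prod_map]
  refine Finset.prod_congr rfl fun i _ ↦ ?_
  have : (S.map g.toEmbedding)ᶜ = Sᶜ.map g.toEmbedding := by
    ext v
    simp
  rw [this, Finset.prod_map]
  simp [stdSimplex_map_apply_of_injective g.injective]

lemma bump_eq_zero {S : Finset (Fin 4)} {p : stdSimplex ℝ (Fin 4)} {i : Fin 4} (hi : i ∈ S)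
    (h : p i = 0) : bump S p = 0 := by
  by_contra hne
  exact (bump_ne_zero_iff.1 hne i hi).1.ne' h

end IdealTriangulation

/-! ### Cocycles from maps to nonzero vectors up to sign -/

section SignCovering

variable {D : Type}

/-- The space of real vectors up to sign. -/
abbrev SignQuotient (D : Type) : Type := Quotient (MulAction.orbitRel ℤˣ (D → ℝ))

open Classical in
/-- The sign by which two vectors differ, written additively. -/
noncomputable def signDiff (v w : D → ℝ) : ZMod 2 := if v = w then 0 else 1

lemma mk_eq_mk_iff {v w : D → ℝ} :
    (⟦v⟧ : SignQuotient D) = ⟦w⟧ ↔ v = w ∨ v = -w := by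
  rw [Quotient.eq]
  change v ∈ MulAction.orbit ℤˣ w ↔ _
  constructor
  · rintro ⟨u, rfl⟩
    rcases Int.units_eq_one_or u with rfl | rfl
    · exact Or.inl (one_smul _ _)
    · refine Or.inr ?_
      simp
  · rintro (rfl | rfl)
    · exact MulAction.mem_orbit_self _
    · exact ⟨-1, by simp⟩

lemma signDiff_self (v : D → ℝ) : signDiff v v = 0 := if_pos rfl

lemma signDiff_comm (v w : D → ℝ) : signDiff v w = signDiff w v := by
  classical
  unfold signDiff
  exact if_congr eq_comm rfl rfl

lemma neg_ne_self_of_ne_zero {v : D → ℝ} (hv : v ≠ 0) : -v ≠ v := by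
  obtain ⟨d, hd⟩ := Function.ne_iff.1 hv
  intro h
  have := congrFun h d
  rw [Pi.neg_apply, Pi.zero_apply] at *
  exact hd (by linarith)

lemma signDiff_neg {v : D → ℝ} (hv : v ≠ 0) : signDiff (-v) v = 1 :=
  if_neg (neg_ne_self_of_ne_zero hv)

lemma signDiff_neg_neg (v w : D → ℝ) : signDiff (-v) (-w) = signDiff v w := by
  classical
  unfold signDiff
  exact if_congr neg_inj rfl rfl

/-- All three vectors lie in one class up to sign; in general `signDiff` is $1$ for any two distinct
vectors and is not additive. -/
lemma signDiff_add {u v w : D → ℝ} (hv : v ≠ 0) (h : (⟦u⟧ : SignQuotient D) = ⟦v⟧)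
    (h' : (⟦v⟧ : SignQuotient D) = ⟦w⟧) : signDiff u v + signDiff v w = signDiff u w := by
  rcases mk_eq_mk_iff.1 h with rfl | rfl
  · rw [signDiff_self, zero_add]
  · rcases mk_eq_mk_iff.1 h'.symm with rfl | rfl
    · rw [signDiff_self, add_zero]
    · rw [signDiff_neg_neg, signDiff_self, signDiff_neg hv, signDiff_comm, signDiff_neg hv]
      decide

lemma ne_zero_of_lift {n : ℕ} {g : C(stdSimplex ℝ (Fin (n + 1)), SignQuotient D)}
    (hg : ∀ s, ∃ v ≠ 0, g s = ⟦v⟧) {L : C(stdSimplex ℝ (Fin (n + 1)), D → ℝ)}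
    (hL : ∀ s, ⟦L s⟧ = g s) (s) : L s ≠ 0 := by
  obtain ⟨v, hv, h⟩ := hg s
  rcases mk_eq_mk_iff.1 ((hL s).trans h) with h | h <;> simpa [h] using hv

variable [Fintype D]

/-- The group $\{\pm1\}$ acts freely away from the zero vector. -/
lemma isCoveringMapOn_signQuotient :
    IsCoveringMapOn (fun v : D → ℝ ↦ (⟦v⟧ : SignQuotient D)) ((⟦·⟧) '' {v | v ≠ 0}) := by
  refine (isCoveringMapOn_quotientMk_of_properlyDiscontinuousSMul
    (G := ℤˣ) (E := D → ℝ)).mono ?_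
  refine Set.image_mono fun v hv ↦ ?_
  refine (Subgroup.eq_bot_iff_forall _).2 fun u hu ↦ ?_
  rcases Int.units_eq_one_or u with rfl | rfl
  · rfl
  · have h : (-1 : ℤˣ) • v = v := hu
    exact absurd (by simpa using h) (neg_ne_self_of_ne_zero hv)

variable {n : ℕ} {g : C(stdSimplex ℝ (Fin (n + 1)), SignQuotient D)}

lemma existsUnique_lift (hg : ∀ s, ∃ v ≠ 0, g s = ⟦v⟧) (a : stdSimplex ℝ (Fin (n + 1))) (v : D → ℝ)
    (hv : ⟦v⟧ = g a) :
    ∃! L : C(stdSimplex ℝ (Fin (n + 1)), D → ℝ), L a = v ∧ (⟦·⟧) ∘ L = g := by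
  have := (convex_stdSimplex ℝ (Fin (n + 1))).contractibleSpace ⟨_, a.2⟩
  have := (convex_stdSimplex ℝ (Fin (n + 1))).locallyPathConnectedSpace
  refine isCoveringMapOn_signQuotient.existsUnique_continuousMap_lifts g hv fun s ↦ ?_
  obtain ⟨v, hv, h⟩ := hg s
  exact ⟨v, hv, h.symm⟩

lemma eq_or_eq_neg_of_lifts (hg : ∀ s, ∃ v ≠ 0, g s = ⟦v⟧)
    {L L' : C(stdSimplex ℝ (Fin (n + 1)), D → ℝ)} (hL : ∀ s, ⟦L s⟧ = g s)
    (hL' : ∀ s, ⟦L' s⟧ = g s) : L = L' ∨ L = -L' := by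
  have h := existsUnique_lift hg (stdSimplex.vertex 0) _ (hL _)
  rcases mk_eq_mk_iff.1 ((hL (stdSimplex.vertex 0)).trans (hL' _).symm) with h' | h'
  · exact Or.inl (h.unique ⟨rfl, funext hL⟩ ⟨h'.symm, funext hL'⟩)
  · refine Or.inr (h.unique ⟨rfl, funext hL⟩ ⟨h'.symm, funext fun s ↦ ?_⟩)
    exact Eq.trans (mk_eq_mk_iff.2 (Or.inr rfl)) (hL' s)

variable {X : Type} [TopologicalSpace X]

/-- A double covering, given by a map to the nonzero vectors up to sign, yields a 1-cocycle. -/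
theorem exists_cocycle_of_signQuotient (F : C(X, SignQuotient D)) (hF : ∀ x, ∃ v ≠ 0, F x = ⟦v⟧) :
    ∃ φ ∈ singularOneCocycles X, ∀ (γ : C(stdSimplex ℝ (Fin 2), X))
      (L : C(stdSimplex ℝ (Fin 2), D → ℝ)), (∀ s, ⟦L s⟧ = F (γ s)) →
      γ (stdSimplex.vertex 0) = γ (stdSimplex.vertex 1) →
      φ γ = signDiff (L (stdSimplex.vertex 0)) (L (stdSimplex.vertex 1)) := by
  choose v hv hvF using hF
  have hex {n : ℕ} (γ : C(stdSimplex ℝ (Fin (n + 1)), X)) :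
      ∃ L : C(stdSimplex ℝ (Fin (n + 1)), D → ℝ), ∀ s, ⟦L s⟧ = F (γ s) := by
    obtain ⟨L, hL, -⟩ := existsUnique_lift (g := F.comp γ) (fun s ↦ ⟨_, hv _, hvF _⟩)
      (stdSimplex.vertex 0) _ (hvF _).symm
    exact ⟨L, congrFun hL.2⟩
  choose Λ hΛ using fun γ : C(stdSimplex ℝ (Fin 2), X) ↦ hex γ
  -- A lift of the path is compared at both ends with reference vectors `v`, chosen without any
  -- continuity. The other lift differs by a sign at both ends, so the value is the same modulo two.
  let φ : C(stdSimplex ℝ (Fin 2), X) → ZMod 2 := fun γ ↦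
    ∑ i, signDiff (Λ γ (stdSimplex.vertex i)) (v (γ (stdSimplex.vertex i)))
  have hφ (γ) (L : C(stdSimplex ℝ (Fin 2), D → ℝ)) (hL : ∀ s, ⟦L s⟧ = F (γ s)) :
      φ γ = ∑ i, signDiff (L (stdSimplex.vertex i)) (v (γ (stdSimplex.vertex i))) := by
    rcases eq_or_eq_neg_of_lifts (g := F.comp γ) (fun s ↦ ⟨_, hv _, hvF _⟩) (hΛ γ) hL with h | h
    · simp only [φ, h]
    · have key (i) : signDiff (Λ γ (stdSimplex.vertex i)) (v (γ (stdSimplex.vertex i))) =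
          1 + signDiff (L (stdSimplex.vertex i)) (v (γ (stdSimplex.vertex i))) := by
        have hL0 := ne_zero_of_lift (g := F.comp γ) (fun s ↦ ⟨_, hv _, hvF _⟩) hL
          (stdSimplex.vertex i)
        rw [h, ← signDiff_neg hL0]
        exact (signDiff_add hL0 (mk_eq_mk_iff.2 (Or.inr rfl)) ((hL _).trans (hvF _))).symm
      refine (Finset.sum_congr rfl fun i _ ↦ key i).trans ?_
      rw [Finset.sum_add_distrib]
      exact (congrArg (· + _) (by decide : ∑ _i : Fin 2, (1 : ZMod 2) = 0)).trans (zero_add _)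
  refine ⟨φ, fun σ ↦ ?_, fun γ L hL hγ ↦ ?_⟩
  · obtain ⟨L, hL⟩ := hex σ
    have hface (i : Fin 3) (j : Fin 2) :
        simplexFace i (stdSimplex.vertex j) = stdSimplex.vertex (i.succAbove j) :=
      stdSimplex.map_vertex _ _
    have h (i : Fin 3) := hφ (σ.comp (simplexFace i)) (L.comp (simplexFace i)) fun s ↦ hL _
    simp_rw [h, ContinuousMap.comp_apply, hface, Fin.sum_univ_two]
    -- One lift over the triangle restricts to lifts over its three sides, and each vertex is
    -- counted twice.
    refine (Fin.sum_univ_three _).trans ?_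
    set δ : Fin 3 → ZMod 2 := fun i ↦ signDiff (L (stdSimplex.vertex i))
      (v (σ (stdSimplex.vertex i)))
    change δ 1 + δ 2 + (δ 0 + δ 2) + (δ 0 + δ 1) = 0
    generalize δ 0 = a
    generalize δ 1 = b
    generalize δ 2 = c
    revert a b c
    decide
  -- On a closed path the two reference vectors coincide and drop out.
  · rw [hφ γ L hL, Fin.sum_univ_two, ← hγ, signDiff_comm (L (stdSimplex.vertex 1))]
    refine signDiff_add (hv _) ((hL _).trans (hvF _)) ?_
    rw [hL, ← hγ, hvF]

end SignCovering

/-! ### Every face cocycle extends to a singular cocycle -/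

namespace IdealTriangulation

variable {T : IdealTriangulation}

/-- The real sign attached to an element of `𝔽₂`. -/
def realSign (z : ZMod 2) : ℝ := if z = 0 then 1 else -1

lemma realSign_add (a b : ZMod 2) : realSign (a + b) = realSign a * realSign b := by
  have h : ∀ a : ZMod 2, a = 0 ∨ a = 1 := by decide
  have h2 : (1 + 1 : ZMod 2) = 0 := by decide
  rcases h a with rfl | rfl <;> rcases h b with rfl | rfl <;> simp [realSign, h2]

lemma realSign_eq_or (a : ZMod 2) : realSign a = 1 ∨ realSign a = -1 := by
  rw [realSign]
  split_ifs <;> simp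

lemma realSign_ne_zero (a : ZMod 2) : realSign a ≠ 0 := by
  rcases realSign_eq_or a with h | h <;> rw [h] <;> norm_num

/-- A potential in the tetrahedra of a face cocycle. -/
def tetPotential (c : T.Edge → ZMod 2) (t : Fin T.N) (a : Fin 4) : ZMod 2 := edgeValue c t 0 a

lemma tetPotential_add {c : T.Edge → ZMod 2} (hc : c ∈ T.faceCocycles) (t : Fin T.N) (a b : Fin 4) :
    tetPotential c t a + tetPotential c t b = edgeValue c t a b := by
  have h : edgeValue c t 0 a + edgeValue c t a b + edgeValue c t 0 b = 0 := hc t 0 a b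
  rw [← CharTwo.add_eq_zero, ← h, tetPotential, tetPotential]
  ring

/-- The change of the potential across a face. -/
lemma exists_shift {c : T.Edge → ZMod 2} (hc : c ∈ T.faceCocycles) (t : Fin T.N) (i : Fin 4) :
    ∃ κ, ∀ a, i ≠ a → tetPotential c (T.adj t i) (T.glue t i a) = κ + tetPotential c t a := by
  obtain ⟨j, hj⟩ := (exists_ne i).imp fun _ h ↦ h.symm
  refine ⟨tetPotential c (T.adj t i) (T.glue t i j) + tetPotential c t j, fun a ha ↦ ?_⟩
  rw [add_assoc, tetPotential_add hc, ← edgeValue_glue c t hj ha, ← tetPotential_add hc,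
    ← add_assoc, CharTwo.add_self_eq_zero, zero_add]

open Classical in
/-- The vector-valued function on the tetrahedron `t` whose sign changes are prescribed by `c`. -/
noncomputable def signVector (c : T.Edge → ZMod 2) (t : Fin T.N) (p : stdSimplex ℝ (Fin 4))
    (d : Quot (MarkedGlued (T := T))) : ℝ :=
  ∑ x : Fin 4 × Finset (Fin 4), if x.1 ∈ x.2 ∧ Quot.mk _ (t, x) = d then
    realSign (tetPotential c t x.1) * bump x.2 p else 0

lemma continuous_signVector (c : T.Edge → ZMod 2) (t : Fin T.N) : Continuous (signVector c t) := by
  refine continuous_pi fun d ↦ continuous_finsetSum _ fun x _ ↦ ?_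
  split_ifs
  · exact continuous_const.mul (continuous_bump _)
  · exact continuous_const

/-- The potentials of the cocycle on two adjacent tetrahedra differ by a constant on the common
face, so the vectors differ by one sign. Faces containing the vertex `i` do not matter, as their
bump functions vanish at `p`. -/
lemma signVector_glue {c : T.Edge → ZMod 2} (hc : c ∈ T.faceCocycles) (t : Fin T.N) {i : Fin 4}
    {p : stdSimplex ℝ (Fin 4)} (hp : p i = 0) :
    ∃ κ : ZMod 2, signVector c (T.adj t i) (stdSimplex.map (T.glue t i) p) =
      realSign κ • signVector c t p := by
  classical
  obtain ⟨κ, hκ⟩ := exists_shift hc t i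
  refine ⟨κ, funext fun d ↦ ?_⟩
  rw [Pi.smul_apply, smul_eq_mul, signVector, signVector, Finset.mul_sum]
  rw [← ((T.glue t i).prodCongr (T.glue t i).finsetCongr).sum_comp]
  refine Finset.sum_congr rfl fun x _ ↦ ?_
  change (if T.glue t i x.1 ∈ x.2.map (T.glue t i).toEmbedding ∧
    Quot.mk _ (T.adj t i, T.glue t i x.1, x.2.map (T.glue t i).toEmbedding) = d then
      realSign (tetPotential c (T.adj t i) (T.glue t i x.1)) *
        bump (x.2.map (T.glue t i).toEmbedding) (stdSimplex.map (T.glue t i) p) else 0) = _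
  rw [bump_map]
  by_cases hi : i ∈ x.2
  · simp [bump_eq_zero hi hp]
  · have h : (Quot.mk _ (t, x) : Quot (MarkedGlued (T := T))) =
        Quot.mk _ (T.adj t i, T.glue t i x.1, x.2.map (T.glue t i).toEmbedding) :=
      Quot.sound ⟨i, hi, rfl⟩
    rw [← h]
    by_cases hx : x.1 ∈ x.2
    · rw [hκ x.1 fun h ↦ hi (h ▸ hx), realSign_add]
      simp [mul_assoc]
    · simp [hx]

/-- No cancellation occurs: another marked face with the same coordinate has the same number of
vertices. If its bump function is nonzero at `p` it is the same face, and then the marking agrees by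
`eq_of_markedFace_eq`. -/
lemma signVector_eq {c : T.Edge → ZMod 2} {t : Fin T.N} {p : stdSimplex ℝ (Fin 4)} {a : Fin 4}
    {S : Finset (Fin 4)} (ha : a ∈ S) (hp : p ∈ dominated S) :
    signVector c t p (Quot.mk _ (t, a, S)) = realSign (tetPotential c t a) * bump S p := by
  rw [signVector, Finset.sum_eq_single (a, S), if_pos ⟨ha, rfl⟩]
  · rintro ⟨b, S'⟩ - hne
    split_ifs with h
    · obtain ⟨hb, h⟩ := h
      by_cases hp' : p ∈ dominated S'
      · have hcard : S'.card = S.card :=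
          congrArg (Quot.lift (fun x : T.MarkedFace ↦ x.2.2.card) fun _ _ ↦ MarkedGlued.card_eq) h
        obtain rfl := eq_of_mem_dominated hcard hp' hp
        exact absurd (congrArg (·, S') (eq_of_markedFace_eq hb ha h)) hne
      · rw [not_ne_iff.1 fun h ↦ hp' (bump_ne_zero_iff.1 h), mul_zero]
    · rfl
  · simp

lemma signVector_ne_zero (c : T.Edge → ZMod 2) (t : Fin T.N) (p : stdSimplex ℝ (Fin 4)) :
    signVector c t p ≠ 0 := by
  obtain ⟨S, ⟨a, ha⟩, hp⟩ := exists_mem_dominated p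
  refine Function.ne_iff.2 ⟨Quot.mk _ (t, a, S), ?_⟩
  rw [signVector_eq ha hp]
  exact mul_ne_zero (realSign_ne_zero _) (bump_ne_zero_iff.2 hp)

/-- At the vertex `a` only the bump function of the face `{a}` survives, so a single sign factors
out. -/
lemma signVector_vertex (c : T.Edge → ZMod 2) (t : Fin T.N) (a : Fin 4)
    (d : Quot (MarkedGlued (T := T))) : signVector c t (stdSimplex.vertex a) d =
      realSign (tetPotential c t a) * signVector 0 t (stdSimplex.vertex a) d := by
  rw [signVector, signVector, Finset.mul_sum]
  refine Finset.sum_congr rfl fun x _ ↦ ?_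
  split_ifs with h
  · by_cases hx : x.1 = a
    · rw [hx]
      simp [tetPotential, edgeValue, realSign]
    · rw [bump_eq_zero h.1 (vertex_apply_of_ne hx)]
      simp
  · simp

lemma mk_eq_mk_of_realSign {D : Type} {v w : D → ℝ} {κ : ZMod 2} (h : v = realSign κ • w) :
    (⟦v⟧ : SignQuotient D) = ⟦w⟧ := by
  rw [mk_eq_mk_iff, h]
  rcases realSign_eq_or κ with h | h <;> simp [h]

lemma signVector_zero_nonneg (t : Fin T.N) (a : Fin 4) (d : Quot (MarkedGlued (T := T))) :
    0 ≤ signVector 0 t (stdSimplex.vertex a) d := by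
  refine Finset.sum_nonneg fun x _ ↦ ?_
  split_ifs with h
  · have h1 : realSign (tetPotential (0 : T.Edge → ZMod 2) t x.1) = 1 := by
      simp [tetPotential, edgeValue, realSign]
    rw [h1, one_mul]
    exact Finset.prod_nonneg fun i _ ↦ mul_nonneg (stdSimplex.zero_le _ i)
      (Finset.prod_nonneg fun j _ ↦ le_max_left _ _)
  · exact le_rfl

lemma signDiff_realSign_smul {D : Type} {w : D → ℝ} (hw : w ≠ 0) (a b : ZMod 2) :
    signDiff (realSign a • w) (realSign b • w) = a + b := by
  have h : ∀ a : ZMod 2, a = 0 ∨ a = 1 := by decide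
  have h0 : realSign 0 • w = w := by simp [realSign]
  have h1 : realSign 1 • w = -w := by simp [realSign]
  rcases h a with rfl | rfl <;> rcases h b with rfl | rfl <;> simp only [h0, h1]
  · exact signDiff_self _
  · rw [signDiff_comm, signDiff_neg hw]
    decide
  · rw [signDiff_neg hw]
    decide
  · rw [signDiff_self]
    decide

/-- Every face cocycle is the restriction of a singular 1-cocycle. -/
theorem edgeRestrictionHom_surjective
    (hv : ∀ t t' v v', T.idealVertex t v = T.idealVertex t' v') :
    Function.Surjective (edgeRestrictionHom T) := by
  rintro ⟨c, hc⟩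
  have hD : Finite (Quot (MarkedGlued (T := T))) := inferInstance
  have := Fintype.ofFinite (Quot (MarkedGlued (T := T)))
  let F : C(T.Compactified, SignQuotient (Quot (MarkedGlued (T := T)))) :=
    ⟨Quot.lift (fun y : Fin T.N × stdSimplex ℝ (Fin 4) ↦ ⟦signVector c y.1 y.2⟧) (by
      rintro ⟨t, p⟩ ⟨_, _⟩ h
      obtain ⟨i, h1, rfl, rfl⟩ := pointGlued_iff.1 h
      obtain ⟨κ, hκ⟩ := signVector_glue hc t h1
      dsimp only
      exact (mk_eq_mk_of_realSign hκ).symm),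
      continuous_quot_lift _ (continuous_quotient_mk'.comp
        (continuous_prod_of_discrete_left.2 fun t ↦ continuous_signVector c t))⟩
  have hF (z) : ∃ v ≠ 0, F z = ⟦v⟧ := by
    induction z using Quot.inductionOn with | _ y
    exact ⟨_, signVector_ne_zero c y.1 y.2, rfl⟩
  obtain ⟨φ, hφ, h⟩ := exists_cocycle_of_signQuotient F hF
  refine ⟨⟨φ, hφ⟩, Subtype.ext (funext fun E ↦ ?_)⟩
  change edgePathValue φ _ _ _ = c E
  have hE := edgeValue_corner c (edgeCorner E)
  rw [edge_edgeCorner] at hE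
  rw [← hE, ← tetPotential_add hc]
  generalize (edgeCorner E).1 = t
  generalize (edgeCorner E).2.1 0 = a
  generalize (edgeCorner E).2.1 3 = b
  -- On a single tetrahedron `signVector` is itself a lift of `F`, so its sign change along the edge
  -- is the value of the cocycle.
  let L : C(stdSimplex ℝ (Fin 2), Quot (MarkedGlued (T := T)) → ℝ) :=
    (⟨signVector c t, continuous_signVector c t⟩ : C(stdSimplex ℝ (Fin 4), _)).comp
      (affineMap ![stdSimplex.vertex a, stdSimplex.vertex b])
  have hγ (x : Fin 2) : (T.tetMap t).comp (affineMap ![stdSimplex.vertex a, stdSimplex.vertex b])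
      (stdSimplex.vertex x) = T.idealVertex t (![a, b] x) := by
    rw [ContinuousMap.comp_apply, affineMap_vertex]
    fin_cases x <;> rfl
  have hL (x : Fin 2) : L (stdSimplex.vertex x) = signVector c t (stdSimplex.vertex (![a, b] x)) := by
    rw [ContinuousMap.comp_apply, affineMap_vertex]
    fin_cases x <;> rfl
  rw [edgePathValue, segmentValue, h _ L (fun s ↦ rfl) (by rw [hγ, hγ]; exact hv _ _ _ _), hL, hL]
  change signDiff (signVector c t (stdSimplex.vertex a)) (signVector c t (stdSimplex.vertex b)) = _
  have hw (a) : signVector c t (stdSimplex.vertex a) =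
      realSign (tetPotential c t a) • signVector 0 t (stdSimplex.vertex a) :=
    funext fun d ↦ signVector_vertex c t a d
  -- The ends of the edge are the same point of the quotient, so the two unsigned vectors agree up
  -- to sign. Both have nonnegative entries and are nonzero, which excludes the minus sign.
  have hab : signVector 0 t (stdSimplex.vertex a) = signVector 0 t (stdSimplex.vertex b) := by
    have h1 : F (T.idealVertex t a) = F (T.idealVertex t b) := by rw [hv]
    have h2 (a) : F (T.idealVertex t a) = ⟦signVector 0 t (stdSimplex.vertex a)⟧ :=
      mk_eq_mk_of_realSign (hw a)
    rw [h2, h2] at h1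
    refine (mk_eq_mk_iff.1 h1).elim id fun h3 ↦
      absurd ?_ (signVector_ne_zero 0 t (stdSimplex.vertex a))
    funext d
    have h4 := congrFun h3 d
    have h5 := signVector_zero_nonneg t a d
    have h6 := signVector_zero_nonneg t b d
    rw [Pi.neg_apply] at h4
    exact le_antisymm (h4.trans_le (neg_nonpos.2 h6)) h5
  rw [hw, hw, hab]
  exact signDiff_realSign_smul (signVector_ne_zero 0 t _) _ _

end IdealTriangulation

/-! ### The covering degree and its independence of the triangulation -/

namespace IdealTriangulation

variable {T : IdealTriangulation}

/-- In a triangulation with one vertex, the face cocycles compute the first homology. -/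
theorem card_faceCocycles_eq [T2Space T.Compactified]
    (hv : ∀ t t' v v', T.idealVertex t v = T.idealVertex t' v') :
    Nat.card ((singularChains T.Compactified).homology 1) = Nat.card T.faceCocycles :=
  card_homology_one_eq (edgeRestrictionHom T) (edgeRestrictionHom_surjective hv) fun φ ↦
    ⟨coboundary_of_edgeRestrictionHom_eq_zero φ, edgeRestrictionHom_eq_zero_of_coboundary hv φ⟩

end IdealTriangulation

open CategoryTheory in
lemma card_homology_one_eq_of_homeomorph {X Y : Type} [TopologicalSpace X] [TopologicalSpace Y]
    (e : X ≃ₜ Y) : Nat.card ((singularChains X).homology 1) =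
      Nat.card ((singularChains Y).homology 1) := by
  have i := ((AlgebraicTopology.singularHomologyFunctor (ModuleCat (ZMod 2)) 1).obj
    coeffModule).mapIso (TopCat.isoOfHomeo (X := TopCat.of X) (Y := TopCat.of Y) e)
  exact Nat.card_congr i.toLinearEquiv.toEquiv

namespace ParametrisationData

variable {M : Type} [TopologicalSpace M]

lemma hasDegree [T2Space M] [LocallyCompactSpace M] (hM : HasOneToroidalEnd M)
    (D : ParametrisationData M) : D.HasDegree (Nat.card (endCompactificationH₁ M)) := by
  obtain ⟨φ⟩ := D.triangulates
  have hv := IdealTriangulation.idealVertex_eq hM φ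
  obtain ⟨e⟩ := IdealTriangulation.nonempty_homeomorph_onePoint φ
    fun t t' v v' ↦ hv t t' v v'
  have : T2Space D.T.Compactified := e.symm.t2Space
  have h : Nat.card (endCompactificationH₁ M) = Nat.card D.T.faceCocycles :=
    (card_homology_one_eq_of_homeomorph e).symm.trans
      (IdealTriangulation.card_faceCocycles_eq fun t t' v v' ↦ hv t t' v v')
  rw [h]
  exact IdealTriangulation.isCoveringOfComponent_param D.generates
    (fun a b ↦ IdealTriangulation.eqvGen_vertexGlued (hv a.1 b.1 a.2 b.2)) D.mem D.E₀

lemma HasDegree.unique {D : ParametrisationData M} {d d' : ℕ} (h : D.HasDegree d)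
    (h' : D.HasDegree d') : d = d' := by
  have h1 := h.2.2 _ (Set.mem_range_self 1)
  rw [h'.2.2 _ (Set.mem_range_self 1)] at h1
  exact_mod_cast h1.symm

end ParametrisationData

theorem mainTheorem8 (M : Type) [TopologicalSpace M] [T2Space M] [SecondCountableTopology M]
    [ConnectedSpace M] [ChartedSpace (EuclideanSpace ℝ (Fin 3)) M] (hM : HasOneToroidalEnd M) :
    (∀ D : ParametrisationData M,
      Nat.card D.T.Edge = D.T.N ∧ D.HasDegree (Nat.card (endCompactificationH₁ M))) ∧
    ∀ (D₁ D₂ : ParametrisationData M) (d₁ d₂ : ℕ),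
      D₁.HasDegree d₁ → D₂.HasDegree d₂ → d₁ = d₂ := by
  have : LocallyCompactSpace M := ChartedSpace.locallyCompactSpace (EuclideanSpace ℝ (Fin 3)) M
  refine ⟨fun D ↦ ⟨IdealTriangulation.card_edge_eq D.mem, D.hasDegree hM⟩, ?_⟩
  intro D₁ D₂ d₁ d₂ h₁ h₂
  rw [h₁.unique (D₁.hasDegree hM), h₂.unique (D₂.hasDegree hM)]
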